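/- Let $\Bbbk$ be a field and let $S$ be a separable $\Bbbk$-algebra, that is, $S$ is projective as a module over $S\otimes_\Bbbk S^{op}$. All $S$-bimodules are modules over $S\otimes_\Bbbk S^{op}$. Let $A=\bigoplus_{n\ge 0}A^n$ be a strongly graded connected $S$-ring, that is, a graded $\Bbbk$-algebra with $A^0=S$ and $A^mA^n=A^{m+n}$ for all $m,n\geq 0$. Let $T_A=T_S(A^1)=\bigoplus_{n\ge 0} T_A^n$ be the tensor $S$-ring of $A^1$, with $T_A^{\le n}=\bigoplus_{i\le n}T_A^i$ and projections $p^n:T_A\to T_A^n$, and let $I_A$ be the kernel of the canonical morphism $T_A\to A$ which is the identity on $S$ and $A^1$. Write $\langle X\rangle$ for the two-sided ideal of $T_A$ generated by $X$. We use the following notions. * A bimodule of relations for $A$ is a graded $S$-subbimodule $R\subseteq T_A$ such that $I_A=R\oplus (I_AT_A^1+T_A^1I_A)$. Then $\langle R\rangle=I_A$, so that $T_A/\langle R\rangle\cong A$. * For an $S$-subbimodule $P\subseteq T_A$ put $P^{\le n}=P\cap T_A^{\le n}$, $R_P=\bigoplus_n p^n(P^{\le n})$, and let $U(P)=T_A/\langle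 P\rangle$, filtered by the images of the $T_A^{\le n}$. If $R\subseteq R_P$ is a bimodule of relations for $A$, then $U(P)$ is a PBW-deformation of $A$ if the canonical graded morphism $T_A/\langle R\rangle\to \operatorname{gr}U(P)$, which sends the class of $x\in T_A^n$ to the class in $\operatorname{gr}^nU(P)$ of the image of $x$ in $U(P)$, is an isomorphism. * $P$ satisfies $(\mathcal J_n)$ if $P_{n+1}\cap T_A^{\le n}\subseteq P_n$, where $P_n=\sum_{i+j+l=n}T_A^{\le i}\,P^{\le j}\,T_A^{\le l}$. * A filtered morphism $\alpha:R\to T_A$ is a morphism of $S$-bimodules such that $\alpha(R\cap T_A^{\le n})\subseteq T_A^{\le n}$ for all $n$ and $p^n(\alpha(r))=r$ for all $n$ and all $r\in R\cap T_A^n$. * The homological complexity of $A$ is $c(A)=-1$ if $\operatorname{Tor}_3^A(S,S)=0$, and otherwise $c(A)=\sup\{n-1\mid \operatorname{Tor}^A_{3,n}(S,S)\ne 0\}\in\mathbb N\cup\{\infty\}$, where $\operatorname{Tor}^A_{3,n}(S,S)$ is the component of internal degree $n$ of $\operatorname{Tor}^A_3(S,S)$. **Theorem.** There exists a bimodule of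 relations for $A$. Moreover, let $R$ be any bimodule of relations for $A$, and let $P$ be an $S$-subbimodule of $T_A$ such that $R\subseteq R_P$. Then $U(P)$ is a PBW-deformation of $A$ if and only if $\langle R\rangle=\langle R_P\rangle$ and there exists a filtered morphism of $S$-bimodules $\alpha:R\to T_A$ such that $\alpha(R)\subseteq P\subseteq\langle\alpha(R)\rangle$ and either $c(A)=-1$ or $\alpha(R)$ satisfies $(\mathcal J_n)$ for every integer $n$ with $1\le n\le c(A)$. -/

import Mathlib

open scoped TensorProduct DirectSum

noncomputable section

namespace PBW

/-! ### The tensor ring of a bimodule -/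

section TensorRing

variable (k S V : Type*) [Field k] [Ring S] [Algebra k S]
  [AddCommGroup V] [Module k V] [Module S V] [Module Sᵐᵒᵖ V]

/-- The relations which turn the tensor `k`-algebra of the vector space `S × V` into the tensor ring
of the `S`-bimodule `V`: multiplication of elements of `S` is that of `S`, and multiplying an
element of `V` by a scalar of `S` is the action of `S` on `V`. -/
inductive TensorRing.Rel : TensorAlgebra k (S × V) → TensorAlgebra k (S × V) → Prop
  | one : Rel (TensorAlgebra.ι k (1, 0)) 1
  | mul (s t : S) : Rel (TensorAlgebra.ι k (s, 0) * TensorAlgebra.ι k (t, 0))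
      (TensorAlgebra.ι k (s * t, 0))
  | left (s : S) (v : V) : Rel (TensorAlgebra.ι k (s, 0) * TensorAlgebra.ι k (0, v))
      (TensorAlgebra.ι k (0, s • v))
  | right (v : V) (s : S) : Rel (TensorAlgebra.ι k (0, v) * TensorAlgebra.ι k (s, 0))
      (TensorAlgebra.ι k (0, MulOpposite.op s • v))

/-- The tensor ring `T_S(V) = S ⊕ V ⊕ V ⊗_S V ⊕ ⋯` of an `S`-bimodule `V` over the (possibly
noncommutative) `k`-algebra `S`, presented through its universal property. The right action of `S`
on `V` is the action of `Sᵐᵒᵖ`. -/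
def TensorRing : Type _ := RingQuot (TensorRing.Rel k S V)

namespace TensorRing

instance : Ring (TensorRing k S V) := inferInstanceAs (Ring (RingQuot (TensorRing.Rel k S V)))

instance : Algebra k (TensorRing k S V) :=
  inferInstanceAs (Algebra k (RingQuot (TensorRing.Rel k S V)))

/-- The quotient map from the tensor `k`-algebra of `S × V`. -/
def mk : TensorAlgebra k (S × V) →ₐ[k] TensorRing k S V :=
  RingQuot.mkAlgHom k (TensorRing.Rel k S V)

variable {k S V} in
theorem mk_rel {x y : TensorAlgebra k (S × V)} (h : Rel k S V x y) : mk k S V x = mk k S V y :=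
  RingQuot.mkAlgHom_rel k h

/-- The structure map `S → T_S(V)`. -/
def scalar : S →ₐ[k] TensorRing k S V :=
  AlgHom.ofLinearMap
    ((mk k S V).toLinearMap ∘ₗ TensorAlgebra.ι k ∘ₗ LinearMap.inl k S V)
    (by
      have h := mk_rel (Rel.one (k := k) (S := S) (V := V))
      simpa using h)
    (fun s t => by
      have h := mk_rel (Rel.mul (k := k) (V := V) s t)
      simpa using h.symm)

/-- The inclusion `V → T_S(V)`. -/
def vec : V →ₗ[k] TensorRing k S V :=
  (mk k S V).toLinearMap ∘ₗ TensorAlgebra.ι k ∘ₗ LinearMap.inr k S V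

variable {k S V}

theorem scalar_apply (s : S) : scalar k S V s = mk k S V (TensorAlgebra.ι k (s, 0)) := rfl

theorem vec_apply (v : V) : vec k S V v = mk k S V (TensorAlgebra.ι k (0, v)) := rfl

theorem scalar_mul_vec (s : S) (v : V) :
    scalar k S V s * vec k S V v = vec k S V (s • v) := by
  have h := mk_rel (Rel.left (k := k) s v)
  simpa [scalar_apply, vec_apply] using h

theorem vec_mul_scalar (v : V) (s : S) :
    vec k S V v * scalar k S V s = vec k S V (MulOpposite.op s • v) := by
  have h := mk_rel (Rel.right (k := k) v s)
  simpa [scalar_apply, vec_apply] using h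

section lift

variable {B : Type*} [Semiring B] [Algebra k B] (f : S →ₐ[k] B) (g : V →ₗ[k] B)
  (hl : ∀ (s : S) (v : V), f s * g v = g (s • v))
  (hr : ∀ (v : V) (s : S), g v * f s = g (MulOpposite.op s • v))

/-- The universal property of `T_S(V)`: a ring morphism `f : S → B` and an `S`-bimodule morphism
`g : V → B` extend to a ring morphism `T_S(V) → B`. -/
def lift : TensorRing k S V →ₐ[k] B :=
  RingQuot.liftAlgHom k ⟨TensorAlgebra.lift k (f.toLinearMap.coprod g), fun x y h => by
    cases h with
    | one => simp
    | mul s t => simp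
    | left s v => simpa using hl s v
    | right v s => simpa using hr v s⟩

@[simp] theorem lift_scalar (s : S) : lift f g hl hr (scalar k S V s) = f s := by
  rw [scalar_apply, lift, mk]
  erw [RingQuot.liftAlgHom_mkAlgHom_apply]
  simp

@[simp] theorem lift_vec (v : V) : lift f g hl hr (vec k S V v) = g v := by
  rw [vec_apply, lift, mk]
  erw [RingQuot.liftAlgHom_mkAlgHom_apply]
  simp

end lift

theorem algHom_ext {B : Type*} [Semiring B] [Algebra k B] {φ ψ : TensorRing k S V →ₐ[k] B}
    (h₀ : ∀ s, φ (scalar k S V s) = ψ (scalar k S V s))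
    (h₁ : ∀ v, φ (vec k S V v) = ψ (vec k S V v)) : φ = ψ := by
  apply RingQuot.ringQuot_ext' k
  apply TensorAlgebra.hom_ext
  apply LinearMap.prod_ext
  · ext s
    exact h₀ s
  · ext v
    exact h₁ v

variable (k S V)

/-- The component of degree `n` of `T_S(V)`: the span of the products `s v₁ ⋯ vₙ` with `s` in `S`
and `v₁, …, vₙ` in `V`. -/
def degree (n : ℕ) : Submodule k (TensorRing k S V) :=
  LinearMap.range (scalar k S V).toLinearMap * LinearMap.range (vec k S V) ^ n

theorem range_vec_mul_range_scalar :
    LinearMap.range (vec k S V) * LinearMap.range (scalar k S V).toLinearMap ≤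
      LinearMap.range (vec k S V) := by
  rw [Submodule.mul_le]
  rintro _ ⟨v, rfl⟩ _ ⟨s, rfl⟩
  exact ⟨_, (vec_mul_scalar v s).symm⟩

theorem range_scalar_mul_self :
    LinearMap.range (scalar k S V).toLinearMap * LinearMap.range (scalar k S V).toLinearMap ≤
      LinearMap.range (scalar k S V).toLinearMap := by
  rw [Submodule.mul_le]
  rintro _ ⟨v, rfl⟩ _ ⟨s, rfl⟩
  exact ⟨v * s, by simp⟩

theorem one_le_range_scalar :
    (1 : Submodule k (TensorRing k S V)) ≤ LinearMap.range (scalar k S V).toLinearMap := by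
  rw [Submodule.one_le]
  exact ⟨1, by simp⟩

theorem pow_mul_range_scalar (n : ℕ) :
    LinearMap.range (vec k S V) ^ n * LinearMap.range (scalar k S V).toLinearMap ≤
      degree k S V n := by
  rw [degree]
  cases n with
  | zero => simp
  | succ n =>
    calc LinearMap.range (vec k S V) ^ (n + 1) * LinearMap.range (scalar k S V).toLinearMap
        = LinearMap.range (vec k S V) ^ n *
          (LinearMap.range (vec k S V) * LinearMap.range (scalar k S V).toLinearMap) := by
          rw [pow_succ, mul_assoc]
      _ ≤ LinearMap.range (vec k S V) ^ n * LinearMap.range (vec k S V) :=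
          mul_le_mul_right (range_vec_mul_range_scalar k S V) _
      _ = 1 * LinearMap.range (vec k S V) ^ (n + 1) := by rw [one_mul, pow_succ]
      _ ≤ _ := mul_le_mul_left (one_le_range_scalar k S V) _

instance : SetLike.GradedMonoid (degree k S V) where
  one_mem := by
    rw [degree, pow_zero, mul_one]
    exact ⟨1, by simp⟩
  mul_mem m n x y hx hy := by
    have key : degree k S V m * degree k S V n ≤ degree k S V (m + n) :=
      calc degree k S V m * degree k S V n
          = LinearMap.range (scalar k S V).toLinearMap *
            (LinearMap.range (vec k S V) ^ m * LinearMap.range (scalar k S V).toLinearMap) *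
              LinearMap.range (vec k S V) ^ n := by simp only [degree, mul_assoc]
        _ ≤ LinearMap.range (scalar k S V).toLinearMap * degree k S V m *
              LinearMap.range (vec k S V) ^ n :=
            mul_le_mul_left (mul_le_mul_right (pow_mul_range_scalar k S V m) _) _
        _ = LinearMap.range (scalar k S V).toLinearMap *
              LinearMap.range (scalar k S V).toLinearMap * LinearMap.range (vec k S V) ^ (m + n) := by
            simp only [degree, mul_assoc, pow_add]
        _ ≤ _ := mul_le_mul_left (range_scalar_mul_self k S V) _
    exact key (Submodule.mul_mem_mul hx hy)

theorem scalar_mem (s : S) : scalar k S V s ∈ degree k S V 0 := by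
  rw [degree, pow_zero, mul_one]
  exact ⟨s, rfl⟩

theorem vec_mem (v : V) : vec k S V v ∈ degree k S V 1 := by
  rw [degree, pow_one]
  have := Submodule.mul_mem_mul (M := LinearMap.range (scalar k S V).toLinearMap)
    (N := LinearMap.range (vec k S V)) (m := scalar k S V 1) (n := vec k S V v) ⟨1, rfl⟩ ⟨v, rfl⟩
  simpa using this

/-- The structure map `S → T_S(V)⁰ ⊆ ⨁ₙ T_S(V)ⁿ`. -/
def gradedScalar : S →ₗ[k] ⨁ n, degree k S V n :=
  DirectSum.lof k ℕ (fun n => degree k S V n) 0 ∘ₗ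
    LinearMap.codRestrict (degree k S V 0) (scalar k S V).toLinearMap (scalar_mem k S V)

/-- The inclusion `V → T_S(V)¹ ⊆ ⨁ₙ T_S(V)ⁿ`. -/
def gradedVec : V →ₗ[k] ⨁ n, degree k S V n :=
  DirectSum.lof k ℕ (fun n => degree k S V n) 1 ∘ₗ
    LinearMap.codRestrict (degree k S V 1) (vec k S V) (vec_mem k S V)

theorem gradedScalar_apply (s : S) : gradedScalar k S V s =
    DirectSum.of (fun n => degree k S V n) 0 ⟨scalar k S V s, scalar_mem k S V s⟩ := rfl

theorem gradedVec_apply (v : V) : gradedVec k S V v =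
    DirectSum.of (fun n => degree k S V n) 1 ⟨vec k S V v, vec_mem k S V v⟩ := rfl

/-- The structure map `S → T_S(V)⁰ ⊆ ⨁ₙ T_S(V)ⁿ`, as a morphism of algebras. -/
def gradedScalarHom : S →ₐ[k] ⨁ n, degree k S V n :=
  AlgHom.ofLinearMap (gradedScalar k S V)
    (by
      rw [gradedScalar_apply]
      exact congrArg (DirectSum.of (fun n => degree k S V n) 0) (Subtype.ext (by simp)))
    (fun s t => by
      simp only [gradedScalar_apply]
      rw [DirectSum.of_mul_of]
      apply DirectSum.of_eq_of_gradedMonoid_eq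
      exact Sigma.subtype_ext (zero_add 0).symm (map_mul (scalar k S V) s t))

theorem gradedScalarHom_apply (s : S) : gradedScalarHom k S V s = gradedScalar k S V s := rfl

/-- The ring morphism `T_S(V) → ⨁ₙ T_S(V)ⁿ` which splits an element into its homogeneous
components. -/
def decomposeHom : TensorRing k S V →ₐ[k] ⨁ n, degree k S V n :=
  lift (gradedScalarHom k S V) (gradedVec k S V)
    (fun s v => by
      rw [gradedScalarHom_apply, gradedScalar_apply, gradedVec_apply, gradedVec_apply,
        DirectSum.of_mul_of]
      apply DirectSum.of_eq_of_gradedMonoid_eq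
      exact Sigma.subtype_ext (zero_add 1) (scalar_mul_vec s v))
    (fun v s => by
      rw [gradedScalarHom_apply, gradedScalar_apply, gradedVec_apply, gradedVec_apply,
        DirectSum.of_mul_of]
      apply DirectSum.of_eq_of_gradedMonoid_eq
      exact Sigma.subtype_ext (add_zero 1) (vec_mul_scalar v s))

theorem decomposeHom_scalar (s : S) :
    decomposeHom k S V (scalar k S V s) = gradedScalar k S V s := by
  rw [decomposeHom, lift_scalar, gradedScalarHom_apply]

theorem decomposeHom_vec (v : V) : decomposeHom k S V (vec k S V v) = gradedVec k S V v := by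
  rw [decomposeHom, lift_vec]

theorem coeAlgHom_comp_decomposeHom :
    (DirectSum.coeAlgHom (degree k S V)).comp (decomposeHom k S V) =
      AlgHom.id k (TensorRing k S V) := by
  apply algHom_ext
  · intro s
    simp [decomposeHom_scalar, gradedScalar_apply]
  · intro v
    simp [decomposeHom_vec, gradedVec_apply]

theorem range_lof_mul_range_lof (m n : ℕ) :
    LinearMap.range (DirectSum.lof k ℕ (fun n => degree k S V n) m) *
        LinearMap.range (DirectSum.lof k ℕ (fun n => degree k S V n) n) ≤
      LinearMap.range (DirectSum.lof k ℕ (fun n => degree k S V n) (m + n)) := by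
  rw [Submodule.mul_le]
  rintro _ ⟨x, rfl⟩ _ ⟨y, rfl⟩
  simp only [DirectSum.lof_eq_of]
  rw [DirectSum.of_mul_of]
  exact ⟨_, rfl⟩

theorem map_decomposeHom_degree (n : ℕ) :
    (degree k S V n).map (decomposeHom k S V).toLinearMap ≤
      LinearMap.range (DirectSum.lof k ℕ (fun n => degree k S V n) n) := by
  have h₀ : (LinearMap.range (scalar k S V).toLinearMap).map (decomposeHom k S V).toLinearMap ≤
      LinearMap.range (DirectSum.lof k ℕ (fun n => degree k S V n) 0) := by
    rintro _ ⟨_, ⟨s, rfl⟩, rfl⟩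
    exact ⟨_, (decomposeHom_scalar k S V s).symm⟩
  have h₁ : (LinearMap.range (vec k S V)).map (decomposeHom k S V).toLinearMap ≤
      LinearMap.range (DirectSum.lof k ℕ (fun n => degree k S V n) 1) := by
    rintro _ ⟨_, ⟨v, rfl⟩, rfl⟩
    exact ⟨_, (decomposeHom_vec k S V v).symm⟩
  induction n with
  | zero => simpa [degree] using h₀
  | succ n ih =>
    have : degree k S V (n + 1) = degree k S V n * LinearMap.range (vec k S V) := by
      simp only [degree, pow_succ, mul_assoc]
    calc (degree k S V (n + 1)).map (decomposeHom k S V).toLinearMap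
        = (degree k S V n).map (decomposeHom k S V).toLinearMap *
          (LinearMap.range (vec k S V)).map (decomposeHom k S V).toLinearMap := by
          rw [this, Submodule.map_mul]
      _ ≤ _ := (mul_le_mul_of_nonneg ih h₁ bot_le bot_le).trans (range_lof_mul_range_lof k S V n 1)

theorem decomposeHom_mem (n : ℕ) (x : degree k S V n) :
    decomposeHom k S V x = DirectSum.lof k ℕ (fun n => degree k S V n) n x := by
  obtain ⟨y, hy⟩ := map_decomposeHom_degree k S V n (Submodule.mem_map_of_mem x.2)
  have h : (y : TensorRing k S V) = x := by
    have h₁ := DFunLike.congr_fun (coeAlgHom_comp_decomposeHom k S V) (x : TensorRing k S V)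
    have h₂ := congrArg (DirectSum.coeAlgHom (degree k S V)) hy
    rw [DirectSum.lof_eq_of, DirectSum.coeAlgHom_of] at h₂
    exact h₂.trans h₁
  have h' : y = x := Subtype.ext h
  rw [← h']
  rw [← h'] at hy
  exact hy.symm

/-- `T_S(V)` is a graded ring. -/
instance : GradedAlgebra (degree k S V) :=
  GradedAlgebra.ofAlgHom _ (decomposeHom k S V) (coeAlgHom_comp_decomposeHom k S V)
    (decomposeHom_mem k S V)

end TensorRing

end TensorRing
/-! ### The associated graded ring of a filtered ring -/

section AssociatedGraded

variable {k U : Type*} [Field k] [Ring U] [Algebra k U] (F : ℕ → Submodule k U)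

/-- `gr ⁿ U = Fⁿ U / Fⁿ⁻¹ U`, where `F⁻¹ U = 0`. For an increasing filtration the sum of the `Fⁱ U`
with `i < n` is `Fⁿ⁻¹ U`. -/
abbrev Gr (n : ℕ) : Type _ := F n ⧸ (⨆ i, ⨆ _ : i < n, F i).submoduleOf (F n)

/-- The class in `gr ⁿ U` of an element of `Fⁿ U`. -/
def grMk (n : ℕ) : F n →ₗ[k] Gr F n := Submodule.mkQ _

variable {F}

theorem grMk_surjective (n : ℕ) : Function.Surjective (grMk F n) := Submodule.mkQ_surjective _

theorem grMk_eq_zero {n : ℕ} (x : F n) :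
    grMk F n x = 0 ↔ (x : U) ∈ (⨆ i, ⨆ _ : i < n, F i : Submodule k U) := by
  rw [grMk, Submodule.mkQ_apply, Submodule.Quotient.mk_eq_zero]
  rfl

theorem gr_mk_eq {m n : ℕ} (h : m = n) (x : F m) (y : F n) (hxy : (x : U) = y) :
    (⟨m, grMk F m x⟩ : GradedMonoid (Gr F)) = ⟨n, grMk F n y⟩ := by
  subst h
  rw [Subtype.ext hxy]

variable [SetLike.GradedMonoid F]

theorem iSup_lt_mul_le (m n : ℕ) :
    (⨆ i, ⨆ _ : i < m, F i : Submodule k U) * F n ≤ ⨆ i, ⨆ _ : i < m + n, F i := by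
  simp only [Submodule.iSup_mul]
  refine iSup₂_le fun i hi => ?_
  refine le_trans ?_ (le_iSup₂ (f := fun i (_ : i < m + n) => F i) (i + n) (by omega))
  rw [Submodule.mul_le]
  exact fun x hx y hy => SetLike.mul_mem_graded hx hy

theorem mul_iSup_lt_le (m n : ℕ) :
    F m * (⨆ i, ⨆ _ : i < n, F i : Submodule k U) ≤ ⨆ i, ⨆ _ : i < m + n, F i := by
  simp only [Submodule.mul_iSup]
  refine iSup₂_le fun i hi => ?_
  refine le_trans ?_ (le_iSup₂ (f := fun i (_ : i < m + n) => F i) (m + i) (by omega))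
  rw [Submodule.mul_le]
  exact fun x hx y hy => SetLike.mul_mem_graded hx hy

/-- The product `Fᵐ U × Fⁿ U → Fᵐ⁺ⁿ U → gr ᵐ⁺ⁿ U`. -/
def grMulAux (m n : ℕ) : F m →ₗ[k] F n →ₗ[k] Gr F (m + n) :=
  LinearMap.mk₂ k (fun x y => grMk F (m + n) ⟨x * y, SetLike.mul_mem_graded x.2 y.2⟩)
    (fun x x' y => by
      rw [← map_add]; exact congrArg _ (Subtype.ext (add_mul _ _ _)))
    (fun c x y => by
      rw [← map_smul]; exact congrArg _ (Subtype.ext (smul_mul_assoc _ _ _)))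
    (fun x y y' => by
      rw [← map_add]; exact congrArg _ (Subtype.ext (mul_add _ _ _)))
    (fun c x y => by
      rw [← map_smul]; exact congrArg _ (Subtype.ext (mul_smul_comm _ _ _)))

/-- The product `gr ᵐ U × gr ⁿ U → gr ᵐ⁺ⁿ U`, which maps the classes of `x` and `y` to the class
of `x * y`. -/
def grMul (m n : ℕ) : Gr F m →ₗ[k] Gr F n →ₗ[k] Gr F (m + n) :=
  Submodule.liftQ _
    (LinearMap.flip (Submodule.liftQ _ (LinearMap.flip (grMulAux m n)) (by
      intro y hy
      rw [LinearMap.mem_ker]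
      ext x
      exact (grMk_eq_zero _).2 (mul_iSup_lt_le m n (Submodule.mul_mem_mul x.2 hy)))))
    (by
      intro x hx
      rw [LinearMap.mem_ker]
      ext y
      exact (grMk_eq_zero _).2 (iSup_lt_mul_le m n (Submodule.mul_mem_mul hx y.2)))

theorem grMul_mk (m n : ℕ) (x : F m) (y : F n) :
    grMul m n (grMk F m x) (grMk F n y) =
      grMk F (m + n) ⟨x * y, SetLike.mul_mem_graded x.2 y.2⟩ := rfl

instance : GradedMonoid.GMul (Gr F) where
  mul x y := grMul _ _ x y

instance : GradedMonoid.GOne (Gr F) where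
  one := grMk F 0 ⟨1, SetLike.GradedOne.one_mem⟩

/-- The associated graded ring of a filtered ring is a graded ring. -/
instance : DirectSum.GSemiring (Gr F) where
  mul_zero x := map_zero _
  zero_mul y := LinearMap.map_zero₂ (grMul _ _) y
  mul_add x y y' := map_add _ _ _
  add_mul x x' y := LinearMap.map_add₂ (grMul _ _) x x' y
  one_mul := by
    rintro ⟨n, x⟩
    obtain ⟨x, rfl⟩ := grMk_surjective n x
    exact gr_mk_eq (zero_add n) _ _ (one_mul (x : U))
  mul_one := by
    rintro ⟨n, x⟩
    obtain ⟨x, rfl⟩ := grMk_surjective n x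
    exact gr_mk_eq (add_zero n) _ _ (mul_one (x : U))
  mul_assoc := by
    rintro ⟨m, x⟩ ⟨n, y⟩ ⟨p, z⟩
    obtain ⟨x, rfl⟩ := grMk_surjective m x
    obtain ⟨y, rfl⟩ := grMk_surjective n y
    obtain ⟨z, rfl⟩ := grMk_surjective p z
    exact gr_mk_eq (add_assoc m n p) _ _ (mul_assoc (x : U) y z)
  natCast n := n • grMk F 0 ⟨1, SetLike.GradedOne.one_mem⟩
  natCast_zero := zero_smul _ _
  natCast_succ n := succ_nsmul _ _

end AssociatedGraded

/-! ### Graded rings, subbimodules and the non-homogeneous algebra -/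

section GradedRing

variable {k T : Type*} [Field k] [Ring T] [Algebra k T] (𝒯 : ℕ → Submodule k T)

/-- The standard filtration `T^{≤ n} = T⁰ ⊕ ⋯ ⊕ Tⁿ` of a graded ring. -/
def upTo (n : ℕ) : Submodule k T := ⨆ i, ⨆ _ : i ≤ n, 𝒯 i

/-- The two-sided ideal `⟨X⟩` generated by `X`. -/
abbrev idealOf (X : Submodule k T) : TwoSidedIdeal T := TwoSidedIdeal.span (X : Set T)

/-- The quotient of `T` by the two-sided ideal `⟨X⟩`. For a subbimodule `P` this is `U(P)`, and for
a graded subbimodule `R` it is `A(R)`. -/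
abbrev QuotientBy (X : Submodule k T) : Type _ := (idealOf X).ringCon.Quotient

/-- The projection `T → T / ⟨X⟩`. -/
def toQuotient (X : Submodule k T) : T →ₐ[k] QuotientBy X := RingCon.mkₐ k (idealOf X).ringCon

/-- The filtration of `U(P) = T / ⟨P⟩` by the images of the `T^{≤ n}`. -/
def quotientFiltration (P : Submodule k T) (n : ℕ) : Submodule k (QuotientBy P) :=
  (upTo 𝒯 n).map (toQuotient P).toLinearMap

/-- The homogeneous component `R_P^n = p^n(P ∩ T^{≤ n})`: the leading terms of degree `n` of elements
of `P`, together with `0`. -/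
def leadingPart [GradedAlgebra 𝒯] (P : Submodule k T) (n : ℕ) : Submodule k T :=
  (P ⊓ upTo 𝒯 n).map (GradedAlgebra.proj 𝒯 n)

/-- The graded subbimodule `R_P = ⨁ₙ R_P^n` of the leading homogeneous parts of elements of `P`. -/
def leading [GradedAlgebra 𝒯] (P : Submodule k T) : Submodule k T := ⨆ n, leadingPart 𝒯 P n

/-- `P_n = ∑_{i + j + l = n} T^{≤ i} · P^{≤ j} · T^{≤ l}`, where `P^{≤ j} = P ∩ T^{≤ j}`. -/
def jacobiTerm (P : Submodule k T) (n : ℕ) : Submodule k T :=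
  ⨆ i, ⨆ j, ⨆ l, ⨆ _ : i + j + l = n, upTo 𝒯 i * (P ⊓ upTo 𝒯 j) * upTo 𝒯 l

/-- The Jacobi condition `(J_n)`: `P_{n + 1} ∩ T^{≤ n} ⊆ P_n`. -/
def Jacobi (P : Submodule k T) (n : ℕ) : Prop :=
  jacobiTerm 𝒯 P (n + 1) ⊓ upTo 𝒯 n ≤ jacobiTerm 𝒯 P n

variable {𝒯}

theorem mem_upTo {n : ℕ} {x : T} (hx : x ∈ 𝒯 n) : x ∈ upTo 𝒯 n :=
  (le_iSup₂ (f := fun i (_ : i ≤ n) => 𝒯 i) n le_rfl) hx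

theorem toQuotient_mem (P : Submodule k T) {n : ℕ} {x : T} (hx : x ∈ 𝒯 n) :
    toQuotient P x ∈ quotientFiltration 𝒯 P n :=
  Submodule.mem_map_of_mem (mem_upTo hx)

variable [SetLike.GradedMonoid 𝒯]

instance : SetLike.GradedMonoid (upTo 𝒯) where
  one_mem := mem_upTo SetLike.GradedOne.one_mem
  mul_mem m n x y hx hy := by
    have key : upTo 𝒯 m * upTo 𝒯 n ≤ upTo 𝒯 (m + n) := by
      simp only [upTo, Submodule.iSup_mul, Submodule.mul_iSup]
      refine iSup₂_le fun j hj => iSup₂_le fun i hi => ?_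
      refine le_trans ?_ (le_iSup₂ (f := fun i (_ : i ≤ m + n) => 𝒯 i) (i + j) (by omega))
      rw [Submodule.mul_le]
      exact fun x hx y hy => SetLike.mul_mem_graded hx hy
    exact key (Submodule.mul_mem_mul hx hy)

instance (P : Submodule k T) : SetLike.GradedMonoid (quotientFiltration 𝒯 P) where
  one_mem := ⟨1, SetLike.GradedOne.one_mem, map_one (toQuotient P)⟩
  mul_mem m n x y hx hy := by
    obtain ⟨x, hx, rfl⟩ := hx
    obtain ⟨y, hy, rfl⟩ := hy
    exact ⟨x * y, SetLike.mul_mem_graded hx hy, map_mul (toQuotient P) x y⟩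

variable (𝒯)

/-- `U(P)` is a PBW-deformation of `A(R)`: the canonical map `A(R) → gr U(P)`, which sends the class
of a homogeneous element `x` of degree `n` to the class in `gr ⁿ U(P)` of the image of `x` in `U(P)`,
is (well defined and) an isomorphism of rings. -/
def IsPBWDeformation (P R : Submodule k T) : Prop :=
  ∃ Φ : QuotientBy R ≃+* ⨁ n, Gr (quotientFiltration 𝒯 P) n,
    ∀ (n : ℕ) (x : T) (hx : x ∈ 𝒯 n), Φ (toQuotient R x) =
      DirectSum.of (Gr (quotientFiltration 𝒯 P)) n
        (grMk (quotientFiltration 𝒯 P) n ⟨toQuotient P x, toQuotient_mem P hx⟩)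

end GradedRing

/-! ### Subbimodules and filtered maps -/

section Bimodules

variable {k S T : Type*} [Field k] [Ring S] [Algebra k S] [Ring T] [Algebra k T]
  (j : S →ₐ[k] T)

/-- `P` is an `S`-subbimodule of the `S`-ring `T` with structure map `j : S → T`. -/
structure IsSubbimodule (P : Submodule k T) : Prop where
  smul_mem : ∀ (s : S) (x : T), x ∈ P → j s * x ∈ P
  mul_mem : ∀ (s : S) (x : T), x ∈ P → x * j s ∈ P

/-- `α : R → T` is a morphism of filtered `S`-bimodules whose component `α₀` of degree `0` is the
inclusion of `R` into `T`. -/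
structure IsFilteredMap (𝒯 : ℕ → Submodule k T) [GradedAlgebra 𝒯] (R : Submodule k T)
    (α : R →ₗ[k] T) : Prop where
  map_smul : ∀ (s : S) (r r' : R), (r' : T) = j s * r → α r' = j s * α r
  map_mul : ∀ (s : S) (r r' : R), (r' : T) = r * j s → α r' = α r * j s
  filtered : ∀ (n : ℕ) (r : R), (r : T) ∈ upTo 𝒯 n → α r ∈ upTo 𝒯 n
  component_zero : ∀ (n : ℕ) (r : R), (r : T) ∈ 𝒯 n → GradedAlgebra.proj 𝒯 n (α r) = r

end Bimodules

/-- The `k`-algebra `S` is separable: it is projective as a module over its enveloping algebra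
`S ⊗ₖ Sᵐᵒᵖ`, that is, as a bimodule over itself. -/
def IsSeparableAlgebra (k S : Type*) [Field k] [Ring S] [Algebra k S] : Prop :=
  letI : Module (S ⊗[k] Sᵐᵒᵖ) S := instModuleTensorProductMop k S
  Module.Projective (S ⊗[k] Sᵐᵒᵖ) S

/-! ### Connected strongly graded `S`-rings

A connected graded `S`-ring is a graded algebra `A = ⨁ₙ Aⁿ` together with an identification
`e : S ≃ A⁰`. -/

section ConnectedRing

variable {k S A : Type*} [Field k] [Ring S] [Algebra k S] [Ring A] [Algebra k A]

/-- `A` is strongly graded: `Aᵐ Aⁿ = Aᵐ⁺ⁿ` for all `m` and `n`. -/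
def IsStronglyGraded (𝒜 : ℕ → Submodule k A) : Prop := ∀ m n, 𝒜 m * 𝒜 n = 𝒜 (m + n)

variable (𝒜 : ℕ → Submodule k A) [GradedAlgebra 𝒜] (e : S ≃ₐ[k] 𝒜 0)

/-- The structure map `S → A` of the `S`-ring `A`. -/
def structureMap : S →ₐ[k] A :=
  AlgHom.ofLinearMap ((𝒜 0).subtype ∘ₗ e.toLinearMap)
    (by simp)
    (fun s t => by simp)

/-- The augmentation `A → A⁰ = S`. -/
def augmentation : A →ₐ[k] S :=
  e.symm.toAlgHom.comp
    { GradedRing.projZeroRingHom' 𝒜 with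
      commutes' := fun c => by
        exact GradedRing.projZeroRingHom'_apply_coe 𝒜 (algebraMap k (𝒜 0) c) }

theorem structureMap_mem (s : S) : structureMap 𝒜 e s ∈ 𝒜 0 := (e s).2

theorem augmentation_structureMap (s : S) :
    augmentation 𝒜 e (structureMap 𝒜 e s) = s := by
  have h : GradedRing.projZeroRingHom' 𝒜 (e s) = e s :=
    GradedRing.projZeroRingHom'_apply_coe 𝒜 (e s)
  exact (congrArg e.symm h).trans (e.symm_apply_apply s)

/-- The component `A¹`, regarded as an `S`-bimodule through `e`. -/
def DegreeOne (_e : S ≃ₐ[k] 𝒜 0) : Type _ := 𝒜 1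

namespace DegreeOne

instance : AddCommGroup (DegreeOne 𝒜 e) := inferInstanceAs (AddCommGroup (𝒜 1))

instance : Module k (DegreeOne 𝒜 e) := inferInstanceAs (Module k (𝒜 1))

/-- The inclusion `A¹ ⊆ A`. -/
def incl : DegreeOne 𝒜 e →ₗ[k] A := (𝒜 1).subtype

theorem incl_injective : Function.Injective (incl 𝒜 e) := Subtype.val_injective

instance : SMul S (DegreeOne 𝒜 e) where
  smul s v := (⟨structureMap 𝒜 e s * incl 𝒜 e v, by
    have h := SetLike.mul_mem_graded (structureMap_mem 𝒜 e s) (v : 𝒜 1).2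
    rwa [zero_add] at h⟩ : 𝒜 1)

instance : SMul Sᵐᵒᵖ (DegreeOne 𝒜 e) where
  smul s v := (⟨incl 𝒜 e v * structureMap 𝒜 e s.unop, by
    have h := SetLike.mul_mem_graded (v : 𝒜 1).2 (structureMap_mem 𝒜 e s.unop)
    rwa [add_zero] at h⟩ : 𝒜 1)

theorem incl_smul (s : S) (v : DegreeOne 𝒜 e) :
    incl 𝒜 e (s • v) = structureMap 𝒜 e s * incl 𝒜 e v := rfl

theorem incl_op_smul (s : Sᵐᵒᵖ) (v : DegreeOne 𝒜 e) :
    incl 𝒜 e (s • v) = incl 𝒜 e v * structureMap 𝒜 e s.unop := rfl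

instance : Module S (DegreeOne 𝒜 e) where
  one_smul v := incl_injective 𝒜 e (by simp [incl_smul])
  mul_smul s t v := incl_injective 𝒜 e (by simp [incl_smul, mul_assoc])
  smul_zero s := incl_injective 𝒜 e (by simp [incl_smul])
  smul_add s v w := incl_injective 𝒜 e (by simp [incl_smul, mul_add])
  add_smul s t v := incl_injective 𝒜 e (by simp [incl_smul, add_mul])
  zero_smul v := incl_injective 𝒜 e (by simp [incl_smul])

instance : Module Sᵐᵒᵖ (DegreeOne 𝒜 e) where
  one_smul v := incl_injective 𝒜 e (by simp [incl_op_smul])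
  mul_smul s t v := incl_injective 𝒜 e (by simp [incl_op_smul, mul_assoc])
  smul_zero s := incl_injective 𝒜 e (by simp [incl_op_smul])
  smul_add s v w := incl_injective 𝒜 e (by simp [incl_op_smul, add_mul])
  add_smul s t v := incl_injective 𝒜 e (by simp [incl_op_smul, mul_add])
  zero_smul v := incl_injective 𝒜 e (by simp [incl_op_smul])

instance : SMulCommClass S Sᵐᵒᵖ (DegreeOne 𝒜 e) where
  smul_comm s t v := incl_injective 𝒜 e (by simp [incl_smul, incl_op_smul, mul_assoc])

instance : IsScalarTower k S (DegreeOne 𝒜 e) where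
  smul_assoc c s v := incl_injective 𝒜 e (by simp [incl_smul])

instance : IsScalarTower k Sᵐᵒᵖ (DegreeOne 𝒜 e) where
  smul_assoc c s v := incl_injective 𝒜 e (by simp [incl_op_smul])

end DegreeOne

/-- The tensor ring `T_A = T_S(A¹)`. -/
abbrev TensorCover : Type _ := TensorRing k S (DegreeOne 𝒜 e)

/-- The grading of `T_A`. -/
abbrev coverDegree : ℕ → Submodule k (TensorCover 𝒜 e) := TensorRing.degree k S (DegreeOne 𝒜 e)

/-- The structure map `S → T_A`. -/
abbrev coverScalar : S →ₐ[k] TensorCover 𝒜 e := TensorRing.scalar k S (DegreeOne 𝒜 e)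

/-- The canonical morphism `π_A : T_A → A`, which is the identity on `S` and on `A¹`. -/
def coverMap : TensorCover 𝒜 e →ₐ[k] A :=
  TensorRing.lift (structureMap 𝒜 e) (DegreeOne.incl 𝒜 e) (fun _ _ => rfl) (fun _ _ => rfl)

/-- The ideal `I_A`, the kernel of `π_A : T_A → A`. -/
def relationIdeal : Submodule k (TensorCover 𝒜 e) := LinearMap.ker (coverMap 𝒜 e).toLinearMap

/-- `I_A T_A¹ + T_A¹ I_A`. -/
def decomposableRelations : Submodule k (TensorCover 𝒜 e) :=
  relationIdeal 𝒜 e * coverDegree 𝒜 e 1 ⊔ coverDegree 𝒜 e 1 * relationIdeal 𝒜 e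

/-- `R` is a bimodule of relations for `A`: a graded subbimodule of `T_A` with
`I_A = R ⊕ (I_A T_A¹ + T_A¹ I_A)`. -/
structure IsBimoduleOfRelations (R : Submodule k (TensorCover 𝒜 e)) : Prop where
  isSubbimodule : IsSubbimodule (coverScalar 𝒜 e) R
  isHomogeneous : DirectSum.SetLike.IsHomogeneous (coverDegree 𝒜 e) R
  inf_eq : R ⊓ decomposableRelations 𝒜 e = ⊥
  sup_eq : R ⊔ decomposableRelations 𝒜 e = relationIdeal 𝒜 e

/-! ### The bigraded group `Tor^A(S, S)` in homological degree three

As `k` is a field, `A ⊗ A^{⊗ n} ⊗ S` (tensor products over `k`) is a free graded left `A`-module, and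
these modules form the bar resolution of the left `A`-module `S = A / A⁺`. Applying `S ⊗_A (-)` gives
the complex with terms `S ⊗ A^{⊗ n} ⊗ S`, whose homology is `Tor^A_n(S, S)`. The internal degree of
`s ⊗ a₁ ⊗ ⋯ ⊗ aₙ ⊗ t` is the sum of the degrees of the `aᵢ`. -/

/-- `S ⊗ A ⊗ A ⊗ S`. -/
abbrev BarTwo (k S A : Type*) [Field k] [Ring S] [Algebra k S] [Ring A] [Algebra k A] : Type _ :=
  S ⊗[k] (A ⊗[k] (A ⊗[k] S))

/-- `S ⊗ A ⊗ A ⊗ A ⊗ S`. -/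
abbrev BarThree (k S A : Type*) [Field k] [Ring S] [Algebra k S] [Ring A] [Algebra k A] : Type _ :=
  S ⊗[k] (A ⊗[k] (A ⊗[k] (A ⊗[k] S)))

/-- `S ⊗ A ⊗ A ⊗ A ⊗ A ⊗ S`. -/
abbrev BarFour (k S A : Type*) [Field k] [Ring S] [Algebra k S] [Ring A] [Algebra k A] : Type _ :=
  S ⊗[k] (A ⊗[k] (A ⊗[k] (A ⊗[k] (A ⊗[k] S))))

/-- The right action of `A` on `S` in the first factor: `s ⊗ a ⊗ x ↦ s ε(a) ⊗ x`, where `ε` is the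
augmentation. -/
def barFirst (X : Type*) [AddCommGroup X] [Module k X] : S ⊗[k] (A ⊗[k] X) →ₗ[k] S ⊗[k] X :=
  (LinearMap.mul' k S ∘ₗ (augmentation 𝒜 e).toLinearMap.lTensor S).rTensor X ∘ₗ
    (TensorProduct.assoc k S A X).symm.toLinearMap

/-- The multiplication of two neighbouring factors: `a ⊗ b ⊗ x ↦ a b ⊗ x`. -/
def barMul (k A X : Type*) [Field k] [Ring A] [Algebra k A] [AddCommGroup X] [Module k X] :
    A ⊗[k] (A ⊗[k] X) →ₗ[k] A ⊗[k] X :=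
  (LinearMap.mul' k A).rTensor X ∘ₗ (TensorProduct.assoc k A A X).symm.toLinearMap

/-- The left action of `A` on `S`: `a ⊗ t ↦ ε(a) t`. -/
def barLast : A ⊗[k] S →ₗ[k] S :=
  LinearMap.mul' k S ∘ₗ (augmentation 𝒜 e).toLinearMap.rTensor S

/-- The differential `S ⊗ A^{⊗ 3} ⊗ S → S ⊗ A^{⊗ 2} ⊗ S`. -/
def barDiffThree : BarThree k S A →ₗ[k] BarTwo k S A :=
  barFirst 𝒜 e _
    - (barMul k A _).lTensor S
    + ((barMul k A _).lTensor A).lTensor S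
    - (((barLast 𝒜 e).lTensor A).lTensor A).lTensor S

/-- The differential `S ⊗ A^{⊗ 4} ⊗ S → S ⊗ A^{⊗ 3} ⊗ S`. -/
def barDiffFour : BarFour k S A →ₗ[k] BarThree k S A :=
  barFirst 𝒜 e _
    - (barMul k A _).lTensor S
    + ((barMul k A _).lTensor A).lTensor S
    - (((barMul k A _).lTensor A).lTensor A).lTensor S
    + ((((barLast 𝒜 e).lTensor A).lTensor A).lTensor A).lTensor S

theorem barDiffThree_tmul (s t : S) (a b c : A) :
    barDiffThree 𝒜 e (s ⊗ₜ (a ⊗ₜ (b ⊗ₜ (c ⊗ₜ t)))) =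
      (s * augmentation 𝒜 e a) ⊗ₜ (b ⊗ₜ (c ⊗ₜ t)) - s ⊗ₜ ((a * b) ⊗ₜ (c ⊗ₜ t))
        + s ⊗ₜ (a ⊗ₜ ((b * c) ⊗ₜ t)) - s ⊗ₜ (a ⊗ₜ (b ⊗ₜ (augmentation 𝒜 e c * t))) := by
  simp [barDiffThree, barFirst, barMul, barLast]

theorem barDiffFour_tmul (s t : S) (a b c d : A) :
    barDiffFour 𝒜 e (s ⊗ₜ (a ⊗ₜ (b ⊗ₜ (c ⊗ₜ (d ⊗ₜ t))))) =
      (s * augmentation 𝒜 e a) ⊗ₜ (b ⊗ₜ (c ⊗ₜ (d ⊗ₜ t))) - s ⊗ₜ ((a * b) ⊗ₜ (c ⊗ₜ (d ⊗ₜ t)))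
        + s ⊗ₜ (a ⊗ₜ ((b * c) ⊗ₜ (d ⊗ₜ t))) - s ⊗ₜ (a ⊗ₜ (b ⊗ₜ ((c * d) ⊗ₜ t)))
        + s ⊗ₜ (a ⊗ₜ (b ⊗ₜ (c ⊗ₜ (augmentation 𝒜 e d * t)))) := by
  simp [barDiffFour, barFirst, barMul, barLast]

theorem barDiffThree_comp_barDiffFour : barDiffThree 𝒜 e ∘ₗ barDiffFour 𝒜 e = 0 := by
  ext s a b c d t
  simp only [TensorProduct.AlgebraTensorModule.curry_apply, TensorProduct.curry_apply,
    LinearMap.restrictScalars_self, LinearMap.comp_apply, LinearMap.zero_apply, barDiffFour_tmul,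
    map_add, map_sub, barDiffThree_tmul, map_mul, mul_assoc]
  abel

/-- The part of internal degree `m` of `S ⊗ A^{⊗ 3} ⊗ S`. -/
def barThreeDegree (m : ℕ) : Submodule k (BarThree k S A) :=
  Submodule.span k {x | ∃ (p q r : ℕ) (s t : S) (a : 𝒜 p) (b : 𝒜 q) (c : 𝒜 r),
    p + q + r = m ∧ x = s ⊗ₜ ((a : A) ⊗ₜ ((b : A) ⊗ₜ ((c : A) ⊗ₜ t)))}

/-- The part of internal degree `m` of `S ⊗ A^{⊗ 4} ⊗ S`. -/
def barFourDegree (m : ℕ) : Submodule k (BarFour k S A) :=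
  Submodule.span k {x | ∃ (p q r u : ℕ) (s t : S) (a : 𝒜 p) (b : 𝒜 q) (c : 𝒜 r) (d : 𝒜 u),
    p + q + r + u = m ∧ x = s ⊗ₜ ((a : A) ⊗ₜ ((b : A) ⊗ₜ ((c : A) ⊗ₜ ((d : A) ⊗ₜ t))))}

theorem augmentation_eq_zero {p : ℕ} (hp : p ≠ 0) {a : A} (ha : a ∈ 𝒜 p) :
    augmentation 𝒜 e a = 0 := by
  have h : GradedRing.projZeroRingHom' 𝒜 a = 0 := by
    apply Subtype.ext
    rw [GradedRing.coe_projZeroRingHom'_apply, GradedRing.projZeroRingHom_apply,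
      DirectSum.decompose_of_mem_ne 𝒜 ha hp]
    rfl
  exact (congrArg e.symm h).trans (map_zero e.symm)

/-- The differential preserves the internal degree. -/
theorem map_barDiffFour_le (m : ℕ) :
    (barFourDegree 𝒜 m).map (barDiffFour 𝒜 e) ≤ barThreeDegree 𝒜 m := by
  have key : ∀ {p q r : ℕ} (s t : S) {a b c : A}, a ∈ 𝒜 p → b ∈ 𝒜 q → c ∈ 𝒜 r → p + q + r = m →
      (s ⊗ₜ (a ⊗ₜ (b ⊗ₜ (c ⊗ₜ t))) : BarThree k S A) ∈ barThreeDegree 𝒜 m :=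
    fun {p q r} s t {a b c} ha hb hc h => by
      rw [barThreeDegree]
      exact Submodule.subset_span ⟨p, q, r, s, t, ⟨a, ha⟩, ⟨b, hb⟩, ⟨c, hc⟩, h, rfl⟩
  rw [barFourDegree, Submodule.map_span_le]
  rintro _ ⟨p, q, r, u, s, t, ⟨a, ha⟩, ⟨b, hb⟩, ⟨c, hc⟩, ⟨d, hd⟩, h, rfl⟩
  rw [barDiffFour_tmul]
  refine add_mem (sub_mem (add_mem (sub_mem ?_ ?_) ?_) ?_) ?_
  · by_cases hp : p = 0
    · exact key _ _ hb hc hd (by omega)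
    · rw [augmentation_eq_zero 𝒜 e hp ha, mul_zero, TensorProduct.zero_tmul]
      exact zero_mem _
  · exact key _ _ (SetLike.mul_mem_graded ha hb) hc hd (by omega)
  · exact key _ _ ha (SetLike.mul_mem_graded hb hc) hd (by omega)
  · exact key _ _ ha hb (SetLike.mul_mem_graded hc hd) (by omega)
  · by_cases hu : u = 0
    · exact key _ _ ha hb hc (by omega)
    · rw [augmentation_eq_zero 𝒜 e hu hd, zero_mul]
      simp

/-- The subquotient `Z / (Z ∩ B)`, which is `Z / B` if `B ⊆ Z`. -/
abbrev Subquotient {k X : Type*} [Field k] [AddCommGroup X] [Module k X] (Z B : Submodule k X) :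
    Type _ := Z ⧸ B.submoduleOf Z

/-- The cycles of homological degree `3` and internal degree `m`. -/
def torCycles (m : ℕ) : Submodule k (BarThree k S A) :=
  LinearMap.ker (barDiffThree 𝒜 e) ⊓ barThreeDegree 𝒜 m

/-- The boundaries of homological degree `3` and internal degree `m`. -/
def torBoundaries (m : ℕ) : Submodule k (BarThree k S A) :=
  (barFourDegree 𝒜 m).map (barDiffFour 𝒜 e)

theorem torBoundaries_le_torCycles (m : ℕ) : torBoundaries 𝒜 e m ≤ torCycles 𝒜 e m := by
  refine le_inf ?_ (map_barDiffFour_le 𝒜 e m)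
  rintro _ ⟨x, -, rfl⟩
  exact DFunLike.congr_fun (barDiffThree_comp_barDiffFour 𝒜 e) x

/-- `Tor^A_{3,m}(S, S)`: the cycles of homological degree `3` and internal degree `m` modulo the
boundaries of internal degree `m`. -/
abbrev TorThree (m : ℕ) : Type _ := Subquotient (torCycles 𝒜 e m) (torBoundaries 𝒜 e m)

open Classical in
/-- The homological complexity `c(A)`: it is `-1` if `Tor^A_3(S, S) = 0`, and otherwise it is
`sup {m - 1 | Tor^A_{3,m}(S, S) ≠ 0}`, which may be infinite. -/
def homologicalComplexity : EReal :=
  if ∀ m, Subsingleton (TorThree 𝒜 e m) then -1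
  else sSup {x : EReal | ∃ m : ℕ, Nontrivial (TorThree 𝒜 e m) ∧ x = (m : EReal) - 1}

end ConnectedRing

end PBW

end

noncomputable section

namespace PBW

/-! ### Filtered graded algebras: leading components and the submodules P_n. -/

section GradedGeneralities

variable {k T : Type*} [Field k] [Ring T] [Algebra k T] (𝒯 : ℕ → Submodule k T)

/-! Write V = A¹, T = T_A, I = I_A, and Q = α(R) for a filtered lift α of R. In degree n the leading
terms of Q_n are always exactly Iⁿ (`proj_mem_relationIdeal`, `exists_lift`). If every (J_n) holds,
then ⟨Q⟩ ∩ T^{≤n} = Q_n, so when ⟨P⟩ = ⟨Q⟩ the leading terms of ⟨P⟩ make up I = ⟨R⟩, which is the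
PBW property (`isPBWDeformation_of_jacobi`). Conversely, the PBW property puts every leading term of
⟨P⟩ into I; subtracting a lift and descending in degree gives ⟨P⟩ ∩ T^{≤n} ⊆ Q_n, hence all (J_n)
and P ⊆ ⟨Q⟩ (`IsPBWDeformation.mem_jacobiTerm`). What remains concerns Q alone: (J_0) is automatic,
and (J_N) implies (J_{N+1}) whenever Tor_3 vanishes in internal degree N + 2
(`IsFilteredMap.jacobi_succ`).

For this step, an element of Q_{N+2} ∩ T^{≤N+1} is, modulo Q_{N+1}, a sum a + b with a ∈ V Q_{N+1},
b ∈ Q_{N+1} V and leading terms r and -r, where r ∈ VI ∩ IV; a contribution of α(R^{N+2}) is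
excluded because R is a complement of IV + VI. By (J_N), lifts of I^{N+1} to Q_{N+1} are unique
modulo Q_N. If g is an S-bilinear such lift, a and b are therefore determined modulo Q_{N+1} by (id
⊗ g)(r) and -(g ⊗ id)(r). The two lifts of r agree modulo Q_{N+1} as soon as r ∈ II + T⁺IT⁺.

That r lies there is where Tor_3 enters (`mem_deepRelations`). The universal derivation of T turns r
into a cycle of the bar complex. A map built from the curvature of a section A → T sends this cycle
back to r modulo II + T⁺IT⁺, and sends boundaries into II + T⁺IT⁺.

Separability supplies a Casimir element of S ⊗ S. Averaging with it makes all linear choices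
S-bilinear, and inserting it into tensors over k replaces tensor products over S. -/

theorem upTo_mono {m n : ℕ} (h : m ≤ n) : upTo 𝒯 m ≤ upTo 𝒯 n :=
  iSup₂_le fun i hi => le_iSup₂ (f := fun i (_ : i ≤ n) => 𝒯 i) i (hi.trans h)

theorem upTo_le_iff {n : ℕ} {C : Submodule k T} : upTo 𝒯 n ≤ C ↔ ∀ i ≤ n, 𝒯 i ≤ C :=
  iSup₂_le_iff

variable {𝒯} in
theorem mem_of_mem_upTo_zero {x : T} (hx : x ∈ upTo 𝒯 0) : x ∈ 𝒯 0 := by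
  have : upTo 𝒯 0 ≤ 𝒯 0 := (upTo_le_iff 𝒯).2 fun i hi => by
    obtain rfl : i = 0 := by omega
    exact le_rfl
  exact this hx

variable {𝒯} in
theorem mul_mem_jacobiTerm (P : Submodule k T) {i j l n : ℕ} (h : i + j + l = n) {a x b : T} (ha : a ∈ upTo 𝒯 i)
    (hx : x ∈ P) (hx' : x ∈ upTo 𝒯 j) (hb : b ∈ upTo 𝒯 l) : a * x * b ∈ jacobiTerm 𝒯 P n := by
  have h₁ : upTo 𝒯 i * (P ⊓ upTo 𝒯 j) * upTo 𝒯 l ≤ jacobiTerm 𝒯 P n := by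
    rw [jacobiTerm]
    exact (le_iSup_of_le i <| le_iSup_of_le j <| le_iSup_of_le l <| le_iSup_of_le h le_rfl)
  exact h₁ (Submodule.mul_mem_mul (Submodule.mul_mem_mul ha ⟨hx, hx'⟩) hb)

variable {𝒯} in
theorem jacobiTerm_le_iff (P : Submodule k T) {n : ℕ} {C : Submodule k T} :
    jacobiTerm 𝒯 P n ≤ C ↔ ∀ i j l, i + j + l = n → ∀ a ∈ upTo 𝒯 i, ∀ x ∈ P, x ∈ upTo 𝒯 j →
      ∀ b ∈ upTo 𝒯 l, a * x * b ∈ C := by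
  constructor
  · intro h i j l hn a ha x hx hx' b hb
    exact h (mul_mem_jacobiTerm P hn ha hx hx' hb)
  · intro h
    rw [jacobiTerm]
    refine iSup_le fun i => iSup_le fun j => iSup_le fun l => iSup_le fun hn => ?_
    rw [Submodule.mul_le]
    intro y hy b hb
    have : upTo 𝒯 i * (P ⊓ upTo 𝒯 j) ≤ C.comap (LinearMap.mulRight k b) := by
      rw [Submodule.mul_le]
      exact fun a ha x hx => h i j l hn a ha x hx.1 hx.2 b hb
    exact this hy

variable {𝒯} in
theorem mem_idealOf_of_mem_jacobiTerm {P : Submodule k T} {n : ℕ} {x : T} (hx : x ∈ jacobiTerm 𝒯 P n) :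
    x ∈ idealOf P := by
  have : jacobiTerm 𝒯 P n ≤ LinearMap.ker (toQuotient P).toLinearMap := by
    rw [jacobiTerm_le_iff]
    intro i j l _ a _ x hx _ b _
    have h : x ∈ idealOf P := TwoSidedIdeal.subset_span hx
    have h' : a * x * b ∈ idealOf P :=
      TwoSidedIdeal.mul_mem_right _ _ _ (TwoSidedIdeal.mul_mem_left _ _ _ h)
    exact (RingCon.eq _).2 h'
  exact (RingCon.eq _).1 (this hx)

variable [GradedAlgebra 𝒯]

theorem proj_mem (n : ℕ) (x : T) : GradedAlgebra.proj 𝒯 n x ∈ 𝒯 n := by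
  rw [GradedAlgebra.proj_apply]
  exact SetLike.coe_mem _

variable {𝒯} in
theorem proj_of_mem {n : ℕ} {x : T} (hx : x ∈ 𝒯 n) : GradedAlgebra.proj 𝒯 n x = x := by
  rw [GradedAlgebra.proj_apply, DirectSum.decompose_of_mem_same 𝒯 hx]

variable {𝒯} in
theorem proj_of_mem_ne {m n : ℕ} {x : T} (hx : x ∈ 𝒯 m) (h : m ≠ n) :
    GradedAlgebra.proj 𝒯 n x = 0 := by
  rw [GradedAlgebra.proj_apply, DirectSum.decompose_of_mem_ne 𝒯 hx h]

theorem mem_of_forall_proj_mem {C : Submodule k T} {x : T}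
    (h : ∀ n, GradedAlgebra.proj 𝒯 n x ∈ C) : x ∈ C := by
  classical
  rw [← DirectSum.sum_support_decompose 𝒯 x]
  exact sum_mem fun i _ => h i

theorem mem_upTo_iff {n : ℕ} {x : T} :
    x ∈ upTo 𝒯 n ↔ ∀ m, n < m → GradedAlgebra.proj 𝒯 m x = 0 := by
  constructor
  · intro hx m hm
    have : upTo 𝒯 n ≤ LinearMap.ker (GradedAlgebra.proj 𝒯 m) :=
      (upTo_le_iff 𝒯).2 fun i hi y hy => proj_of_mem_ne hy (by omega)
    exact this hx
  · intro h
    refine mem_of_forall_proj_mem 𝒯 fun m => ?_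
    rcases le_or_gt m n with hm | hm
    · exact upTo_mono 𝒯 hm (mem_upTo (proj_mem 𝒯 m x))
    · rw [h m hm]
      exact zero_mem _

theorem exists_mem_upTo (x : T) : ∃ n, x ∈ upTo 𝒯 n := by
  induction x using DirectSum.Decomposition.inductionOn 𝒯 with
  | zero => exact ⟨0, zero_mem _⟩
  | homogeneous x => exact ⟨_, mem_upTo x.2⟩
  | add x y hx hy =>
    obtain ⟨m, hm⟩ := hx
    obtain ⟨n, hn⟩ := hy
    exact ⟨max m n, add_mem (upTo_mono 𝒯 (le_max_left _ _) hm)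
      (upTo_mono 𝒯 (le_max_right _ _) hn)⟩

variable {𝒯} in
theorem mem_upTo_of_proj_eq_zero {n : ℕ} {x : T} (hx : x ∈ upTo 𝒯 (n + 1))
    (h : GradedAlgebra.proj 𝒯 (n + 1) x = 0) : x ∈ upTo 𝒯 n := by
  rw [mem_upTo_iff] at hx ⊢
  intro m hm
  rcases eq_or_lt_of_le (Nat.succ_le_of_lt hm) with rfl | h'
  · exact h
  · exact hx m h'

variable {𝒯} in
theorem proj_eq_zero_of_mem_upTo {m n : ℕ} {x : T} (hx : x ∈ upTo 𝒯 n) (h : n < m) :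
    GradedAlgebra.proj 𝒯 m x = 0 :=
  (mem_upTo_iff 𝒯).1 hx m h

theorem proj_proj (n : ℕ) (x : T) :
    GradedAlgebra.proj 𝒯 n (GradedAlgebra.proj 𝒯 n x) = GradedAlgebra.proj 𝒯 n x :=
  proj_of_mem (proj_mem 𝒯 n x)

variable {𝒯} in
theorem sub_proj_mem_upTo {n : ℕ} {x : T} (hx : x ∈ upTo 𝒯 (n + 1)) :
    x - GradedAlgebra.proj 𝒯 (n + 1) x ∈ upTo 𝒯 n :=
  mem_upTo_of_proj_eq_zero (sub_mem hx (mem_upTo (proj_mem 𝒯 _ x)))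
    (by rw [map_sub, proj_proj, sub_self])

variable {𝒯} in
theorem mul_mem_upTo {i j n : ℕ} {x y : T} (hx : x ∈ upTo 𝒯 i) (hy : y ∈ upTo 𝒯 j)
    (h : i + j ≤ n) : x * y ∈ upTo 𝒯 n :=
  upTo_mono 𝒯 h (SetLike.mul_mem_graded hx hy)

variable {𝒯} in
-- Leading terms are multiplicative. Both sides are bilinear, so it suffices to test homogeneous
-- factors, and only the pair of top degrees reaches degree i + j.
theorem proj_mul {i j : ℕ} {x y : T} (hx : x ∈ upTo 𝒯 i) (hy : y ∈ upTo 𝒯 j) :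
    GradedAlgebra.proj 𝒯 (i + j) (x * y) =
      GradedAlgebra.proj 𝒯 i x * GradedAlgebra.proj 𝒯 j y := by
  let B : T →ₗ[k] T →ₗ[k] T := (LinearMap.mul k T).compr₂ (GradedAlgebra.proj 𝒯 (i + j)) -
    (LinearMap.mul k T).compl₁₂ (GradedAlgebra.proj 𝒯 i) (GradedAlgebra.proj 𝒯 j)
  have hB : ∀ x y, B x y = GradedAlgebra.proj 𝒯 (i + j) (x * y) -
      GradedAlgebra.proj 𝒯 i x * GradedAlgebra.proj 𝒯 j y := fun x y => by simp [B]
  have h₁ : ∀ a ≤ i, ∀ b ≤ j, ∀ x ∈ 𝒯 a, ∀ y ∈ 𝒯 b, B x y = 0 := by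
    intro a ha b hb x hxa y hyb
    rw [hB]
    have hxy := SetLike.mul_mem_graded hxa hyb
    by_cases h : a = i ∧ b = j
    · obtain ⟨rfl, rfl⟩ := h
      rw [proj_of_mem hxa, proj_of_mem hyb, proj_of_mem hxy, sub_self]
    · rw [proj_of_mem_ne hxy (by omega)]
      rcases ne_or_eq a i with h' | h'
      · rw [proj_of_mem_ne hxa h', zero_mul, sub_zero]
      · rw [proj_of_mem_ne hyb (fun h'' => h ⟨h', h''⟩), mul_zero, sub_zero]
  have h₂ : ∀ a ≤ i, ∀ x ∈ 𝒯 a, B x y = 0 := fun a ha x hx => by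
    have : upTo 𝒯 j ≤ LinearMap.ker (B x) :=
      (upTo_le_iff 𝒯).2 fun b hb y hy => h₁ a ha b hb x hx y hy
    exact this hy
  have h₃ : upTo 𝒯 i ≤ LinearMap.ker (B.flip y) :=
    (upTo_le_iff 𝒯).2 fun a ha x hx => h₂ a ha x hx
  have h₄ : B x y = 0 := h₃ hx
  rw [hB] at h₄
  exact sub_eq_zero.1 h₄

theorem isHomogeneous_iff {C : Submodule k T} :
    DirectSum.SetLike.IsHomogeneous 𝒯 C ↔ ∀ n, ∀ x ∈ C, GradedAlgebra.proj 𝒯 n x ∈ C :=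
  Iff.rfl

theorem proj_mem_leadingPart {P : Submodule k T} {n : ℕ} {x : T} (hx : x ∈ leading 𝒯 P) :
    GradedAlgebra.proj 𝒯 n x ∈ leadingPart 𝒯 P n := by
  have : leading 𝒯 P ≤ (leadingPart 𝒯 P n).comap (GradedAlgebra.proj 𝒯 n) := by
    refine iSup_le fun m => ?_
    rintro _ ⟨y, hy, rfl⟩
    rw [Submodule.mem_comap]
    by_cases h : m = n
    · subst h
      rw [proj_proj]
      exact ⟨y, hy, rfl⟩
    · rw [proj_of_mem_ne (proj_mem 𝒯 m y) h]
      exact zero_mem _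
  exact this hx

/-! ### The filtration of an ideal by the submodules `P_n` -/

variable {𝒯} (P : Submodule k T)

theorem one_mem_upTo (n : ℕ) : (1 : T) ∈ upTo 𝒯 n :=
  upTo_mono 𝒯 (Nat.zero_le n) (mem_upTo SetLike.GradedOne.one_mem)

variable {P}

theorem mem_jacobiTerm {n : ℕ} {x : T} (hx : x ∈ P) (hx' : x ∈ upTo 𝒯 n) :
    x ∈ jacobiTerm 𝒯 P n := by
  have := mul_mem_jacobiTerm P (zero_add n) (one_mem_upTo 0) hx hx' (one_mem_upTo (𝒯 := 𝒯) 0)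
  simpa using this

theorem left_mul_mem_jacobiTerm {m n p : ℕ} {a x : T} (ha : a ∈ upTo 𝒯 m)
    (hx : x ∈ jacobiTerm 𝒯 P n) (h : m + n ≤ p) : a * x ∈ jacobiTerm 𝒯 P p := by
  have : jacobiTerm 𝒯 P n ≤ (jacobiTerm 𝒯 P p).comap (LinearMap.mulLeft k a) := by
    rw [jacobiTerm_le_iff]
    intro i j l hn b hb x hx hx' c hc
    rw [Submodule.mem_comap, LinearMap.mulLeft_apply, ← mul_assoc, ← mul_assoc]
    exact mul_mem_jacobiTerm (i := p - j - l) P (by omega)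
      (mul_mem_upTo ha hb (by omega)) hx hx' hc
  exact this hx

theorem right_mul_mem_jacobiTerm {m n p : ℕ} {x a : T} (hx : x ∈ jacobiTerm 𝒯 P n)
    (ha : a ∈ upTo 𝒯 m) (h : n + m ≤ p) : x * a ∈ jacobiTerm 𝒯 P p := by
  have : jacobiTerm 𝒯 P n ≤ (jacobiTerm 𝒯 P p).comap (LinearMap.mulRight k a) := by
    rw [jacobiTerm_le_iff]
    intro i j l hn b hb x hx hx' c hc
    rw [Submodule.mem_comap, LinearMap.mulRight_apply, mul_assoc]
    exact mul_mem_jacobiTerm (l := p - i - j) P (by omega) hb hx hx'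
      (mul_mem_upTo hc ha (by omega))
  exact this hx

theorem jacobiTerm_mono {m n : ℕ} (h : m ≤ n) : jacobiTerm 𝒯 P m ≤ jacobiTerm 𝒯 P n :=
  fun x hx => by simpa using left_mul_mem_jacobiTerm (one_mem_upTo (𝒯 := 𝒯) 0) hx (by omega)

theorem jacobiTerm_le_upTo (n : ℕ) : jacobiTerm 𝒯 P n ≤ upTo 𝒯 n := by
  rw [jacobiTerm_le_iff]
  exact fun i j l hn a ha x _ hx' b hb =>
    mul_mem_upTo (mul_mem_upTo ha hx' le_rfl) hb (by omega)

variable (𝒯) in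
-- The submodules P_n exhaust the ideal because multiplication by an element of filtration m maps
-- P_n into P_{m+n}. The index found here is not controlled by the filtration of x; the Jacobi
-- conditions repair exactly this.
theorem exists_mem_jacobiTerm {x : T} (hx : x ∈ idealOf P) : ∃ n, x ∈ jacobiTerm 𝒯 P n := by
  induction hx using TwoSidedIdeal.span_induction with
  | mem x hx =>
    obtain ⟨n, hn⟩ := exists_mem_upTo 𝒯 x
    exact ⟨n, mem_jacobiTerm hx hn⟩
  | zero => exact ⟨0, zero_mem _⟩
  | add x y _ _ hx hy =>
    obtain ⟨m, hm⟩ := hx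
    obtain ⟨n, hn⟩ := hy
    exact ⟨max m n, add_mem (jacobiTerm_mono (le_max_left _ _) hm)
      (jacobiTerm_mono (le_max_right _ _) hn)⟩
  | neg x _ hx =>
    obtain ⟨m, hm⟩ := hx
    exact ⟨m, neg_mem hm⟩
  | left_absorb a x _ hx =>
    obtain ⟨m, hm⟩ := hx
    obtain ⟨n, hn⟩ := exists_mem_upTo 𝒯 a
    exact ⟨n + m, left_mul_mem_jacobiTerm hn hm le_rfl⟩
  | right_absorb a x _ hx =>
    obtain ⟨m, hm⟩ := hx
    obtain ⟨n, hn⟩ := exists_mem_upTo 𝒯 a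
    exact ⟨m + n, right_mul_mem_jacobiTerm hm hn le_rfl⟩

/-- If `P` satisfies all Jacobi conditions, then `⟨P⟩ ∩ T^{≤ n} = P_n`. -/
theorem mem_jacobiTerm_of_mem_upTo (hJ : ∀ n, Jacobi 𝒯 P n) {n : ℕ} {x : T} (hx : x ∈ idealOf P)
    (hx' : x ∈ upTo 𝒯 n) : x ∈ jacobiTerm 𝒯 P n := by
  obtain ⟨m, hm⟩ := exists_mem_jacobiTerm 𝒯 hx
  -- The index is lowered one unit at a time: x stays in T^{≤n}, so (J_{n+d}) applies at every
  -- stage.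
  have key : ∀ d, x ∈ jacobiTerm 𝒯 P (n + d) → x ∈ jacobiTerm 𝒯 P n := by
    intro d
    induction d with
    | zero => exact id
    | succ d ih => exact fun h => ih (hJ (n + d) ⟨h, upTo_mono 𝒯 (Nat.le_add_right n d) hx'⟩)
  exact key m (jacobiTerm_mono (Nat.le_add_left m n) hm)

/-! ### A criterion for PBW-deformations -/

theorem toQuotient_eq_zero_iff {x : T} : toQuotient P x = 0 ↔ x ∈ idealOf P := by
  have h : toQuotient P x = toQuotient P 0 ↔ (idealOf P).ringCon x 0 := RingCon.eq _
  rw [map_zero] at h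
  exact h

/-- The image of x drops in filtration when x is congruent modulo ⟨P⟩ to some z of lower filtration,
and then x - z lies in ⟨P⟩ with leading term x. This describes the kernel of Tⁿ → grⁿ U(P). -/
theorem mem_iSup_lt_quotientFiltration {n : ℕ} {x : T} (hx : x ∈ 𝒯 n) :
    toQuotient P x ∈ (⨆ i, ⨆ _ : i < n, quotientFiltration 𝒯 P i : Submodule k (QuotientBy P)) ↔
      ∃ y ∈ idealOf P, y ∈ upTo 𝒯 n ∧ GradedAlgebra.proj 𝒯 n y = x := by
  constructor
  · intro h
    obtain ⟨z, hz, hz'⟩ : ∃ z ∈ (⨆ i, ⨆ _ : i < n, upTo 𝒯 i : Submodule k T),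
        toQuotient P z = toQuotient P x := by
      have : (⨆ i, ⨆ _ : i < n, quotientFiltration 𝒯 P i : Submodule k (QuotientBy P)) =
          (⨆ i, ⨆ _ : i < n, upTo 𝒯 i : Submodule k T).map (toQuotient P).toLinearMap := by
        simp only [Submodule.map_iSup, quotientFiltration]
      rw [this] at h
      exact h
    have hz₁ : z ∈ upTo 𝒯 n := by
      have : (⨆ i, ⨆ _ : i < n, upTo 𝒯 i : Submodule k T) ≤ upTo 𝒯 n :=
        iSup₂_le fun i hi => upTo_mono 𝒯 hi.le
      exact this hz
    have hz₂ : GradedAlgebra.proj 𝒯 n z = 0 := by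
      have : (⨆ i, ⨆ _ : i < n, upTo 𝒯 i : Submodule k T) ≤
          LinearMap.ker (GradedAlgebra.proj 𝒯 n) :=
        iSup₂_le fun i hi y hy => proj_eq_zero_of_mem_upTo hy hi
      exact this hz
    refine ⟨x - z, ?_, sub_mem (mem_upTo hx) hz₁, ?_⟩
    · rw [← toQuotient_eq_zero_iff, map_sub, hz', sub_self]
    · rw [map_sub, hz₂, proj_of_mem hx, sub_zero]
  · rintro ⟨y, hy, hyn, rfl⟩
    have h₀ := toQuotient_eq_zero_iff.2 hy
    cases n with
    -- For n = 0 the supremum is empty, so the image itself has to vanish.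
    | zero =>
      rw [proj_of_mem (mem_of_mem_upTo_zero hyn), h₀]
      exact zero_mem _
    | succ n =>
      have h₁ : toQuotient P (GradedAlgebra.proj 𝒯 (n + 1) y) =
          -toQuotient P (y - GradedAlgebra.proj 𝒯 (n + 1) y) := by
        rw [map_sub, h₀, zero_sub, neg_neg]
      rw [h₁]
      refine neg_mem ?_
      exact (le_iSup₂ (f := fun i (_ : i < n + 1) => quotientFiltration 𝒯 P i) n (Nat.lt_succ_self n))
        (Submodule.mem_map_of_mem (sub_proj_mem_upTo hyn))

/-- Injectivity of the canonical map: a leading term of ⟨P⟩ is zero in gr U(P), hence already zero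
in T/⟨R⟩. -/
theorem IsPBWDeformation.proj_mem_idealOf {R : Submodule k T} (h : IsPBWDeformation 𝒯 P R) {n : ℕ}
    {x : T} (hx : x ∈ idealOf P) (hx' : x ∈ upTo 𝒯 n) :
    GradedAlgebra.proj 𝒯 n x ∈ idealOf R := by
  obtain ⟨Φ, hΦ⟩ := h
  rw [← toQuotient_eq_zero_iff]
  apply Φ.injective
  rw [hΦ n _ (proj_mem 𝒯 n x), map_zero]
  have : grMk (quotientFiltration 𝒯 P) n
      ⟨_, toQuotient_mem P (proj_mem 𝒯 n x)⟩ = 0 :=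
    (grMk_eq_zero _).2 ((mem_iSup_lt_quotientFiltration (proj_mem 𝒯 n x)).2 ⟨x, hx, hx', rfl⟩)
  rw [this, map_zero]

variable (𝒯) (P) in
/-- The canonical map `Tⁿ → gr ⁿ U(P)`. -/
def toGrPart (n : ℕ) : 𝒯 n →+ Gr (quotientFiltration 𝒯 P) n where
  toFun x := grMk (quotientFiltration 𝒯 P) n ⟨toQuotient P x, toQuotient_mem P x.2⟩
  map_zero' := by
    rw [← map_zero (grMk (quotientFiltration 𝒯 P) n)]
    exact congrArg _ (Subtype.ext (map_zero _))
  map_add' x y := by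
    rw [← map_add]
    exact congrArg _ (Subtype.ext (map_add _ _ _))

theorem toGrPart_surjective (n : ℕ) : Function.Surjective (toGrPart 𝒯 P n) := by
  intro y
  obtain ⟨⟨_, ⟨x, hx, rfl⟩⟩, rfl⟩ := grMk_surjective n y
  refine ⟨⟨_, proj_mem 𝒯 n x⟩, ?_⟩
  change grMk (quotientFiltration 𝒯 P) n
    ⟨toQuotient P (GradedAlgebra.proj 𝒯 n x), toQuotient_mem P (proj_mem 𝒯 n x)⟩ = _
  rw [← sub_eq_zero, ← map_sub, grMk_eq_zero]
  change toQuotient P (GradedAlgebra.proj 𝒯 n x) - toQuotient P x ∈ _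
  rw [← map_sub]
  cases n with
  | zero =>
    rw [proj_of_mem (mem_of_mem_upTo_zero hx), sub_self, map_zero]
    exact zero_mem _
  | succ n =>
    refine (le_iSup₂ (f := fun i (_ : i < n + 1) => quotientFiltration 𝒯 P i) n
      (Nat.lt_succ_self n)) (Submodule.mem_map_of_mem ?_)
    rw [← neg_mem_iff, neg_sub]
    exact sub_proj_mem_upTo hx

variable (𝒯) (P) in
/-- The canonical map `T → gr U(P)`. -/
def toGr : T →+* ⨁ n, Gr (quotientFiltration 𝒯 P) n :=
  (DirectSum.toSemiring
    (fun n => (DirectSum.of (Gr (quotientFiltration 𝒯 P)) n).comp (toGrPart 𝒯 P n))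
    (by
      refine congrArg (DirectSum.of (Gr (quotientFiltration 𝒯 P)) 0)
        (congrArg (grMk (quotientFiltration 𝒯 P) 0) (Subtype.ext ?_))
      exact map_one (toQuotient P))
    (by
      intro i j x y
      rw [AddMonoidHom.comp_apply, AddMonoidHom.comp_apply, AddMonoidHom.comp_apply,
        DirectSum.of_mul_of]
      refine congrArg (DirectSum.of (Gr (quotientFiltration 𝒯 P)) (i + j))
        (congrArg (grMk (quotientFiltration 𝒯 P) (i + j)) (Subtype.ext ?_))
      exact map_mul (toQuotient P) _ _)).comp
  (DirectSum.decomposeRingEquiv 𝒯 : T →+* ⨁ n, 𝒯 n)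

theorem toGr_of_mem {n : ℕ} {x : T} (hx : x ∈ 𝒯 n) : toGr 𝒯 P x =
    DirectSum.of (Gr (quotientFiltration 𝒯 P)) n
      (grMk (quotientFiltration 𝒯 P) n ⟨toQuotient P x, toQuotient_mem P hx⟩) := by
  rw [toGr, RingHom.comp_apply]
  change DirectSum.toSemiring _ _ _ (DirectSum.decompose 𝒯 x) = _
  rw [DirectSum.decompose_of_mem 𝒯 hx, DirectSum.toSemiring_of]
  rfl

theorem toGr_apply (x : T) :
    toGr 𝒯 P x = DirectSum.map (toGrPart 𝒯 P) (DirectSum.decompose 𝒯 x) := by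
  induction x using DirectSum.Decomposition.inductionOn 𝒯 with
  | zero => rw [map_zero, DirectSum.decompose_zero, map_zero]
  | homogeneous x =>
    rw [toGr_of_mem x.2, DirectSum.decompose_coe, DirectSum.map_of]
    rfl
  | add x y hx hy => rw [map_add, DirectSum.decompose_add, map_add, hx, hy]

theorem toGr_surjective : Function.Surjective (toGr 𝒯 P) := by
  intro y
  induction y using DirectSum.induction_on with
  | zero => exact ⟨0, map_zero _⟩
  | of n y =>
    obtain ⟨x, rfl⟩ := toGrPart_surjective n y
    exact ⟨x, toGr_of_mem x.2⟩
  | add y z hy hz =>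
    obtain ⟨x, rfl⟩ := hy
    obtain ⟨x', rfl⟩ := hz
    exact ⟨x + x', map_add _ _ _⟩

theorem toGr_eq_iff {x y : T} : toGr 𝒯 P x = toGr 𝒯 P y ↔ ∀ n, ∃ z ∈ idealOf P,
    z ∈ upTo 𝒯 n ∧ GradedAlgebra.proj 𝒯 n z = GradedAlgebra.proj 𝒯 n (x - y) := by
  rw [toGr_apply, toGr_apply, DFinsupp.ext_iff]
  refine forall_congr' fun n => ?_
  rw [← mem_iSup_lt_quotientFiltration (proj_mem 𝒯 n (x - y)), map_sub, map_sub]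
  change grMk (quotientFiltration 𝒯 P) n
      ⟨toQuotient P (GradedAlgebra.proj 𝒯 n x), toQuotient_mem P (proj_mem 𝒯 n x)⟩ =
    grMk (quotientFiltration 𝒯 P) n
      ⟨toQuotient P (GradedAlgebra.proj 𝒯 n y), toQuotient_mem P (proj_mem 𝒯 n y)⟩ ↔ _
  rw [← sub_eq_zero, ← map_sub, grMk_eq_zero]
  rfl

/-- `U(P)` is a PBW-deformation of `T / ⟨R⟩` as soon as the ideal `⟨R⟩` consists of the elements all
of whose homogeneous components are leading terms of elements of `⟨P⟩`. -/
theorem isPBWDeformation_of_forall {R : Submodule k T}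
    (h : ∀ x, x ∈ idealOf R ↔ ∀ n, ∃ y ∈ idealOf P, y ∈ upTo 𝒯 n ∧
      GradedAlgebra.proj 𝒯 n y = GradedAlgebra.proj 𝒯 n x) : IsPBWDeformation 𝒯 P R := by
  -- The hypothesis says that ⟨R⟩ and `toGr` define the same congruence; the first isomorphism
  -- theorem then gives the isomorphism.
  have hker : (idealOf R).ringCon = RingCon.ker (toGr 𝒯 P) := by
    ext x y
    rw [TwoSidedIdeal.rel_iff, h, RingCon.ker_apply, toGr_eq_iff]
  refine ⟨RingEquiv.ofBijective (RingCon.lift (idealOf R).ringCon (toGr 𝒯 P) hker.le) ⟨?_, ?_⟩, ?_⟩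
  · exact (RingCon.lift_injective_iff).2 hker
  · exact RingCon.lift_surjective_of_surjective hker.le toGr_surjective
  · intro n x hx
    exact toGr_of_mem hx

end GradedGeneralities

/-! ### Separability: the Casimir element and averaging. -/

section Separable

variable {k S : Type*} [Field k] [Ring S] [Algebra k S]

variable (k) in
/-- `∑ᵢ xᵢ ⊗ yᵢ` is a separability idempotent of `S`. -/
structure IsCasimir {n : ℕ} (x y : Fin n → S) : Prop where
  sum_mul : ∑ i, x i * y i = 1
  comm : ∀ s : S, ∑ i, (s * x i) ⊗ₜ[k] y i = ∑ i, x i ⊗ₜ[k] (y i * s)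

/-- Projectivity splits the surjection S ⊗ Sᵒᵖ → S, and the element sought is the image of 1 under
the splitting. It multiplies to 1 because the splitting is a section, and it commutes with S because
s ⊗ 1 and 1 ⊗ s act in the same way on 1. -/
theorem IsSeparableAlgebra.exists_isCasimir (hS : IsSeparableAlgebra k S) :
    ∃ (n : ℕ) (x y : Fin n → S), IsCasimir k x y := by
  let _ : Module (S ⊗[k] Sᵐᵒᵖ) S := instModuleTensorProductMop k S
  have : Module.Projective (S ⊗[k] Sᵐᵒᵖ) S := hS
  have hsmul : ∀ (s t m : S), (s ⊗ₜ[k] MulOpposite.op t : S ⊗[k] Sᵐᵒᵖ) • m = s * (m * t) :=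
    fun s t m => TensorProduct.Algebra.smul_def s (MulOpposite.op t) m
  let f : S ⊗[k] Sᵐᵒᵖ →ₗ[S ⊗[k] Sᵐᵒᵖ] S := LinearMap.toSpanSingleton _ S 1
  have hf : Function.Surjective f := fun s => ⟨s ⊗ₜ 1, by
    have := hsmul s 1 1
    simpa [f] using this⟩
  obtain ⟨g, hg⟩ := Module.projective_lifting_property f LinearMap.id hf
  have hg' : ∀ s, f (g s) = s := fun s => DFunLike.congr_fun hg s
  obtain ⟨m, x, y, hxy⟩ : ∃ (m : ℕ) (x y : Fin m → S),
      g 1 = ∑ i, x i ⊗ₜ[k] MulOpposite.op (y i) := by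
    induction g 1 using TensorProduct.induction_on with
    | zero => exact ⟨0, Fin.elim0, Fin.elim0, by simp⟩
    | tmul a b => exact ⟨1, fun _ => a, fun _ => b.unop, by simp⟩
    | add u v hu hv =>
      obtain ⟨m, x, y, rfl⟩ := hu
      obtain ⟨m', x', y', rfl⟩ := hv
      refine ⟨m + m', Fin.append x x', Fin.append y y', ?_⟩
      simp [Fin.sum_univ_add]
  refine ⟨m, x, y, ?_, fun s => ?_⟩
  · have h := hg' 1
    rw [hxy, map_sum] at h
    rw [← h]
    refine Finset.sum_congr rfl fun i _ => ?_
    have := hsmul (x i) (y i) 1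
    rw [one_mul] at this
    exact this.symm
  · have h₁ : (s ⊗ₜ[k] 1 : S ⊗[k] Sᵐᵒᵖ) * g 1 = (1 ⊗ₜ[k] MulOpposite.op s) * g 1 := by
      rw [← smul_eq_mul, ← smul_eq_mul, ← map_smul, ← map_smul]
      have h₁ := hsmul s 1 1
      have h₂ := hsmul 1 s 1
      rw [one_mul, mul_one] at h₁
      rw [one_mul, one_mul] at h₂
      exact congrArg g (h₁.trans h₂.symm)
    rw [hxy, Finset.mul_sum, Finset.mul_sum] at h₁
    simp only [Algebra.TensorProduct.tmul_mul_tmul, one_mul, ← MulOpposite.op_mul] at h₁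
    have h₂ := congrArg ((MulOpposite.opLinearEquiv k (M := S)).symm.toLinearMap.lTensor S) h₁
    simpa using h₂

namespace IsCasimir

variable {n : ℕ} {x y : Fin n → S} (h : IsCasimir k x y)
include h

theorem sum_apply {X : Type*} [AddCommGroup X] [Module k X] (β : S →ₗ[k] S →ₗ[k] X) (s : S) :
    ∑ i, β (s * x i) (y i) = ∑ i, β (x i) (y i * s) := by
  have := congrArg (TensorProduct.lift β) (h.comm s)
  simpa using this

end IsCasimir

/-! ### Averaging linear maps -/

section Average

variable {B C : Type*} [Ring B] [Algebra k B] [Ring C] [Algebra k C] (j : S →ₐ[k] B)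
  (j' : S →ₐ[k] C) {n : ℕ} (x y : Fin n → S)

/-- The average `b ↦ ∑ᵢₗ xᵢ g(yᵢ b xₗ) yₗ` of a linear map, which is a morphism of `S`-bimodules. -/
def average (g : B →ₗ[k] C) : B →ₗ[k] C :=
  ∑ i, ∑ l, LinearMap.mulLeft k (j' (x i)) ∘ₗ LinearMap.mulRight k (j' (y l)) ∘ₗ g ∘ₗ
    LinearMap.mulLeft k (j (y i)) ∘ₗ LinearMap.mulRight k (j (x l))

variable {x y}

theorem average_apply (g : B →ₗ[k] C) (b : B) : average j j' x y g b =
    ∑ i, ∑ l, j' (x i) * (g (j (y i) * (b * j (x l))) * j' (y l)) := by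
  simp [average]

theorem IsCasimir.average_smul (h : IsCasimir k x y) (g : B →ₗ[k] C) (s : S) (b : B) :
    average j j' x y g (j s * b) = j' s * average j j' x y g b := by
  rw [average_apply, average_apply, Finset.sum_comm]
  conv_rhs => rw [Finset.sum_comm, Finset.mul_sum]
  refine Finset.sum_congr rfl fun l _ => ?_
  have := h.sum_apply (LinearMap.mk₂ k
    (fun u v : S => j' u * (g (j v * (b * j (x l))) * j' (y l)))
    (fun _ _ _ => by simp only [map_add, add_mul]) (fun _ _ _ => by simp only [map_smul, smul_mul_assoc])
    (fun _ _ _ => by simp only [map_add, add_mul, mul_add])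
    (fun _ _ _ => by simp only [map_smul, smul_mul_assoc, mul_smul_comm])) s
  simp only [LinearMap.mk₂_apply, map_mul, mul_assoc] at this
  simp only [mul_assoc, Finset.mul_sum]
  exact this.symm

theorem IsCasimir.average_mul (h : IsCasimir k x y) (g : B →ₗ[k] C) (s : S) (b : B) :
    average j j' x y g (b * j s) = average j j' x y g b * j' s := by
  rw [average_apply, average_apply, Finset.sum_mul]
  refine Finset.sum_congr rfl fun i _ => ?_
  have := h.sum_apply (LinearMap.mk₂ k
    (fun u v : S => j' (x i) * (g (j (y i) * (b * j u)) * j' v))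
    (fun _ _ _ => by simp only [map_add, add_mul, mul_add])
    (fun _ _ _ => by simp only [map_smul, smul_mul_assoc, mul_smul_comm])
    (fun _ _ _ => by simp only [map_add, mul_add])
    (fun _ _ _ => by simp only [map_smul, mul_smul_comm])) s
  simp only [LinearMap.mk₂_apply, map_mul] at this
  simp only [mul_assoc, Finset.sum_mul]
  exact this

theorem IsCasimir.sum_sum_eq (h : IsCasimir k x y) (c : C) :
    ∑ i, ∑ l, j' (x i) * ((j' (y i) * (c * j' (x l))) * j' (y l)) = c := by
  have : ∀ i l, j' (x i) * ((j' (y i) * (c * j' (x l))) * j' (y l)) =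
      j' (x i * y i) * c * j' (x l * y l) := fun i l => by simp only [map_mul, mul_assoc]
  simp only [this, ← Finset.mul_sum, ← Finset.sum_mul, ← map_sum, h.sum_mul, map_one, one_mul,
    mul_one]

/-- Averaging keeps the value at b if g is already bilinear along S b S. In this way prescribed
values of a linear map survive the passage to a bimodule map. -/
theorem IsCasimir.average_eq (h : IsCasimir k x y) (g : B →ₗ[k] C) (b : B) (c : C)
    (hb : ∀ s t, g (j s * (b * j t)) = j' s * (c * j' t)) : average j j' x y g b = c := by
  rw [average_apply]
  simp only [hb]
  exact h.sum_sum_eq j' c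

theorem average_mem (g : B →ₗ[k] C) {P : Submodule k C} (hP : IsSubbimodule j' P) {b : B}
    (hb : ∀ s t, g (j s * (b * j t)) ∈ P) : average j j' x y g b ∈ P := by
  rw [average_apply]
  exact sum_mem fun i _ => sum_mem fun l _ => hP.smul_mem _ _ (hP.mul_mem _ _ (hb _ _))

/-- A linear map is a morphism of `S`-bimodules. -/
structure IsBimoduleMap (g : B →ₗ[k] C) : Prop where
  map_smul : ∀ s b, g (j s * b) = j' s * g b
  map_mul : ∀ s b, g (b * j s) = g b * j' s

theorem IsCasimir.isBimoduleMap_average (h : IsCasimir k x y) (g : B →ₗ[k] C) :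
    IsBimoduleMap j j' (average j j' x y g) :=
  ⟨h.average_smul j j' g, h.average_mul j j' g⟩

end Average

/-! ### Bimodule choices and gluing by degree. -/

section Choice

variable {T : Type*} [Ring T] [Algebra k T]

/-- The pairs (w, x) with x - w ∈ Y form a space surjecting onto W. Over a field this surjection
splits, and the resulting map extends from W to T. -/
theorem exists_linear_choice {W X Y : Submodule k T} (h : ∀ w ∈ W, ∃ x ∈ X, x - w ∈ Y) :
    ∃ g : T →ₗ[k] T, ∀ w ∈ W, g w ∈ X ∧ g w - w ∈ Y := by
  let Z : Submodule k (W × X) := Y.comap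
    (X.subtype ∘ₗ LinearMap.snd k W X - W.subtype ∘ₗ LinearMap.fst k W X)
  let f : Z →ₗ[k] W := LinearMap.fst k W X ∘ₗ Z.subtype
  have hf : Function.Surjective f := fun w => by
    obtain ⟨x, hx, hxw⟩ := h w w.2
    exact ⟨⟨(w, ⟨x, hx⟩), hxw⟩, rfl⟩
  obtain ⟨g, hg⟩ := f.exists_rightInverse_of_surjective (LinearMap.range_eq_top.2 hf)
  obtain ⟨g', hg'⟩ := LinearMap.exists_extend (X.subtype ∘ₗ LinearMap.snd k W X ∘ₗ Z.subtype ∘ₗ g)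
  refine ⟨g', fun w hw => ?_⟩
  have h₁ : g' w = ((g ⟨w, hw⟩ : W × X).2 : T) := DFunLike.congr_fun hg' (⟨w, hw⟩ : W)
  have h₂ : ((g ⟨w, hw⟩ : W × X).1 : T) = w :=
    congrArg Subtype.val (DFunLike.congr_fun hg (⟨w, hw⟩ : W))
  have h₃ : ((g ⟨w, hw⟩ : W × X).2 : T) - ((g ⟨w, hw⟩ : W × X).1 : T) ∈ Y := (g ⟨w, hw⟩).2
  rw [h₁]
  refine ⟨SetLike.coe_mem _, ?_⟩
  rwa [h₂] at h₃

/-- The average of a linear choice stays in X, and since the identity is its own average, its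
difference with the identity is the average of a map with values in Y. With Y the kernel of a
projection, this yields bilinear lifts with prescribed leading terms. -/
theorem IsCasimir.exists_bimodule_choice {n : ℕ} {x y : Fin n → S} (h : IsCasimir k x y)
    (j : S →ₐ[k] T) {W X Y : Submodule k T} (hW : IsSubbimodule j W) (hX : IsSubbimodule j X)
    (hY : IsSubbimodule j Y) (hWX : ∀ w ∈ W, ∃ x ∈ X, x - w ∈ Y) :
    ∃ g : T →ₗ[k] T, IsBimoduleMap j j g ∧ ∀ w ∈ W, g w ∈ X ∧ g w - w ∈ Y := by
  obtain ⟨g, hg⟩ := exists_linear_choice hWX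
  refine ⟨average j j x y g, h.isBimoduleMap_average j j g, fun w hw => ⟨?_, ?_⟩⟩
  · exact average_mem j j g hX fun s t => (hg _ (hW.smul_mem _ _ (hW.mul_mem _ _ hw))).1
  · have h₁ : average j j x y g w - w = average j j x y (g - LinearMap.id) w := by
      have h₂ := h.sum_sum_eq j w
      rw [average_apply, average_apply]
      nth_rw 2 [← h₂]
      simp only [← Finset.sum_sub_distrib, ← mul_sub, ← sub_mul, LinearMap.sub_apply,
        LinearMap.id_apply]
    rw [h₁]
    exact average_mem j j _ hY fun s t => (hg _ (hW.smul_mem _ _ (hW.mul_mem _ _ hw))).2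

variable (𝒯 : ℕ → Submodule k T) [GradedAlgebra 𝒯]

/-- The linear map which coincides with `g n` in degree `n`. -/
def gradedGlue (g : ℕ → T →ₗ[k] T) : T →ₗ[k] T :=
  DirectSum.toModule k ℕ T (fun n => g n ∘ₗ (𝒯 n).subtype) ∘ₗ
    (DirectSum.decomposeLinearEquiv 𝒯).toLinearMap

variable {𝒯}

theorem gradedGlue_of_mem (g : ℕ → T →ₗ[k] T) {n : ℕ} {x : T} (hx : x ∈ 𝒯 n) :
    gradedGlue 𝒯 g x = g n x := by
  rw [gradedGlue, LinearMap.comp_apply]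
  change DirectSum.toModule k ℕ T _ (DirectSum.decompose 𝒯 x) = _
  rw [DirectSum.decompose_of_mem 𝒯 hx, ← DirectSum.lof_eq_of k, DirectSum.toModule_lof]
  rfl

theorem isBimoduleMap_gradedGlue (j : S →ₐ[k] T) (hj : ∀ s, j s ∈ 𝒯 0) {g : ℕ → T →ₗ[k] T}
    (hg : ∀ n, IsBimoduleMap j j (g n)) : IsBimoduleMap j j (gradedGlue 𝒯 g) := by
  constructor
  · intro s b
    induction b using DirectSum.Decomposition.inductionOn 𝒯 with
    | zero => simp
    | @homogeneous n b =>
      have h := SetLike.mul_mem_graded (hj s) b.2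
      rw [zero_add] at h
      rw [gradedGlue_of_mem g h, gradedGlue_of_mem g b.2, (hg n).map_smul]
    | add b c hb hc => rw [mul_add, map_add, map_add, mul_add, hb, hc]
  · intro s b
    induction b using DirectSum.Decomposition.inductionOn 𝒯 with
    | zero => simp
    | @homogeneous n b =>
      have h := SetLike.mul_mem_graded b.2 (hj s)
      rw [add_zero] at h
      rw [gradedGlue_of_mem g h, gradedGlue_of_mem g b.2, (hg n).map_mul]
    | add b c hb hc => rw [add_mul, map_add, map_add, add_mul, hb, hc]

end Choice

end Separable

/-! ### Generation of the tensor ring by S and V. -/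

namespace TensorRing

variable {k S V : Type*} [Field k] [Ring S] [Algebra k S]
  [AddCommGroup V] [Module k V] [Module S V] [Module Sᵐᵒᵖ V]

/-- The universal property factors the identity of T_S(V) through B. -/
theorem subalgebra_eq_top {B : Subalgebra k (TensorRing k S V)} (hs : ∀ s, scalar k S V s ∈ B)
    (hv : ∀ v, vec k S V v ∈ B) : B = ⊤ := by
  let φ : TensorRing k S V →ₐ[k] B := lift
    ((scalar k S V).codRestrict B hs)
    ((vec k S V).codRestrict (Subalgebra.toSubmodule B) hv)
    (fun s v => Subtype.ext (scalar_mul_vec s v))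
    (fun v s => Subtype.ext (vec_mul_scalar v s))
  have hφ : B.val.comp φ = AlgHom.id k _ := by
    apply algHom_ext
    · intro s
      rw [AlgHom.comp_apply, lift_scalar]
      rfl
    · intro v
      rw [AlgHom.comp_apply, lift_vec]
      rfl
  rw [eq_top_iff]
  intro a _
  have : (φ a : TensorRing k S V) = a := DFunLike.congr_fun hφ a
  rw [← this]
  exact (φ a).2

@[elab_as_elim]
theorem induction {p : TensorRing k S V → Prop} (hs : ∀ s, p (scalar k S V s))
    (hv : ∀ v, p (vec k S V v)) (hadd : ∀ a b, p a → p b → p (a + b))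
    (hmul : ∀ a b, p a → p b → p (a * b)) (a : TensorRing k S V) : p a := by
  let B : Subalgebra k (TensorRing k S V) :=
    { carrier := {a | p a}
      mul_mem' := fun ha hb => hmul _ _ ha hb
      add_mem' := fun ha hb => hadd _ _ ha hb
      algebraMap_mem' := fun c => by
        have := hs (algebraMap k S c)
        rwa [AlgHom.commutes] at this }
  have : a ∈ B := by
    rw [subalgebra_eq_top (B := B) hs hv]
    exact Algebra.mem_top
  exact this

variable (k S V)

theorem degree_zero : degree k S V 0 = LinearMap.range (scalar k S V).toLinearMap := by
  rw [degree, pow_zero, mul_one]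

theorem degree_one : degree k S V 1 = LinearMap.range (vec k S V) := by
  apply le_antisymm
  · rw [degree, pow_one, Submodule.mul_le]
    rintro _ ⟨s, rfl⟩ _ ⟨v, rfl⟩
    exact ⟨s • v, (scalar_mul_vec s v).symm⟩
  · rintro _ ⟨v, rfl⟩
    exact vec_mem k S V v

theorem degree_succ (n : ℕ) : degree k S V (n + 1) = degree k S V n * degree k S V 1 := by
  rw [degree_one, degree, degree, pow_succ, mul_assoc]

theorem degree_succ' (n : ℕ) : degree k S V (n + 1) = degree k S V 1 * degree k S V n := by
  apply le_antisymm
  · have h : degree k S V (n + 1) = degree k S V 1 * LinearMap.range (vec k S V) ^ n := by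
      rw [degree, degree, pow_succ', pow_one, mul_assoc]
    rw [h]
    refine mul_le_mul_right ?_ _
    calc LinearMap.range (vec k S V) ^ n = 1 * LinearMap.range (vec k S V) ^ n := (one_mul _).symm
      _ ≤ degree k S V n := mul_le_mul_left (one_le_range_scalar k S V) _
  · rw [Submodule.mul_le]
    intro x hx y hy
    have := SetLike.mul_mem_graded hx hy
    rwa [add_comm] at this

variable {k S V}

theorem mem_degree_succ_induction {n : ℕ} {C : Submodule k (TensorRing k S V)}
    (h : ∀ t ∈ degree k S V n, ∀ v, t * vec k S V v ∈ C) : degree k S V (n + 1) ≤ C := by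
  rw [degree_succ, degree_one, Submodule.mul_le]
  rintro t ht _ ⟨v, rfl⟩
  exact h t ht v

theorem mem_degree_succ_induction' {n : ℕ} {C : Submodule k (TensorRing k S V)}
    (h : ∀ v, ∀ t ∈ degree k S V n, vec k S V v * t ∈ C) : degree k S V (n + 1) ≤ C := by
  rw [degree_succ', degree_one, Submodule.mul_le]
  rintro _ ⟨v, rfl⟩ t ht
  exact h v t ht

end TensorRing

/-! ### The universal derivation -/

section TripleTensor

variable {k T : Type*} [Field k] [Ring T] [Algebra k T]

variable (k T) in
/-- `T ⊗ T ⊗ T` over `k`. -/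
abbrev Triple : Type _ := T ⊗[k] (T ⊗[k] T)

variable (k T) in
/-- The right action of `T` on `T ⊗ T ⊗ T` through the last factor. -/
def tripleMul : Triple k T →ₗ[k] T →ₗ[k] Triple k T :=
  ((LinearMap.lTensorHom T ∘ₗ LinearMap.lTensorHom T ∘ₗ (LinearMap.mul k T).flip :
    T →ₗ[k] Triple k T →ₗ[k] Triple k T)).flip

theorem tripleMul_tmul (a b c t : T) :
    tripleMul k T (a ⊗ₜ (b ⊗ₜ c)) t = a ⊗ₜ (b ⊗ₜ (c * t)) := rfl

theorem tripleMul_one (m : Triple k T) : tripleMul k T m 1 = m := by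
  have : (tripleMul k T).flip 1 = LinearMap.id := by
    ext a b c
    simp [tripleMul_tmul]
  exact DFunLike.congr_fun this m

theorem tripleMul_mul (m : Triple k T) (t u : T) :
    tripleMul k T m (t * u) = tripleMul k T (tripleMul k T m t) u := by
  have : (tripleMul k T).flip (t * u) = (tripleMul k T).flip u ∘ₗ (tripleMul k T).flip t := by
    ext a b c
    simp [tripleMul_tmul, mul_assoc]
  exact DFunLike.congr_fun this m

theorem smul_triple_tmul (t a b c : T) :
    t • (a ⊗ₜ[k] (b ⊗ₜ[k] c)) = (t * a) ⊗ₜ (b ⊗ₜ c) := rfl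

theorem tripleMul_smul (a : T) (m : Triple k T) (t : T) :
    tripleMul k T (a • m) t = a • tripleMul k T m t := by
  have : (tripleMul k T).flip t ∘ₗ Algebra.lsmul k k (Triple k T) a =
      Algebra.lsmul k k (Triple k T) a ∘ₗ (tripleMul k T).flip t := by
    ext b c d
    simp [tripleMul_tmul, smul_triple_tmul]
  exact DFunLike.congr_fun this m

variable (𝒯 : ℕ → Submodule k T)

/-- The part of degree `n` of `T ⊗ T ⊗ T`. -/
def tripleDegree (n : ℕ) : Submodule k (Triple k T) :=
  Submodule.span k {z | ∃ p q r, p + q + r = n ∧ ∃ a ∈ 𝒯 p, ∃ b ∈ 𝒯 q, ∃ c ∈ 𝒯 r,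
    z = a ⊗ₜ (b ⊗ₜ c)}

variable {𝒯} [SetLike.GradedMonoid 𝒯]

theorem smul_mem_tripleDegree {m n : ℕ} {t : T} (ht : t ∈ 𝒯 m) {z : Triple k T}
    (hz : z ∈ tripleDegree 𝒯 n) : t • z ∈ tripleDegree 𝒯 (m + n) := by
  have : tripleDegree 𝒯 n ≤ (tripleDegree 𝒯 (m + n)).comap (Algebra.lsmul k k (Triple k T) t) := by
    rw [tripleDegree, Submodule.span_le]
    rintro _ ⟨p, q, r, h, a, ha, b, hb, c, hc, rfl⟩
    exact Submodule.subset_span ⟨m + p, q, r, by omega, t * a, SetLike.mul_mem_graded ht ha,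
      b, hb, c, hc, rfl⟩
  exact this hz

theorem tripleMul_mem_tripleDegree {m n : ℕ} {t : T} (ht : t ∈ 𝒯 m) {z : Triple k T}
    (hz : z ∈ tripleDegree 𝒯 n) : tripleMul k T z t ∈ tripleDegree 𝒯 (n + m) := by
  have : tripleDegree 𝒯 n ≤ (tripleDegree 𝒯 (n + m)).comap ((tripleMul k T).flip t) := by
    rw [tripleDegree, Submodule.span_le]
    rintro _ ⟨p, q, r, h, a, ha, b, hb, c, hc, rfl⟩
    exact Submodule.subset_span ⟨p, q, r + m, by omega, a, ha, b, hb, c * t,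
      SetLike.mul_mem_graded hc ht, rfl⟩
  exact this hz

end TripleTensor

namespace TensorRing

variable {k S V : Type*} [Field k] [Ring S] [Algebra k S]
  [AddCommGroup V] [Module k V] [Module S V] [Module Sᵐᵒᵖ V]
  {n : ℕ} {x y : Fin n → S}

variable (k V x y) in
/-- The map `v ↦ ∑ᵢₗ xᵢ ⊗ yᵢ v xₗ ⊗ yₗ`. -/
def derivationVec : V →ₗ[k] Triple k (TensorRing k S V) :=
  ∑ i, ∑ l, TensorProduct.mk k _ _ (scalar k S V (x i)) ∘ₗ
    (TensorProduct.mk k _ _).flip (scalar k S V (y l)) ∘ₗ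
      LinearMap.mulLeft k (scalar k S V (y i)) ∘ₗ LinearMap.mulRight k (scalar k S V (x l)) ∘ₗ
        vec k S V

theorem derivationVec_apply (v : V) : derivationVec k V x y v =
    ∑ i, ∑ l, scalar k S V (x i) ⊗ₜ
      ((scalar k S V (y i) * (vec k S V v * scalar k S V (x l))) ⊗ₜ scalar k S V (y l)) := by
  simp [derivationVec]

/-- The Casimir identity carries s from yᵢ over to xᵢ. Inserting Casimir elements between the
factors thus makes a tensor over k behave like one in T ⊗_S V ⊗_S T. -/
theorem derivationVec_smul (h : IsCasimir k x y) (s : S) (v : V) :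
    derivationVec k V x y (s • v) = scalar k S V s • derivationVec k V x y v := by
  rw [derivationVec_apply, derivationVec_apply, Finset.sum_comm]
  conv_rhs => rw [Finset.sum_comm, Finset.smul_sum]
  refine Finset.sum_congr rfl fun l _ => ?_
  have : ∑ i, scalar k S V (s * x i) ⊗ₜ[k] ((scalar k S V (y i) *
        (vec k S V v * scalar k S V (x l))) ⊗ₜ[k] scalar k S V (y l)) =
      ∑ i, scalar k S V (x i) ⊗ₜ[k] ((scalar k S V (y i * s) *
        (vec k S V v * scalar k S V (x l))) ⊗ₜ[k] scalar k S V (y l)) := h.sum_apply (LinearMap.mk₂ k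
    (fun u w : S => scalar k S V u ⊗ₜ[k] ((scalar k S V w * (vec k S V v * scalar k S V (x l)))
      ⊗ₜ[k] scalar k S V (y l)))
    (fun _ _ _ => by simp only [map_add, TensorProduct.add_tmul])
    (fun _ _ _ => by simp only [map_smul, TensorProduct.smul_tmul'])
    (fun _ _ _ => by simp only [map_add, add_mul, TensorProduct.add_tmul, TensorProduct.tmul_add])
    (fun _ _ _ => by
      simp only [map_smul, smul_mul_assoc, ← TensorProduct.smul_tmul', TensorProduct.tmul_smul])) s
  simp only [map_mul] at this
  simp only [← scalar_mul_vec, Finset.smul_sum, smul_triple_tmul, this, mul_assoc]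

theorem derivationVec_op_smul (h : IsCasimir k x y) (s : S) (v : V) :
    derivationVec k V x y (MulOpposite.op s • v) =
      tripleMul k _ (derivationVec k V x y v) (scalar k S V s) := by
  rw [derivationVec_apply, derivationVec_apply, map_sum, LinearMap.sum_apply]
  refine Finset.sum_congr rfl fun i _ => ?_
  have := h.sum_apply (LinearMap.mk₂ k
    (fun u w : S => scalar k S V (x i) ⊗ₜ[k] ((scalar k S V (y i) * (vec k S V v * scalar k S V u))
      ⊗ₜ[k] scalar k S V w))
    (fun _ _ _ => by simp only [map_add, mul_add, TensorProduct.add_tmul, TensorProduct.tmul_add])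
    (fun _ _ _ => by
      simp only [map_smul, mul_smul_comm, ← TensorProduct.smul_tmul', TensorProduct.tmul_smul])
    (fun _ _ _ => by simp only [map_add, TensorProduct.tmul_add])
    (fun _ _ _ => by simp only [map_smul, TensorProduct.tmul_smul])) s
  simp only [LinearMap.mk₂_apply, map_mul] at this
  rw [map_sum, LinearMap.sum_apply]
  simp only [← vec_mul_scalar, mul_assoc, tripleMul_tmul] at this ⊢
  exact this

/-- The action of `T = T_S(V)` on `T × (T ⊗ T ⊗ T)` which encodes the universal derivation. -/
def derivationRep (h : IsCasimir k x y) :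
    TensorRing k S V →ₐ[k] Module.End k (TensorRing k S V × Triple k (TensorRing k S V)) :=
  -- The action is triangular: a sends (t, m) to (a t, D(a) t + a m). Multiplicativity of such a
  -- representation is the Leibniz rule for D, so the universal property produces D from its values
  -- on V.
  lift ((Algebra.lsmul k k (TensorRing k S V × Triple k (TensorRing k S V))).comp (scalar k S V))
    ((Algebra.lsmul k k (TensorRing k S V × Triple k (TensorRing k S V))).toLinearMap ∘ₗ vec k S V +
      (LinearMap.llcomp k _ _ _ (LinearMap.inr k (TensorRing k S V) (Triple k (TensorRing k S V)))) ∘ₗ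
        (LinearMap.lcomp k _ (LinearMap.fst k (TensorRing k S V) (Triple k (TensorRing k S V)))) ∘ₗ
          tripleMul k _ ∘ₗ derivationVec k V x y)
    (fun s v => by
      refine LinearMap.ext fun ⟨t, m⟩ => ?_
      refine Prod.ext ?_ ?_
      · simp [← scalar_mul_vec]
      · simp [← scalar_mul_vec, derivationVec_smul h, tripleMul_smul])
    (fun v s => by
      refine LinearMap.ext fun ⟨t, m⟩ => ?_
      refine Prod.ext ?_ ?_
      · simp [← vec_mul_scalar]
      · simp [← vec_mul_scalar, derivationVec_op_smul h, tripleMul_mul])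

theorem derivationRep_scalar (h : IsCasimir k x y) (s : S) (t : TensorRing k S V)
    (m : Triple k (TensorRing k S V)) :
    derivationRep h (scalar k S V s) (t, m) = (scalar k S V s * t, scalar k S V s • m) := by
  rw [derivationRep, lift_scalar]
  rfl

theorem derivationRep_vec (h : IsCasimir k x y) (v : V) (t : TensorRing k S V)
    (m : Triple k (TensorRing k S V)) :
    derivationRep h (vec k S V v) (t, m) =
      (vec k S V v * t, tripleMul k _ (derivationVec k V x y v) t + vec k S V v • m) := by
  rw [derivationRep, lift_vec]
  refine Prod.ext ?_ ?_
  · simp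
  · simp [add_comm]

/-- The universal derivation `T → T ⊗_S V ⊗_S T ⊆ T ⊗ T ⊗ T` of the `S`-ring `T = T_S(V)`, which
maps `v₁ ⋯ vₙ` to `∑ᵢ v₁ ⋯ vᵢ₋₁ ⊗ vᵢ ⊗ vᵢ₊₁ ⋯ vₙ`. -/
def universalDerivation (h : IsCasimir k x y) :
    TensorRing k S V →ₗ[k] Triple k (TensorRing k S V) :=
  LinearMap.snd k _ _ ∘ₗ LinearMap.applyₗ (1, 0) ∘ₗ (derivationRep h).toLinearMap

theorem universalDerivation_eq (h : IsCasimir k x y) (a : TensorRing k S V) :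
    universalDerivation h a = (derivationRep h a (1, 0)).2 := rfl

@[simp]
theorem universalDerivation_scalar (h : IsCasimir k x y) (s : S) :
    universalDerivation h (scalar k S V s) = 0 := by
  rw [universalDerivation_eq, derivationRep_scalar, smul_zero]

theorem universalDerivation_vec (h : IsCasimir k x y) (v : V) :
    universalDerivation h (vec k S V v) = derivationVec k V x y v := by
  rw [universalDerivation_eq, derivationRep_vec, tripleMul_one, smul_zero, add_zero]

theorem derivationRep_apply (h : IsCasimir k x y) (a t : TensorRing k S V)
    (m : Triple k (TensorRing k S V)) : derivationRep h a (t, m) =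
      (a * t, tripleMul k _ (universalDerivation h a) t + a • m) := by
  induction a using TensorRing.induction generalizing t m with
  | hs s =>
    rw [derivationRep_scalar, universalDerivation_scalar, map_zero, LinearMap.zero_apply, zero_add]
  | hv v => rw [derivationRep_vec, universalDerivation_vec]
  | hadd a b ha hb =>
    rw [map_add, LinearMap.add_apply, ha, hb, Prod.mk_add_mk, map_add, map_add,
      LinearMap.add_apply, add_mul, add_smul]
    congr 1
    abel
  | hmul a b ha hb =>
    have hab : universalDerivation h (a * b) =
        tripleMul k _ (universalDerivation h a) b + a • universalDerivation h b := by
      rw [universalDerivation_eq, map_mul, Module.End.mul_apply, hb, ha, tripleMul_one, mul_one,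
        smul_zero, add_zero]
    rw [map_mul, Module.End.mul_apply, hb, ha, hab, map_add, LinearMap.add_apply, tripleMul_mul,
      tripleMul_smul, mul_assoc, smul_add, mul_smul, add_assoc]

theorem universalDerivation_mul (h : IsCasimir k x y) (a b : TensorRing k S V) :
    universalDerivation h (a * b) =
      tripleMul k _ (universalDerivation h a) b + a • universalDerivation h b := by
  rw [universalDerivation_eq, map_mul, Module.End.mul_apply, derivationRep_apply,
    derivationRep_apply, tripleMul_one, mul_one, smul_zero, add_zero]

/-- Homogeneity of the derivation keeps the cycles built from it in a single internal degree, so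
that vanishing of Tor in that one degree is enough. -/
theorem universalDerivation_mem (h : IsCasimir k x y) (m : ℕ) :
    degree k S V m ≤ (tripleDegree (degree k S V) m).comap (universalDerivation h) := by
  induction m with
  | zero =>
    rw [degree_zero]
    rintro _ ⟨s, rfl⟩
    rw [Submodule.mem_comap, AlgHom.toLinearMap_apply, universalDerivation_scalar]
    exact zero_mem _
  | succ m ih =>
    refine mem_degree_succ_induction fun t ht v => ?_
    rw [Submodule.mem_comap, universalDerivation_mul]
    refine add_mem (tripleMul_mem_tripleDegree (vec_mem k S V v) (ih ht)) ?_
    refine smul_mem_tripleDegree ht ?_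
    rw [universalDerivation_vec, derivationVec_apply]
    refine sum_mem fun i _ => sum_mem fun l _ => Submodule.subset_span
      ⟨0, 1, 0, rfl, _, scalar_mem k S V _, _, ?_, _, scalar_mem k S V _, rfl⟩
    have h₁ := SetLike.mul_mem_graded (scalar_mem k S V (y i))
      (SetLike.mul_mem_graded (vec_mem k S V v) (scalar_mem k S V (x l)))
    exact h₁

/-! ### Applying a bimodule map to one tensor factor -/

/-- For a bimodule map `g`, the map `T_S(V)^{+} = V ⊗_S T_S(V) → T_S(V)`, `v t ↦ v g(t)`. -/
theorem exists_map_vec_mul (h : IsCasimir k x y) {g : TensorRing k S V →ₗ[k] TensorRing k S V}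
    (hg : IsBimoduleMap (scalar k S V) (scalar k S V) g) :
    ∃ f : TensorRing k S V →ₗ[k] TensorRing k S V,
      ∀ v t, f (vec k S V v * t) = vec k S V v * g t := by
  -- Projecting the first factor to degree 0 retains only the part of D(v t) that singles out the
  -- leftmost letter v; `g` is then applied to the remainder t.
  let φ : Triple k (TensorRing k S V) →ₗ[k] TensorRing k S V :=
    LinearMap.mul' k _ ∘ₗ TensorProduct.map (GradedAlgebra.proj (degree k S V) 0)
      (LinearMap.mul' k _ ∘ₗ g.lTensor _)
  have hφ : ∀ a b c, φ (a ⊗ₜ (b ⊗ₜ c)) = GradedAlgebra.proj (degree k S V) 0 a * (b * g c) :=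
    fun a b c => by simp [φ]
  refine ⟨φ ∘ₗ universalDerivation h, fun v t => ?_⟩
  -- The part v D(t) of the Leibniz rule has first factor in positive degree.
  have h₁ : ∀ m, φ (vec k S V v • m) = 0 := fun m => by
    have : φ ∘ₗ Algebra.lsmul k k (Triple k (TensorRing k S V)) (vec k S V v) = 0 := by
      ext a b c
      have hv : GradedAlgebra.proj (degree k S V) 0 (vec k S V v * a) = 0 := by
        refine DirectSum.Decomposition.inductionOn (degree k S V) (by simp) (fun {i} a => ?_)
          (fun a b ha hb => by rw [mul_add, map_add, ha, hb, add_zero]) a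
        exact proj_of_mem_ne (SetLike.mul_mem_graded (vec_mem k S V v) a.2) (by omega)
      simp [hφ, smul_triple_tmul, hv]
    exact DFunLike.congr_fun this m
  rw [LinearMap.comp_apply, universalDerivation_mul, map_add, h₁, add_zero,
    universalDerivation_vec, derivationVec_apply]
  simp only [map_sum, LinearMap.sum_apply, tripleMul_tmul, hφ, hg.map_smul,
    proj_of_mem (scalar_mem k S V _)]
  have : ∀ i l, scalar k S V (x i) * (scalar k S V (y i) * (vec k S V v * scalar k S V (x l)) *
      (scalar k S V (y l) * g t)) =
      scalar k S V (x i * y i) * (vec k S V v * (scalar k S V (x l * y l) * g t)) := fun i l => by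
    simp only [map_mul, mul_assoc]
  simp only [this, ← Finset.mul_sum, ← Finset.sum_mul, ← map_sum, h.sum_mul, map_one, one_mul]

/-- For a bimodule map `g`, the map `T_S(V)^{+} = T_S(V) ⊗_S V → T_S(V)`, `t v ↦ g(t) v`. -/
theorem exists_map_mul_vec (h : IsCasimir k x y) {g : TensorRing k S V →ₗ[k] TensorRing k S V}
    (hg : IsBimoduleMap (scalar k S V) (scalar k S V) g) :
    ∃ f : TensorRing k S V →ₗ[k] TensorRing k S V,
      ∀ t v, f (t * vec k S V v) = g t * vec k S V v := by
  -- The mirror image: projecting the last factor to degree 0 retains only the rightmost letter.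
  let φ : Triple k (TensorRing k S V) →ₗ[k] TensorRing k S V :=
    LinearMap.mul' k _ ∘ₗ TensorProduct.map g
      (LinearMap.mul' k _ ∘ₗ (GradedAlgebra.proj (degree k S V) 0).lTensor _)
  have hφ : ∀ a b c, φ (a ⊗ₜ (b ⊗ₜ c)) = g a * (b * GradedAlgebra.proj (degree k S V) 0 c) :=
    fun a b c => by simp [φ]
  refine ⟨φ ∘ₗ universalDerivation h, fun t v => ?_⟩
  have h₁ : ∀ m, φ (tripleMul k _ m (vec k S V v)) = 0 := fun m => by
    have : φ ∘ₗ (tripleMul k (TensorRing k S V)).flip (vec k S V v) = 0 := by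
      ext a b c
      have hv : GradedAlgebra.proj (degree k S V) 0 (c * vec k S V v) = 0 := by
        refine DirectSum.Decomposition.inductionOn (degree k S V) (by simp) (fun {i} a => ?_)
          (fun a b ha hb => by rw [add_mul, map_add, ha, hb, add_zero]) c
        exact proj_of_mem_ne (SetLike.mul_mem_graded a.2 (vec_mem k S V v)) (by omega)
      simp [hφ, tripleMul_tmul, hv]
    exact DFunLike.congr_fun this m
  rw [LinearMap.comp_apply, universalDerivation_mul, map_add, h₁, zero_add,
    universalDerivation_vec, derivationVec_apply]
  simp only [map_sum, Finset.smul_sum, smul_triple_tmul, hφ, hg.map_mul,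
    proj_of_mem (scalar_mem k S V _)]
  have : ∀ i l, g t * scalar k S V (x i) * (scalar k S V (y i) *
      (vec k S V v * scalar k S V (x l)) * scalar k S V (y l)) =
      g t * (scalar k S V (x i * y i) * (vec k S V v * scalar k S V (x l * y l))) := fun i l => by
    simp only [map_mul, mul_assoc]
  simp only [this, ← Finset.mul_sum, ← Finset.sum_mul, ← map_sum, h.sum_mul, map_one, one_mul,
    mul_one]

end TensorRing

/-! ### The cover T_A → A, its kernel and its augmentation. -/

section Cover

variable {k S A : Type*} [Field k] [Ring S] [Algebra k S] [Ring A] [Algebra k A]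
  (𝒜 : ℕ → Submodule k A) [GradedAlgebra 𝒜] (e : S ≃ₐ[k] 𝒜 0)

/-- The inclusion `A¹ → T_A`. -/
abbrev coverVec : DegreeOne 𝒜 e →ₗ[k] TensorCover 𝒜 e := TensorRing.vec k S (DegreeOne 𝒜 e)

@[simp]
theorem coverMap_scalar (s : S) : coverMap 𝒜 e (coverScalar 𝒜 e s) = structureMap 𝒜 e s :=
  TensorRing.lift_scalar _ _ _ _ s

@[simp]
theorem coverMap_vec (v : DegreeOne 𝒜 e) :
    coverMap 𝒜 e (coverVec 𝒜 e v) = DegreeOne.incl 𝒜 e v :=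
  TensorRing.lift_vec _ _ _ _ v

theorem incl_mem (v : DegreeOne 𝒜 e) : DegreeOne.incl 𝒜 e v ∈ 𝒜 1 := (v : 𝒜 1).2

theorem coverDegree_zero :
    coverDegree 𝒜 e 0 = LinearMap.range (coverScalar 𝒜 e).toLinearMap :=
  TensorRing.degree_zero k S (DegreeOne 𝒜 e)

theorem mem_relationIdeal {x : TensorCover 𝒜 e} :
    x ∈ relationIdeal 𝒜 e ↔ coverMap 𝒜 e x = 0 := Iff.rfl

variable {𝒜 e} in
theorem mul_mem_relationIdeal_left (t : TensorCover 𝒜 e) {x : TensorCover 𝒜 e}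
    (hx : x ∈ relationIdeal 𝒜 e) : t * x ∈ relationIdeal 𝒜 e := by
  rw [mem_relationIdeal] at hx ⊢
  rw [map_mul, hx, mul_zero]

variable {𝒜 e} in
theorem mul_mem_relationIdeal_right {x : TensorCover 𝒜 e} (hx : x ∈ relationIdeal 𝒜 e)
    (t : TensorCover 𝒜 e) : x * t ∈ relationIdeal 𝒜 e := by
  rw [mem_relationIdeal] at hx ⊢
  rw [map_mul, hx, zero_mul]

theorem coverMap_mem (n : ℕ) :
    coverDegree 𝒜 e n ≤ (𝒜 n).comap (coverMap 𝒜 e).toLinearMap := by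
  induction n with
  | zero =>
    rw [coverDegree_zero]
    rintro _ ⟨s, rfl⟩
    rw [Submodule.mem_comap, AlgHom.toLinearMap_apply, AlgHom.toLinearMap_apply, coverMap_scalar]
    exact structureMap_mem 𝒜 e s
  | succ n ih =>
    refine TensorRing.mem_degree_succ_induction fun t ht v => ?_
    rw [Submodule.mem_comap, AlgHom.toLinearMap_apply, map_mul, coverMap_vec]
    exact SetLike.mul_mem_graded (ih ht) (incl_mem 𝒜 e v)

theorem coverMap_proj (n : ℕ) (t : TensorCover 𝒜 e) :
    coverMap 𝒜 e (GradedAlgebra.proj (coverDegree 𝒜 e) n t) =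
      GradedAlgebra.proj 𝒜 n (coverMap 𝒜 e t) := by
  induction t using DirectSum.Decomposition.inductionOn (coverDegree 𝒜 e) with
  | zero => simp
  | @homogeneous m t =>
    have h : coverMap 𝒜 e t ∈ 𝒜 m := coverMap_mem 𝒜 e m t.2
    by_cases hm : m = n
    · subst hm
      rw [proj_of_mem t.2, proj_of_mem h]
    · rw [proj_of_mem_ne t.2 hm, proj_of_mem_ne h hm, map_zero]
  | add t u ht hu => simp only [map_add, ht, hu]

theorem isHomogeneous_relationIdeal :
    DirectSum.SetLike.IsHomogeneous (coverDegree 𝒜 e) (relationIdeal 𝒜 e) := by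
  rw [isHomogeneous_iff]
  intro n x hx
  rw [mem_relationIdeal] at hx ⊢
  rw [coverMap_proj, hx, map_zero]

/-- T_A⁰ is the image of S, and the augmentation of A recovers an element of S from its image in A.
This is the base case of the inductions on degree. -/
theorem eq_zero_of_mem_relationIdeal_of_mem_zero {x : TensorCover 𝒜 e}
    (hx : x ∈ relationIdeal 𝒜 e) (hx' : x ∈ coverDegree 𝒜 e 0) : x = 0 := by
  rw [coverDegree_zero] at hx'
  obtain ⟨s, rfl⟩ := hx'
  rw [AlgHom.toLinearMap_apply, mem_relationIdeal, coverMap_scalar] at hx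
  have := augmentation_structureMap 𝒜 e s
  rw [hx, map_zero] at this
  rw [← this, map_zero]

/-- Strong grading enters the proof here, through Aⁿ⁺¹ = Aⁿ A¹. -/
theorem coverMap_surjective (hA : IsStronglyGraded 𝒜) : Function.Surjective (coverMap 𝒜 e) := by
  have key : ∀ n, 𝒜 n ≤ LinearMap.range (coverMap 𝒜 e).toLinearMap := by
    intro n
    induction n with
    | zero =>
      intro a ha
      refine ⟨coverScalar 𝒜 e (e.symm ⟨a, ha⟩), ?_⟩
      rw [AlgHom.toLinearMap_apply, coverMap_scalar]
      change ((e (e.symm ⟨a, ha⟩) : 𝒜 0) : A) = a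
      rw [AlgEquiv.apply_symm_apply]
    | succ n ih =>
      rw [← hA n 1, Submodule.mul_le]
      intro a ha b hb
      obtain ⟨t, rfl⟩ := ih ha
      refine ⟨t * coverVec 𝒜 e (show DegreeOne 𝒜 e from ⟨b, hb⟩), ?_⟩
      rw [AlgHom.toLinearMap_apply, map_mul, coverMap_vec]
      rfl
  intro a
  exact mem_of_forall_proj_mem 𝒜 (C := LinearMap.range (coverMap 𝒜 e).toLinearMap)
    fun n => key n (proj_mem 𝒜 n a)

/-- The augmentation `T_A → S`. -/
def coverAugmentation : TensorCover 𝒜 e →ₐ[k] S := (augmentation 𝒜 e).comp (coverMap 𝒜 e)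

@[simp]
theorem coverAugmentation_scalar (s : S) : coverAugmentation 𝒜 e (coverScalar 𝒜 e s) = s := by
  rw [coverAugmentation, AlgHom.comp_apply, coverMap_scalar, augmentation_structureMap]

theorem augmentation_incl (v : DegreeOne 𝒜 e) :
    augmentation 𝒜 e (DegreeOne.incl 𝒜 e v) = 0 :=
  augmentation_eq_zero 𝒜 e one_ne_zero (incl_mem 𝒜 e v)

theorem coverAugmentation_eq_zero {x : TensorCover 𝒜 e} (hx : x ∈ relationIdeal 𝒜 e) :
    coverAugmentation 𝒜 e x = 0 := by
  rw [coverAugmentation, AlgHom.comp_apply, (mem_relationIdeal 𝒜 e).1 hx, map_zero]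

/-- The augmentation ideal of `T_A`. -/
def augmentationIdeal : Submodule k (TensorCover 𝒜 e) :=
  LinearMap.ker (coverAugmentation 𝒜 e).toLinearMap

theorem mem_augmentationIdeal {x : TensorCover 𝒜 e} :
    x ∈ augmentationIdeal 𝒜 e ↔ coverAugmentation 𝒜 e x = 0 := Iff.rfl

theorem proj_zero_of_mem_augmentationIdeal {x : TensorCover 𝒜 e}
    (hx : x ∈ augmentationIdeal 𝒜 e) : GradedAlgebra.proj (coverDegree 𝒜 e) 0 x = 0 := by
  have key : ∀ t, GradedAlgebra.proj (coverDegree 𝒜 e) 0 t =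
      coverScalar 𝒜 e (coverAugmentation 𝒜 e t) := by
    intro t
    induction t using DirectSum.Decomposition.inductionOn (coverDegree 𝒜 e) with
    | zero => simp
    | @homogeneous n t =>
      by_cases hn : n = 0
      · subst hn
        obtain ⟨t, ht⟩ := t
        rw [proj_of_mem ht]
        rw [coverDegree_zero] at ht
        obtain ⟨s, rfl⟩ := ht
        exact congrArg (coverScalar 𝒜 e) (coverAugmentation_scalar 𝒜 e s).symm
      · rw [proj_of_mem_ne t.2 hn, coverAugmentation, AlgHom.comp_apply,
          augmentation_eq_zero 𝒜 e hn (a := coverMap 𝒜 e t) (coverMap_mem 𝒜 e n t.2), map_zero]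
    | add t u ht hu => simp only [map_add, ht, hu]
  rw [key, (mem_augmentationIdeal 𝒜 e).1 hx, map_zero]

/-! ### A section of `T_A → A` -/

theorem IsCasimir.exists_section (hA : IsStronglyGraded 𝒜) {n : ℕ} {x y : Fin n → S}
    (h : IsCasimir k x y) : ∃ σ : A →ₗ[k] TensorCover 𝒜 e,
      IsBimoduleMap (structureMap 𝒜 e) (coverScalar 𝒜 e) σ ∧ (∀ a, coverMap 𝒜 e (σ a) = a) ∧
      (∀ s, σ (structureMap 𝒜 e s) = coverScalar 𝒜 e s) ∧
      ∀ v, σ (DegreeOne.incl 𝒜 e v) = coverVec 𝒜 e v := by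
  obtain ⟨g, hg⟩ := (coverMap 𝒜 e).toLinearMap.exists_rightInverse_of_surjective
    (LinearMap.range_eq_top.2 (coverMap_surjective 𝒜 e hA))
  have hg : ∀ a, coverMap 𝒜 e (g a) = a := fun a => DFunLike.congr_fun hg a
  let p : A →ₗ[k] DegreeOne 𝒜 e :=
    LinearMap.codRestrict (𝒜 1) (GradedAlgebra.proj 𝒜 1) (proj_mem 𝒜 1)
  have hp : ∀ v, p (DegreeOne.incl 𝒜 e v) = v := fun v =>
    DegreeOne.incl_injective 𝒜 e (proj_of_mem (incl_mem 𝒜 e v))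
  have hp' : ∀ s, p (structureMap 𝒜 e s) = 0 := fun s => DegreeOne.incl_injective 𝒜 e (by
    rw [map_zero]
    exact proj_of_mem_ne (structureMap_mem 𝒜 e s) zero_ne_one)
  -- The evident section on A⁰ and A¹, zero in higher degrees.
  let c : A →ₗ[k] TensorCover 𝒜 e :=
    (coverScalar 𝒜 e).toLinearMap ∘ₗ (augmentation 𝒜 e).toLinearMap + coverVec 𝒜 e ∘ₗ p
  have hc : ∀ a, c a = coverScalar 𝒜 e (augmentation 𝒜 e a) + coverVec 𝒜 e (p a) := fun a => rfl
  -- Under T_A → A the last two terms cancel, so this is still a section; wherever `c` is itself a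
  -- section, the outer terms cancel and `c` remains.
  let σ₀ : A →ₗ[k] TensorCover 𝒜 e := g + c - g ∘ₗ (coverMap 𝒜 e).toLinearMap ∘ₗ c
  have hσ₀ : ∀ a, σ₀ a = g a + c a - g (coverMap 𝒜 e (c a)) := fun a => rfl
  have hσs : ∀ s, σ₀ (structureMap 𝒜 e s) = coverScalar 𝒜 e s := fun s => by
    rw [hσ₀, hc, augmentation_structureMap, hp', map_zero, add_zero, coverMap_scalar,
      add_sub_cancel_left]
  have hσv : ∀ v, σ₀ (DegreeOne.incl 𝒜 e v) = coverVec 𝒜 e v := fun v => by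
    rw [hσ₀, hc, augmentation_incl, hp, map_zero, zero_add, coverMap_vec, add_sub_cancel_left]
  have hσ₀' : ∀ a, coverMap 𝒜 e (σ₀ a) = a := fun a => by
    rw [hσ₀, map_sub, map_add, hg, hg, add_sub_cancel_right]
  refine ⟨average (structureMap 𝒜 e) (coverScalar 𝒜 e) x y σ₀, h.isBimoduleMap_average _ _ _,
    fun a => ?_, fun s => ?_, fun v => ?_⟩
  · simp only [average_apply, map_sum, map_mul, hσ₀', coverMap_scalar]
    exact h.sum_sum_eq (structureMap 𝒜 e) a
  · refine h.average_eq _ _ _ _ _ fun t u => ?_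
    rw [← map_mul, ← map_mul, hσs, map_mul, map_mul]
  · refine h.average_eq _ _ _ _ _ fun t u => ?_
    rw [TensorRing.vec_mul_scalar, TensorRing.scalar_mul_vec, ← hσv]
    rfl

/-! ### From cycles to relations -/

section Curvature

variable (σ : A →ₗ[k] TensorCover 𝒜 e)

/-- The curvature `a ⊗ b ↦ σ(a) σ(b) - σ(a b)` of a section `σ`. -/
def curvature : A ⊗[k] A →ₗ[k] TensorCover 𝒜 e :=
  LinearMap.mul' k _ ∘ₗ TensorProduct.map σ σ - σ ∘ₗ LinearMap.mul' k A

variable {σ}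

theorem curvature_tmul (a b : A) : curvature 𝒜 e σ (a ⊗ₜ b) = σ a * σ b - σ (a * b) := by
  simp [curvature]

theorem curvature_mem (hσ : ∀ a, coverMap 𝒜 e (σ a) = a) (a b : A) :
    σ a * σ b - σ (a * b) ∈ relationIdeal 𝒜 e := by
  rw [mem_relationIdeal, map_sub, map_mul, hσ, hσ, hσ, sub_self]

variable (σ)

/-- The map `s ⊗ a ⊗ b ⊗ c ⊗ t ↦ s (σ(a) - ε(a)) (σ(b) σ(c) - σ(b c)) t`. -/
def cycleToRelation : BarThree k S A →ₗ[k] TensorCover 𝒜 e :=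
  LinearMap.mul' k _ ∘ₗ TensorProduct.map (coverScalar 𝒜 e).toLinearMap
    (LinearMap.mul' k _ ∘ₗ TensorProduct.map
      (σ - (coverScalar 𝒜 e).toLinearMap ∘ₗ (augmentation 𝒜 e).toLinearMap)
      (LinearMap.mul' k _ ∘ₗ TensorProduct.map (curvature 𝒜 e σ) (coverScalar 𝒜 e).toLinearMap ∘ₗ
        (TensorProduct.assoc k A A S).symm.toLinearMap))

theorem cycleToRelation_tmul (s t : S) (a b c : A) :
    cycleToRelation 𝒜 e σ (s ⊗ₜ (a ⊗ₜ (b ⊗ₜ (c ⊗ₜ t)))) =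
      coverScalar 𝒜 e s * ((σ a - coverScalar 𝒜 e (augmentation 𝒜 e a)) *
        ((σ b * σ c - σ (b * c)) * coverScalar 𝒜 e t)) := by
  simp [cycleToRelation, curvature_tmul]

/-- `I_A I_A + T_A⁺ I_A T_A⁺`. -/
def deepRelations : Submodule k (TensorCover 𝒜 e) :=
  relationIdeal 𝒜 e * relationIdeal 𝒜 e ⊔
    augmentationIdeal 𝒜 e * relationIdeal 𝒜 e * augmentationIdeal 𝒜 e

theorem mul_mem_deepRelations {x y : TensorCover 𝒜 e} (hx : x ∈ relationIdeal 𝒜 e)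
    (hy : y ∈ relationIdeal 𝒜 e) : x * y ∈ deepRelations 𝒜 e :=
  (le_sup_left : _ ≤ deepRelations 𝒜 e) (Submodule.mul_mem_mul hx hy)

theorem mul_mul_mem_deepRelations {x y z : TensorCover 𝒜 e} (hx : x ∈ augmentationIdeal 𝒜 e)
    (hy : y ∈ relationIdeal 𝒜 e) (hz : z ∈ augmentationIdeal 𝒜 e) :
    x * y * z ∈ deepRelations 𝒜 e :=
  (le_sup_right : _ ≤ deepRelations 𝒜 e) (Submodule.mul_mem_mul (Submodule.mul_mem_mul hx hy) hz)

variable {σ}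

theorem section_sub_mem (hσ : ∀ a, coverMap 𝒜 e (σ a) = a) (a : A) :
    σ a - coverScalar 𝒜 e (augmentation 𝒜 e a) ∈ augmentationIdeal 𝒜 e := by
  rw [mem_augmentationIdeal, map_sub, coverAugmentation_scalar, coverAugmentation,
    AlgHom.comp_apply, hσ, sub_self]

theorem scalar_mul_mem_augmentationIdeal (s : S) {x : TensorCover 𝒜 e}
    (hx : x ∈ augmentationIdeal 𝒜 e) : coverScalar 𝒜 e s * x ∈ augmentationIdeal 𝒜 e := by
  rw [mem_augmentationIdeal] at hx ⊢
  rw [map_mul, hx, mul_zero]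

theorem mul_scalar_mem_augmentationIdeal (s : S) {x : TensorCover 𝒜 e}
    (hx : x ∈ augmentationIdeal 𝒜 e) : x * coverScalar 𝒜 e s ∈ augmentationIdeal 𝒜 e := by
  rw [mem_augmentationIdeal] at hx ⊢
  rw [map_mul, hx, zero_mul]

/-- A Bianchi-type identity: on the boundary of s ⊗ a ⊗ b ⊗ c ⊗ d ⊗ t everything cancels except the
curvature of (a, b) times that of (c, d), which lies in I_A I_A, and the curvature of (b, c) between
σ(a) - ε(a) and σ(d) - ε(d), which lies in T_A⁺ I_A T_A⁺. -/
theorem cycleToRelation_barDiffFour (hσ : ∀ a, coverMap 𝒜 e (σ a) = a) (z : BarFour k S A) :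
    cycleToRelation 𝒜 e σ (barDiffFour 𝒜 e z) ∈ deepRelations 𝒜 e := by
  have key : ∀ (s t : S) (a b c d : A),
      cycleToRelation 𝒜 e σ (barDiffFour 𝒜 e (s ⊗ₜ (a ⊗ₜ (b ⊗ₜ (c ⊗ₜ (d ⊗ₜ t)))))) ∈
        deepRelations 𝒜 e := by
    intro s t a b c d
    have h : cycleToRelation 𝒜 e σ (barDiffFour 𝒜 e (s ⊗ₜ (a ⊗ₜ (b ⊗ₜ (c ⊗ₜ (d ⊗ₜ t)))))) =
        (coverScalar 𝒜 e s * (σ a * σ b - σ (a * b))) *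
          ((σ c * σ d - σ (c * d)) * coverScalar 𝒜 e t) -
        (coverScalar 𝒜 e s * (σ a - coverScalar 𝒜 e (augmentation 𝒜 e a))) *
          (σ b * σ c - σ (b * c)) *
          ((σ d - coverScalar 𝒜 e (augmentation 𝒜 e d)) * coverScalar 𝒜 e t) := by
      rw [barDiffFour_tmul]
      simp only [map_add, map_sub, cycleToRelation_tmul, map_mul]
      simp only [mul_sub, sub_mul, mul_assoc]
      abel
    rw [h]
    refine sub_mem (mul_mem_deepRelations 𝒜 e
      (mul_mem_relationIdeal_left _ (curvature_mem 𝒜 e hσ a b))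
      (mul_mem_relationIdeal_right (curvature_mem 𝒜 e hσ c d) _)) ?_
    exact mul_mul_mem_deepRelations 𝒜 e
      (scalar_mul_mem_augmentationIdeal 𝒜 e s (section_sub_mem 𝒜 e hσ a))
      (curvature_mem 𝒜 e hσ b c)
      (mul_scalar_mem_augmentationIdeal 𝒜 e t (section_sub_mem 𝒜 e hσ d))
  have h₀ : (deepRelations 𝒜 e).mkQ ∘ₗ cycleToRelation 𝒜 e σ ∘ₗ barDiffFour 𝒜 e = 0 := by
    ext s a b c d t
    exact (Submodule.Quotient.mk_eq_zero _).2 (key s t a b c d)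
  exact (Submodule.Quotient.mk_eq_zero _).1 (DFunLike.congr_fun h₀ z)

end Curvature

end Cover

/-! ### Bar cycles attached to elements of T_A¹ I_A ∩ I_A T_A¹. -/

section BarCycles

variable {k S A : Type*} [Field k] [Ring S] [Algebra k S] [Ring A] [Algebra k A]
  (𝒜 : ℕ → Submodule k A) [GradedAlgebra 𝒜] (e : S ≃ₐ[k] 𝒜 0)

theorem mem_augmentationIdeal_of_mem {n : ℕ} (hn : n ≠ 0) {t : TensorCover 𝒜 e}
    (ht : t ∈ coverDegree 𝒜 e n) : t ∈ augmentationIdeal 𝒜 e :=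
  augmentation_eq_zero 𝒜 e hn (a := coverMap 𝒜 e t) (coverMap_mem 𝒜 e n ht)

/-- The map `a ⊗ b ⊗ c ↦ 1 ⊗ π(a) ⊗ π(b) ⊗ π(c) ⊗ 1`, where `π : T_A → A` is the projection. -/
def toBarThree : Triple k (TensorCover 𝒜 e) →ₗ[k] BarThree k S A :=
  TensorProduct.mk k S _ 1 ∘ₗ TensorProduct.map (coverMap 𝒜 e).toLinearMap
    (TensorProduct.map (coverMap 𝒜 e).toLinearMap
      ((TensorProduct.mk k A S).flip 1 ∘ₗ (coverMap 𝒜 e).toLinearMap))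

theorem toBarThree_tmul (a b c : TensorCover 𝒜 e) : toBarThree 𝒜 e (a ⊗ₜ (b ⊗ₜ c)) =
    1 ⊗ₜ (coverMap 𝒜 e a ⊗ₜ (coverMap 𝒜 e b ⊗ₜ (coverMap 𝒜 e c ⊗ₜ 1))) := rfl

theorem toBarThree_mem {m : ℕ} {z : Triple k (TensorCover 𝒜 e)}
    (hz : z ∈ tripleDegree (coverDegree 𝒜 e) m) : toBarThree 𝒜 e z ∈ barThreeDegree 𝒜 m := by
  have : tripleDegree (coverDegree 𝒜 e) m ≤ (barThreeDegree 𝒜 m).comap (toBarThree 𝒜 e) := by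
    rw [tripleDegree, Submodule.span_le]
    rintro _ ⟨p, q, r, h, a, ha, b, hb, c, hc, rfl⟩
    exact Submodule.subset_span ⟨p, q, r, 1, 1, ⟨_, coverMap_mem 𝒜 e p ha⟩,
      ⟨_, coverMap_mem 𝒜 e q hb⟩, ⟨_, coverMap_mem 𝒜 e r hc⟩, h, rfl⟩
  exact this hz

theorem toBarThree_smul_eq_zero {w : TensorCover 𝒜 e} (hw : w ∈ relationIdeal 𝒜 e)
    (m : Triple k (TensorCover 𝒜 e)) : toBarThree 𝒜 e (w • m) = 0 := by
  have : toBarThree 𝒜 e ∘ₗ Algebra.lsmul k k (Triple k (TensorCover 𝒜 e)) w = 0 := by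
    ext a b c
    simp [smul_triple_tmul, toBarThree_tmul, (mem_relationIdeal 𝒜 e).1 hw]
  exact DFunLike.congr_fun this m

theorem barFirst_toBarThree_smul {t : TensorCover 𝒜 e} (ht : t ∈ augmentationIdeal 𝒜 e)
    (m : Triple k (TensorCover 𝒜 e)) : barFirst 𝒜 e _ (toBarThree 𝒜 e (t • m)) = 0 := by
  have : barFirst 𝒜 e _ ∘ₗ toBarThree 𝒜 e ∘ₗ
      Algebra.lsmul k k (Triple k (TensorCover 𝒜 e)) t = 0 := by
    ext a b c
    have h : augmentation 𝒜 e (coverMap 𝒜 e t) = 0 := ht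
    simp [smul_triple_tmul, toBarThree_tmul, barFirst, h]
  exact DFunLike.congr_fun this m

/-- The last component `s ⊗ a ⊗ b ⊗ c ⊗ t ↦ s ⊗ a ⊗ b ⊗ ε(c) t` of the differential. -/
abbrev barThreeLast : BarThree k S A →ₗ[k] BarTwo k S A :=
  (((barLast 𝒜 e).lTensor A).lTensor A).lTensor S

theorem barThreeLast_toBarThree_tripleMul {t : TensorCover 𝒜 e}
    (ht : t ∈ augmentationIdeal 𝒜 e) (m : Triple k (TensorCover 𝒜 e)) :
    barThreeLast 𝒜 e (toBarThree 𝒜 e (tripleMul k _ m t)) = 0 := by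
  have : barThreeLast 𝒜 e ∘ₗ toBarThree 𝒜 e ∘ₗ
      (tripleMul k (TensorCover 𝒜 e)).flip t = 0 := by
    ext a b c
    have h : augmentation 𝒜 e (coverMap 𝒜 e t) = 0 := ht
    simp [tripleMul_tmul, toBarThree_tmul, barLast, h]
  exact DFunLike.congr_fun this m

variable (k S A) in
/-- The components of the differential which multiply two of the inner factors. -/
def barThreeInner : BarThree k S A →ₗ[k] BarTwo k S A :=
  ((barMul k A _).lTensor A).lTensor S - (barMul k A _).lTensor S

theorem barThreeInner_tmul (s t : S) (a b c : A) :
    barThreeInner k S A (s ⊗ₜ (a ⊗ₜ (b ⊗ₜ (c ⊗ₜ t)))) =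
      s ⊗ₜ (a ⊗ₜ ((b * c) ⊗ₜ t)) - s ⊗ₜ ((a * b) ⊗ₜ (c ⊗ₜ t)) := by
  simp [barThreeInner, barMul]

theorem barDiffThree_eq (z : BarThree k S A) : barDiffThree 𝒜 e z =
    barFirst 𝒜 e _ z + barThreeInner k S A z - barThreeLast 𝒜 e z := by
  rw [barDiffThree, barThreeInner]
  simp only [LinearMap.sub_apply, LinearMap.add_apply]
  abel

section Casimir

variable {N : ℕ} (x y : Fin N → S)

/-- The element `∑ₗ 1 ⊗ π(t xₗ) ⊗ π(yₗ b) ⊗ 1`. -/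
def casimirBarTwo (t b : TensorCover 𝒜 e) : BarTwo k S A :=
  ∑ l, 1 ⊗ₜ (coverMap 𝒜 e (t * coverScalar 𝒜 e (x l)) ⊗ₜ
    (coverMap 𝒜 e (coverScalar 𝒜 e (y l) * b) ⊗ₜ 1))

variable {x y} (h : IsCasimir k x y)

theorem casimirBarTwo_scalar (h : IsCasimir k x y) (t b : TensorCover 𝒜 e) (s : S) :
    casimirBarTwo 𝒜 e x y (t * coverScalar 𝒜 e s) b =
      casimirBarTwo 𝒜 e x y t (coverScalar 𝒜 e s * b) := by
  let β : S →ₗ[k] S →ₗ[k] BarTwo k S A := LinearMap.compl₁₂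
    (TensorProduct.mk k A (A ⊗[k] S) |>.compr₂ (TensorProduct.mk k S _ 1))
    ((coverMap 𝒜 e).toLinearMap ∘ₗ LinearMap.mulLeft k t ∘ₗ (coverScalar 𝒜 e).toLinearMap)
    ((TensorProduct.mk k A S).flip 1 ∘ₗ (coverMap 𝒜 e).toLinearMap ∘ₗ LinearMap.mulRight k b ∘ₗ
      (coverScalar 𝒜 e).toLinearMap)
  have hβ : ∀ u w, β u w = 1 ⊗ₜ (coverMap 𝒜 e (t * coverScalar 𝒜 e u) ⊗ₜ
    (coverMap 𝒜 e (coverScalar 𝒜 e w * b) ⊗ₜ 1)) := fun u w => rfl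
  have := h.sum_apply β s
  simp only [hβ] at this
  rw [casimirBarTwo, casimirBarTwo]
  simp only [map_mul, mul_assoc] at this ⊢
  exact this

/-- A telescoping sum: the derivation singles out each letter of a in turn, and merging it with the
factor on its right or left gives terms that cancel between consecutive letters. The two surviving
ends vanish for a ∈ I_A and b = 1. -/
theorem barThreeInner_derivation (a t b : TensorCover 𝒜 e) :
    barThreeInner k S A (toBarThree 𝒜 e
      (t • tripleMul k _ (TensorRing.universalDerivation h a) b)) =
      casimirBarTwo 𝒜 e x y t (a * b) - casimirBarTwo 𝒜 e x y (t * a) b := by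
  induction a using TensorRing.induction generalizing t b with
  | hs s =>
    rw [TensorRing.universalDerivation_scalar, casimirBarTwo_scalar 𝒜 e h, sub_self, map_zero,
      LinearMap.zero_apply, smul_zero, map_zero, map_zero]
  | hv v =>
    rw [TensorRing.universalDerivation_vec, TensorRing.derivationVec_apply]
    simp only [map_sum, LinearMap.sum_apply, tripleMul_tmul, Finset.smul_sum, smul_triple_tmul,
      toBarThree_tmul, barThreeInner_tmul, Finset.sum_sub_distrib]
    congr 1
    · rw [casimirBarTwo]
      refine Finset.sum_congr rfl fun i _ => ?_
      rw [← TensorProduct.tmul_sum, ← TensorProduct.tmul_sum, ← TensorProduct.sum_tmul]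
      simp only [← map_mul]
      have : ∀ l, coverScalar 𝒜 e (y i) * (coverVec 𝒜 e v * coverScalar 𝒜 e (x l)) *
          (coverScalar 𝒜 e (y l) * b) =
          coverScalar 𝒜 e (y i) * (coverVec 𝒜 e v * (coverScalar 𝒜 e (x l * y l) * b)) :=
        fun l => by simp only [map_mul, mul_assoc]
      simp only [this]
      simp only [← map_sum, ← Finset.mul_sum, ← Finset.sum_mul, h.sum_mul, map_one, one_mul]
    · rw [casimirBarTwo, Finset.sum_comm]
      refine Finset.sum_congr rfl fun l _ => ?_
      rw [← TensorProduct.tmul_sum, ← TensorProduct.sum_tmul]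
      simp only [← map_mul]
      have : ∀ i, t * coverScalar 𝒜 e (x i) *
          (coverScalar 𝒜 e (y i) * (coverVec 𝒜 e v * coverScalar 𝒜 e (x l))) =
          t * (coverScalar 𝒜 e (x i * y i) * (coverVec 𝒜 e v * coverScalar 𝒜 e (x l))) :=
        fun l => by simp only [map_mul, mul_assoc]
      simp only [this]
      simp only [← map_sum, ← Finset.mul_sum, ← Finset.sum_mul, h.sum_mul, map_one, one_mul,
        mul_assoc]
  | hadd a a' ha ha' =>
    have h₁ : ∀ u v, casimirBarTwo 𝒜 e x y t (u + v) =
        casimirBarTwo 𝒜 e x y t u + casimirBarTwo 𝒜 e x y t v := fun u v => by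
      simp only [casimirBarTwo, mul_add, map_add, TensorProduct.add_tmul, TensorProduct.tmul_add,
        Finset.sum_add_distrib]
    have h₂ : ∀ u v, casimirBarTwo 𝒜 e x y (u + v) b =
        casimirBarTwo 𝒜 e x y u b + casimirBarTwo 𝒜 e x y v b := fun u v => by
      simp only [casimirBarTwo, add_mul, map_add, TensorProduct.add_tmul, TensorProduct.tmul_add,
        Finset.sum_add_distrib]
    rw [map_add, map_add, LinearMap.add_apply, smul_add, map_add, map_add, ha, ha', add_mul,
      mul_add, h₁, h₂]
    abel
  | hmul a a' ha ha' =>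
    rw [TensorRing.universalDerivation_mul, map_add, LinearMap.add_apply, ← tripleMul_mul,
      tripleMul_smul, smul_add, ← mul_smul, map_add, map_add, ha, ha', mul_assoc, mul_assoc]
    abel

variable {σ : A →ₗ[k] TensorCover 𝒜 e}

/-- The letters of a contribute differences v σ(b) - σ(v b), which telescope to a σ(b) - σ(a b). For
a ∈ I_A and b = 1 the latter is a, so the product t a is recovered modulo `deepRelations`. -/
theorem cycleToRelation_derivation
    (hσ : IsBimoduleMap (structureMap 𝒜 e) (coverScalar 𝒜 e) σ)
    (hσπ : ∀ a, coverMap 𝒜 e (σ a) = a) (hσv : ∀ v, σ (DegreeOne.incl 𝒜 e v) = coverVec 𝒜 e v)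
    (a b : TensorCover 𝒜 e) {t : TensorCover 𝒜 e} (ht : t ∈ augmentationIdeal 𝒜 e) :
    cycleToRelation 𝒜 e σ (toBarThree 𝒜 e
      (t • tripleMul k _ (TensorRing.universalDerivation h a) b)) -
      t * (a * σ (coverMap 𝒜 e b) - σ (coverMap 𝒜 e (a * b))) ∈ deepRelations 𝒜 e := by
  induction a using TensorRing.induction generalizing t b with
  | hs s =>
    rw [TensorRing.universalDerivation_scalar, map_zero, LinearMap.zero_apply, smul_zero, map_zero,
      map_zero, map_mul, coverMap_scalar, hσ.map_smul, sub_self, mul_zero, sub_zero]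
    exact zero_mem _
  | hv v =>
    have ht' : augmentation 𝒜 e (coverMap 𝒜 e t) = 0 := ht
    have h₁ : cycleToRelation 𝒜 e σ (toBarThree 𝒜 e
        (t • tripleMul k _ (TensorRing.universalDerivation h (coverVec 𝒜 e v)) b)) =
        σ (coverMap 𝒜 e t) * (coverVec 𝒜 e v * σ (coverMap 𝒜 e b) -
          σ (coverMap 𝒜 e (coverVec 𝒜 e v * b))) := by
      rw [TensorRing.universalDerivation_vec, TensorRing.derivationVec_apply]
      simp only [map_sum, LinearMap.sum_apply, tripleMul_tmul, Finset.smul_sum, smul_triple_tmul,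
        toBarThree_tmul, cycleToRelation_tmul, map_one, one_mul, mul_one]
      have h₂ : ∀ i l, (σ (coverMap 𝒜 e (t * coverScalar 𝒜 e (x i))) -
          coverScalar 𝒜 e (augmentation 𝒜 e (coverMap 𝒜 e (t * coverScalar 𝒜 e (x i))))) *
          (σ (coverMap 𝒜 e (coverScalar 𝒜 e (y i) * (coverVec 𝒜 e v * coverScalar 𝒜 e (x l)))) *
            σ (coverMap 𝒜 e (coverScalar 𝒜 e (y l) * b)) -
            σ (coverMap 𝒜 e (coverScalar 𝒜 e (y i) * (coverVec 𝒜 e v * coverScalar 𝒜 e (x l))) *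
              coverMap 𝒜 e (coverScalar 𝒜 e (y l) * b))) =
          σ (coverMap 𝒜 e t) * (coverScalar 𝒜 e (x i * y i) * (coverVec 𝒜 e v *
            (coverScalar 𝒜 e (x l * y l) * σ (coverMap 𝒜 e b)) -
            σ (coverMap 𝒜 e (coverVec 𝒜 e v) * (structureMap 𝒜 e (x l * y l) *
              coverMap 𝒜 e b)))) := by
        intro i l
        simp only [map_mul, coverMap_scalar, ht', zero_mul, map_zero, sub_zero, hσ.map_smul,
          hσ.map_mul, coverMap_vec, hσv, mul_assoc, mul_sub]
      simp only [h₂]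
      simp only [← map_sum, ← Finset.mul_sum, ← Finset.sum_mul, Finset.sum_sub_distrib, h.sum_mul,
        map_one, one_mul]
      rw [map_mul (coverMap 𝒜 e)]
    -- The exact value has σ(π(t)) in place of t; the error is a product of two elements of I_A.
    rw [h₁, ← sub_mul]
    refine mul_mem_deepRelations 𝒜 e ?_ ?_
    · rw [mem_relationIdeal, map_sub, hσπ, sub_self]
    · rw [mem_relationIdeal, map_sub, map_mul, hσπ, hσπ, map_mul, sub_self]
  | hadd a a' ha ha' =>
    have h₁ := add_mem (ha b ht) (ha' b ht)
    rw [map_add, map_add, LinearMap.add_apply, smul_add, map_add, map_add, add_mul, add_mul,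
      map_add, map_add]
    convert h₁ using 1
    simp only [mul_sub, mul_add]
    abel
  | hmul a a' ha ha' =>
    have hta : t * a ∈ augmentationIdeal 𝒜 e := by
      rw [mem_augmentationIdeal] at ht ⊢
      rw [map_mul, ht, zero_mul]
    have h₁ := add_mem (ha (a' * b) ht) (ha' b hta)
    rw [TensorRing.universalDerivation_mul, map_add, LinearMap.add_apply, ← tripleMul_mul,
      tripleMul_smul, smul_add, ← mul_smul, map_add, map_add]
    convert h₁ using 1
    simp only [mul_sub, mul_assoc]
    abel

/-- If `Tor₃^A(S, S)` vanishes in degree `n + 1`, then an element of this degree of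
`T_A¹ I_A ∩ I_A T_A¹` lies in `I_A I_A + T_A⁺ I_A T_A⁺`. -/
theorem mem_deepRelations (hA : IsStronglyGraded 𝒜) (h : IsCasimir k x y) {n : ℕ}
    (hTor : Subsingleton (TorThree 𝒜 e (n + 1))) {r : TensorCover 𝒜 e}
    (hl : r ∈ coverDegree 𝒜 e 1 * (relationIdeal 𝒜 e ⊓ coverDegree 𝒜 e n))
    (hr : r ∈ (relationIdeal 𝒜 e ⊓ coverDegree 𝒜 e n) * coverDegree 𝒜 e 1) :
    r ∈ deepRelations 𝒜 e := by
  obtain ⟨σ, hσ, hσπ, hσs, hσv⟩ := h.exists_section 𝒜 e hA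
  have hσ1 : σ 1 = 1 := by
    have := hσs 1
    rwa [map_one (structureMap 𝒜 e), map_one (coverScalar 𝒜 e)] at this
  -- For r = ∑ t w with t ∈ T_A¹ and w ∈ I_A, take m = ∑ t D(w). The first and inner components of
  -- the differential vanish termwise. The last one is merely compared with that of D(r): the
  -- missing terms D(t) w are killed because w has augmentation zero.
  obtain ⟨m, hm, hmr, hfirst, hinner, hlast⟩ : ∃ m ∈ tripleDegree (coverDegree 𝒜 e) (n + 1),
      cycleToRelation 𝒜 e σ (toBarThree 𝒜 e m) - r ∈ deepRelations 𝒜 e ∧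
      barFirst 𝒜 e _ (toBarThree 𝒜 e m) = 0 ∧ barThreeInner k S A (toBarThree 𝒜 e m) = 0 ∧
      barThreeLast 𝒜 e (toBarThree 𝒜 e m) =
        barThreeLast 𝒜 e (toBarThree 𝒜 e (TensorRing.universalDerivation h r)) := by
    clear hr
    induction hl using Submodule.mul_induction_on' with
    | mem_mul_mem t ht w hw =>
      have ht' := mem_augmentationIdeal_of_mem 𝒜 e one_ne_zero ht
      have hw' : w ∈ augmentationIdeal 𝒜 e := coverAugmentation_eq_zero 𝒜 e hw.1
      refine ⟨t • TensorRing.universalDerivation h w, ?_, ?_, ?_, ?_, ?_⟩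
      · have := smul_mem_tripleDegree ht (TensorRing.universalDerivation_mem h n hw.2)
        rwa [add_comm] at this
      · have := cycleToRelation_derivation 𝒜 e h hσ hσπ hσv w 1 ht'
        rwa [tripleMul_one, map_one, hσ1, mul_one, (mem_relationIdeal 𝒜 e).1 hw.1,
          map_zero, sub_zero] at this
      · exact barFirst_toBarThree_smul 𝒜 e ht' _
      · have := barThreeInner_derivation 𝒜 e h w t 1
        rw [tripleMul_one, mul_one] at this
        rw [this, casimirBarTwo, casimirBarTwo]
        simp only [map_mul, (mem_relationIdeal 𝒜 e).1 hw.1, mul_zero, zero_mul,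
          TensorProduct.zero_tmul, TensorProduct.tmul_zero, Finset.sum_const_zero, sub_self]
      · rw [TensorRing.universalDerivation_mul, map_add, map_add,
          barThreeLast_toBarThree_tripleMul 𝒜 e hw', zero_add]
    | add r _ r' _ hr hr' =>
      obtain ⟨m, h₁, h₂, h₃, h₄, h₅⟩ := hr
      obtain ⟨m', h₁', h₂', h₃', h₄', h₅'⟩ := hr'
      refine ⟨m + m', add_mem h₁ h₁', ?_, ?_, ?_, ?_⟩
      · convert add_mem h₂ h₂' using 1
        rw [map_add, map_add]
        abel
      · rw [map_add, map_add, h₃, h₃', add_zero]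
      · rw [map_add, map_add, h₄, h₄', add_zero]
      · rw [map_add, map_add, map_add, map_add, map_add, h₅, h₅']
  -- Now r is read as a sum of products w t with w ∈ I_A: the last component kills D(w) t because
  -- ε(t) = 0, and w D(t) already vanishes in the bar complex because π(w) = 0.
  have hlast' : barThreeLast 𝒜 e (toBarThree 𝒜 e (TensorRing.universalDerivation h r)) = 0 := by
    clear hl hmr hlast
    induction hr using Submodule.mul_induction_on' with
    | mem_mul_mem w hw t ht =>
      rw [TensorRing.universalDerivation_mul, map_add, map_add,
        barThreeLast_toBarThree_tripleMul 𝒜 e (mem_augmentationIdeal_of_mem 𝒜 e one_ne_zero ht),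
        toBarThree_smul_eq_zero 𝒜 e hw.1, map_zero, zero_add]
    | add r _ r' _ hr hr' => rw [map_add, map_add, map_add, hr, hr', add_zero]
  have hcycle : toBarThree 𝒜 e m ∈ torCycles 𝒜 e (n + 1) := by
    refine ⟨?_, toBarThree_mem 𝒜 e hm⟩
    change barDiffThree 𝒜 e _ = 0
    rw [barDiffThree_eq, hfirst, hinner, hlast, hlast', add_zero, sub_zero]
  have hboundary : (⟨_, hcycle⟩ : torCycles 𝒜 e (n + 1)) ∈
      (torBoundaries 𝒜 e (n + 1)).submoduleOf (torCycles 𝒜 e (n + 1)) :=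
    (Submodule.Quotient.mk_eq_zero _).1 (hTor.elim _ _)
  obtain ⟨u, -, hu⟩ : toBarThree 𝒜 e m ∈ torBoundaries 𝒜 e (n + 1) := hboundary
  have h₁ := cycleToRelation_barDiffFour 𝒜 e hσπ u
  rw [hu] at h₁
  have h₂ := sub_mem h₁ hmr
  rwa [sub_sub_cancel] at h₂

end Casimir

end BarCycles

/-! ### Products and sums of homogeneous submodules. -/

section HomogeneousProducts

variable {k T : Type*} [Field k] [Ring T] [Algebra k T] {𝒯 : ℕ → Submodule k T} [GradedAlgebra 𝒯]

theorem proj_mul_of_mem_left {i j : ℕ} {a : T} (ha : a ∈ 𝒯 i) (b : T) :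
    GradedAlgebra.proj 𝒯 (i + j) (a * b) = a * GradedAlgebra.proj 𝒯 j b :=
  DirectSum.coe_decompose_mul_add_of_left_mem 𝒯 ha

theorem proj_mul_of_mem_right {i j : ℕ} (a : T) {b : T} (hb : b ∈ 𝒯 j) :
    GradedAlgebra.proj 𝒯 (i + j) (a * b) = GradedAlgebra.proj 𝒯 i a * b :=
  DirectSum.coe_decompose_mul_add_of_right_mem 𝒯 hb

theorem mul_le_of_isHomogeneous {C D E : Submodule k T}
    (hC : DirectSum.SetLike.IsHomogeneous 𝒯 C) (hD : DirectSum.SetLike.IsHomogeneous 𝒯 D)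
    (h : ∀ i j, ∀ c ∈ C, c ∈ 𝒯 i → ∀ d ∈ D, d ∈ 𝒯 j → c * d ∈ E) : C * D ≤ E := by
  rw [isHomogeneous_iff] at hC hD
  rw [Submodule.mul_le]
  intro c hc d hd
  refine mem_of_forall_proj_mem 𝒯 (C := E.comap (LinearMap.mulRight k d)) (x := c) fun i => ?_
  refine mem_of_forall_proj_mem 𝒯
    (C := E.comap (LinearMap.mulLeft k (GradedAlgebra.proj 𝒯 i c))) (x := d) fun j => ?_
  exact h i j _ (hC i c hc) (proj_mem 𝒯 i c) _ (hD j d hd) (proj_mem 𝒯 j d)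

theorem isHomogeneous_mul {C D : Submodule k T}
    (hC : DirectSum.SetLike.IsHomogeneous 𝒯 C) (hD : DirectSum.SetLike.IsHomogeneous 𝒯 D) :
    DirectSum.SetLike.IsHomogeneous 𝒯 (C * D) := by
  rw [isHomogeneous_iff]
  intro n x hx
  have : C * D ≤ (C * D).comap (GradedAlgebra.proj 𝒯 n) := by
    refine mul_le_of_isHomogeneous hC hD fun i j c hc hci d hd hdj => ?_
    rw [Submodule.mem_comap]
    have hcd := SetLike.mul_mem_graded hci hdj
    by_cases h : i + j = n
    · subst h
      rw [proj_of_mem hcd]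
      exact Submodule.mul_mem_mul hc hd
    · rw [proj_of_mem_ne hcd h]
      exact zero_mem _
  exact this hx

theorem isHomogeneous_degree (m : ℕ) : DirectSum.SetLike.IsHomogeneous 𝒯 (𝒯 m) := by
  rw [isHomogeneous_iff]
  intro n x hx
  by_cases h : m = n
  · subst h
    rwa [proj_of_mem hx]
  · rw [proj_of_mem_ne hx h]
    exact zero_mem _

theorem isHomogeneous_sup {C D : Submodule k T}
    (hC : DirectSum.SetLike.IsHomogeneous 𝒯 C) (hD : DirectSum.SetLike.IsHomogeneous 𝒯 D) :
    DirectSum.SetLike.IsHomogeneous 𝒯 (C ⊔ D) := by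
  rw [isHomogeneous_iff] at hC hD ⊢
  intro n x hx
  have : C ⊔ D ≤ (C ⊔ D).comap (GradedAlgebra.proj 𝒯 n) :=
    sup_le (fun c hc => (le_sup_left : C ≤ C ⊔ D) (hC n c hc))
      (fun d hd => (le_sup_right : D ≤ C ⊔ D) (hD n d hd))
  exact this hx

end HomogeneousProducts

/-! ### Filtered lifts of relations and the submodules α(R)_n. -/

section Deformations

variable {k S A : Type*} [Field k] [Ring S] [Algebra k S] [Ring A] [Algebra k A]
  (𝒜 : ℕ → Submodule k A) [GradedAlgebra 𝒜] (e : S ≃ₐ[k] 𝒜 0)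

theorem coverScalar_mem (s : S) : coverScalar 𝒜 e s ∈ coverDegree 𝒜 e 0 :=
  TensorRing.scalar_mem k S (DegreeOne 𝒜 e) s

theorem coverScalar_mem_upTo (s : S) (n : ℕ) : coverScalar 𝒜 e s ∈ upTo (coverDegree 𝒜 e) n :=
  upTo_mono _ (Nat.zero_le n) (mem_upTo (coverScalar_mem 𝒜 e s))

theorem coverDegree_one : coverDegree 𝒜 e 1 = LinearMap.range (coverVec 𝒜 e) :=
  TensorRing.degree_one k S (DegreeOne 𝒜 e)

theorem coverVec_mem (v : DegreeOne 𝒜 e) : coverVec 𝒜 e v ∈ coverDegree 𝒜 e 1 :=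
  TensorRing.vec_mem k S (DegreeOne 𝒜 e) v

theorem upTo_succ_le (n : ℕ) : upTo (coverDegree 𝒜 e) (n + 1) ≤
    coverDegree 𝒜 e 1 * upTo (coverDegree 𝒜 e) n ⊔ upTo (coverDegree 𝒜 e) n := by
  rw [upTo_le_iff]
  intro m hm
  rcases Nat.lt_or_eq_of_le hm with h | rfl
  · exact le_trans (fun t ht => upTo_mono _ (Nat.le_of_lt_succ h) (mem_upTo ht)) le_sup_right
  · refine le_trans ?_ le_sup_left
    refine (TensorRing.degree_succ' k S (DegreeOne 𝒜 e) n).le.trans ?_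
    exact mul_le_mul_right (fun t ht => mem_upTo ht) _

theorem upTo_succ_le' (n : ℕ) : upTo (coverDegree 𝒜 e) (n + 1) ≤
    upTo (coverDegree 𝒜 e) n * coverDegree 𝒜 e 1 ⊔ upTo (coverDegree 𝒜 e) n := by
  rw [upTo_le_iff]
  intro m hm
  rcases Nat.lt_or_eq_of_le hm with h | rfl
  · exact le_trans (fun t ht => upTo_mono _ (Nat.le_of_lt_succ h) (mem_upTo ht)) le_sup_right
  · refine le_trans ?_ le_sup_left
    refine (TensorRing.degree_succ k S (DegreeOne 𝒜 e) n).le.trans ?_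
    exact mul_le_mul_left (fun t ht => mem_upTo ht) _

variable {𝒜 e} {R : Submodule k (TensorCover 𝒜 e)}

namespace IsBimoduleOfRelations

variable (hR : IsBimoduleOfRelations 𝒜 e R)
include hR

theorem le_relationIdeal : R ≤ relationIdeal 𝒜 e := hR.sup_eq ▸ le_sup_left

theorem proj_mem (n : ℕ) {r : TensorCover 𝒜 e} (hr : r ∈ R) :
    GradedAlgebra.proj (coverDegree 𝒜 e) n r ∈ R := hR.isHomogeneous n hr

/-- The component of degree n + 1 of I_A = R + (I_A T_A¹ + T_A¹ I_A). It is the recursion behind the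
inductions on degree over I_A. -/
theorem mem_sup_of_mem {n : ℕ} {w : TensorCover 𝒜 e} (hw : w ∈ relationIdeal 𝒜 e)
    (hwn : w ∈ coverDegree 𝒜 e (n + 1)) :
    w ∈ (R ⊓ coverDegree 𝒜 e (n + 1)) ⊔
      ((relationIdeal 𝒜 e ⊓ coverDegree 𝒜 e n) * coverDegree 𝒜 e 1 ⊔
        coverDegree 𝒜 e 1 * (relationIdeal 𝒜 e ⊓ coverDegree 𝒜 e n)) := by
  set D := (R ⊓ coverDegree 𝒜 e (n + 1)) ⊔
      ((relationIdeal 𝒜 e ⊓ coverDegree 𝒜 e n) * coverDegree 𝒜 e 1 ⊔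
        coverDegree 𝒜 e 1 * (relationIdeal 𝒜 e ⊓ coverDegree 𝒜 e n)) with hD
  have key : R ⊔ decomposableRelations 𝒜 e ≤
      D.comap (GradedAlgebra.proj (coverDegree 𝒜 e) (n + 1)) := by
    refine sup_le (fun r hr => ?_) (sup_le ?_ ?_)
    · exact (le_sup_left : _ ≤ D) ⟨hR.proj_mem _ hr, PBW.proj_mem _ _ _⟩
    · rw [Submodule.mul_le]
      intro a ha v hv
      rw [Submodule.mem_comap, proj_mul_of_mem_right a hv]
      exact (le_sup_left.trans le_sup_right : _ ≤ D) (Submodule.mul_mem_mul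
        ⟨isHomogeneous_relationIdeal 𝒜 e n ha, PBW.proj_mem _ _ _⟩ hv)
    · rw [Submodule.mul_le]
      intro v hv a ha
      rw [Submodule.mem_comap, add_comm n 1, proj_mul_of_mem_left hv a]
      exact (le_sup_right.trans le_sup_right : _ ≤ D) (Submodule.mul_mem_mul hv
        ⟨isHomogeneous_relationIdeal 𝒜 e n ha, PBW.proj_mem _ _ _⟩)
  rw [hR.sup_eq] at key
  have := key hw
  rwa [Submodule.mem_comap, proj_of_mem hwn] at this

theorem mem_idealOf_iff {x : TensorCover 𝒜 e} : x ∈ idealOf R ↔ x ∈ relationIdeal 𝒜 e := by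
  constructor
  · intro hx
    have h : idealOf R ≤ TwoSidedIdeal.ker (coverMap 𝒜 e) :=
      TwoSidedIdeal.span_le.2 fun r hr =>
        (TwoSidedIdeal.mem_ker (coverMap 𝒜 e)).2 ((mem_relationIdeal 𝒜 e).1 (hR.le_relationIdeal hr))
    exact (TwoSidedIdeal.mem_ker (coverMap 𝒜 e)).1 (h hx)
  · have key : ∀ n, relationIdeal 𝒜 e ⊓ coverDegree 𝒜 e n ≤
        LinearMap.ker (toQuotient R).toLinearMap := by
      intro n
      induction n with
      | zero =>
        rintro w ⟨hw, hw'⟩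
        rw [eq_zero_of_mem_relationIdeal_of_mem_zero 𝒜 e hw hw']
        exact zero_mem _
      | succ n ih =>
        rintro w ⟨hw, hw'⟩
        refine (sup_le ?_ (sup_le ?_ ?_) :
          _ ≤ LinearMap.ker (toQuotient R).toLinearMap) (hR.mem_sup_of_mem hw hw')
        · rintro r ⟨hr, -⟩
          exact toQuotient_eq_zero_iff.2 (TwoSidedIdeal.subset_span hr)
        · rw [Submodule.mul_le]
          intro a ha v _
          have h₁ : toQuotient R a = 0 := ih ha
          rw [LinearMap.mem_ker, AlgHom.toLinearMap_apply, map_mul, h₁, zero_mul]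
        · rw [Submodule.mul_le]
          intro v _ a ha
          have h₁ : toQuotient R a = 0 := ih ha
          rw [LinearMap.mem_ker, AlgHom.toLinearMap_apply, map_mul, h₁, mul_zero]
    intro hx
    refine toQuotient_eq_zero_iff.1 ?_
    exact mem_of_forall_proj_mem (coverDegree 𝒜 e)
      (C := LinearMap.ker (toQuotient R).toLinearMap) fun n =>
        key n ⟨isHomogeneous_relationIdeal 𝒜 e n hx, PBW.proj_mem _ _ _⟩

end IsBimoduleOfRelations

variable {α : R →ₗ[k] TensorCover 𝒜 e} (hR : IsBimoduleOfRelations 𝒜 e R)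
  (hα : IsFilteredMap (coverScalar 𝒜 e) (coverDegree 𝒜 e) R α)

namespace IsFilteredMap

include hα

theorem isSubbimodule_range (hR : IsBimoduleOfRelations 𝒜 e R) :
    IsSubbimodule (coverScalar 𝒜 e) (LinearMap.range α) := by
  constructor
  · rintro s _ ⟨r, rfl⟩
    exact ⟨⟨_, hR.isSubbimodule.smul_mem s r r.2⟩, hα.map_smul s r _ rfl⟩
  · rintro s _ ⟨r, rfl⟩
    exact ⟨⟨_, hR.isSubbimodule.mul_mem s r r.2⟩, hα.map_mul s r _ rfl⟩

include hR

/-- The condition on leading terms is imposed for homogeneous relations only. In general, subtract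
the top component of r; α maps the rest to lower filtration. -/
theorem proj_apply {d : ℕ} {r : R} (hr : (r : TensorCover 𝒜 e) ∈ upTo (coverDegree 𝒜 e) d) :
    GradedAlgebra.proj (coverDegree 𝒜 e) d (α r) = GradedAlgebra.proj (coverDegree 𝒜 e) d r := by
  cases d with
  | zero =>
    have h := mem_of_mem_upTo_zero hr
    rw [hα.component_zero 0 r h, proj_of_mem h]
  | succ d =>
    let r₁ : R := ⟨_, hR.proj_mem (d + 1) r.2⟩
    have h₁ : α (r - r₁) ∈ upTo (coverDegree 𝒜 e) d := hα.filtered d _ (sub_proj_mem_upTo hr)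
    have h₂ := proj_eq_zero_of_mem_upTo h₁ (Nat.lt_succ_self d)
    rw [map_sub, map_sub, sub_eq_zero] at h₂
    rw [h₂]
    exact hα.component_zero (d + 1) r₁ (PBW.proj_mem _ _ _)

/-- Strictness of α: a top component of r in degree above j would reappear as the leading term of
α(r). -/
theorem mem_upTo_of_apply_mem {j : ℕ} {r : R} (h : α r ∈ upTo (coverDegree 𝒜 e) j) :
    (r : TensorCover 𝒜 e) ∈ upTo (coverDegree 𝒜 e) j := by
  obtain ⟨m, hm⟩ := exists_mem_upTo (coverDegree 𝒜 e) (r : TensorCover 𝒜 e)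
  have key : ∀ d, (r : TensorCover 𝒜 e) ∈ upTo (coverDegree 𝒜 e) (j + d) →
      (r : TensorCover 𝒜 e) ∈ upTo (coverDegree 𝒜 e) j := by
    intro d
    induction d with
    | zero => exact id
    | succ d ih =>
      intro hd
      refine ih (mem_upTo_of_proj_eq_zero hd ?_)
      have h₁ := hα.proj_apply hR hd
      rw [← add_assoc] at h₁
      rw [← h₁]
      exact proj_eq_zero_of_mem_upTo h (by omega)
  exact key m (upTo_mono _ (Nat.le_add_left m j) hm)

/-- By strictness, a bound on the filtration of α(r) also bounds r. The leading term of a product a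
α(r) b then contains a component of r as a factor, which lies in R ⊆ I_A. -/
theorem proj_mem_relationIdeal {n : ℕ} {x : TensorCover 𝒜 e}
    (hx : x ∈ jacobiTerm (coverDegree 𝒜 e) (LinearMap.range α) n) :
    GradedAlgebra.proj (coverDegree 𝒜 e) n x ∈ relationIdeal 𝒜 e := by
  have : jacobiTerm (coverDegree 𝒜 e) (LinearMap.range α) n ≤
      (relationIdeal 𝒜 e).comap (GradedAlgebra.proj (coverDegree 𝒜 e) n) := by
    rw [jacobiTerm_le_iff]
    rintro i j l rfl a ha _ ⟨r, rfl⟩ hr b hb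
    rw [Submodule.mem_comap, proj_mul (SetLike.mul_mem_graded ha hr) hb, proj_mul ha hr,
      hα.proj_apply hR (hα.mem_upTo_of_apply_mem hR hr)]
    exact mul_mem_relationIdeal_right (mul_mem_relationIdeal_left _
      (hR.le_relationIdeal (hR.proj_mem j r.2))) _
  exact this hx

/-- Induction along `mem_sup_of_mem`: α lifts the part in R, and lifts of lower degree are
multiplied by T_A¹. No Jacobi condition is involved. -/
theorem exists_lift (n : ℕ) {w : TensorCover 𝒜 e} (hw : w ∈ relationIdeal 𝒜 e)
    (hw' : w ∈ coverDegree 𝒜 e n) :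
    ∃ x ∈ jacobiTerm (coverDegree 𝒜 e) (LinearMap.range α) n,
      GradedAlgebra.proj (coverDegree 𝒜 e) n x = w := by
  induction n generalizing w with
  | zero =>
    refine ⟨0, zero_mem _, ?_⟩
    rw [map_zero, eq_zero_of_mem_relationIdeal_of_mem_zero 𝒜 e hw hw']
  | succ n ih =>
    refine (sup_le ?_ (sup_le ?_ ?_) :
      _ ≤ (jacobiTerm (coverDegree 𝒜 e) (LinearMap.range α) (n + 1)).map
        (GradedAlgebra.proj (coverDegree 𝒜 e) (n + 1))) (hR.mem_sup_of_mem hw hw')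
    · rintro r ⟨hr, hr'⟩
      refine ⟨α ⟨r, hr⟩, mem_jacobiTerm ⟨_, rfl⟩ (hα.filtered _ _ (mem_upTo hr')), ?_⟩
      exact hα.component_zero _ _ hr'
    · rw [Submodule.mul_le]
      rintro a ⟨ha, ha'⟩ v hv
      obtain ⟨x, hx, rfl⟩ := ih ha ha'
      exact ⟨x * v, right_mul_mem_jacobiTerm hx (mem_upTo hv) le_rfl, proj_mul_of_mem_right x hv⟩
    · rw [Submodule.mul_le]
      rintro v hv a ⟨ha, ha'⟩
      obtain ⟨x, hx, rfl⟩ := ih ha ha'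
      refine ⟨v * x, left_mul_mem_jacobiTerm (mem_upTo hv) hx (add_comm 1 n).le, ?_⟩
      rw [add_comm n 1]
      exact proj_mul_of_mem_left hv x

/-- From a product a α(r) b a letter is peeled off the outer end of a or of b. If both indices i and
l are 0, the scalars are absorbed into α(R), and the relation splits into its component of degree n
+ 1 and a part of lower filtration. -/
theorem jacobiTerm_succ_le (n : ℕ) :
    jacobiTerm (coverDegree 𝒜 e) (LinearMap.range α) (n + 1) ≤
      (coverDegree 𝒜 e 1 * jacobiTerm (coverDegree 𝒜 e) (LinearMap.range α) n ⊔
        jacobiTerm (coverDegree 𝒜 e) (LinearMap.range α) n * coverDegree 𝒜 e 1) ⊔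
      (((coverDegree 𝒜 e (n + 1)).comap R.subtype).map α ⊔
        jacobiTerm (coverDegree 𝒜 e) (LinearMap.range α) n) := by
  set Q := LinearMap.range α with hQ
  set D := (coverDegree 𝒜 e 1 * jacobiTerm (coverDegree 𝒜 e) Q n ⊔
        jacobiTerm (coverDegree 𝒜 e) Q n * coverDegree 𝒜 e 1) ⊔
      (((coverDegree 𝒜 e (n + 1)).comap R.subtype).map α ⊔
        jacobiTerm (coverDegree 𝒜 e) Q n) with hD
  have hD₁ : coverDegree 𝒜 e 1 * jacobiTerm (coverDegree 𝒜 e) Q n ≤ D :=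
    le_sup_left.trans le_sup_left
  have hD₂ : jacobiTerm (coverDegree 𝒜 e) Q n * coverDegree 𝒜 e 1 ≤ D :=
    le_sup_right.trans le_sup_left
  have hD₃ : ((coverDegree 𝒜 e (n + 1)).comap R.subtype).map α ≤ D :=
    le_sup_left.trans le_sup_right
  have hD₄ : jacobiTerm (coverDegree 𝒜 e) Q n ≤ D := le_sup_right.trans le_sup_right
  rw [jacobiTerm_le_iff]
  intro i j l hn a ha q hq hq' b hb
  rcases i with _ | i
  · rcases l with _ | l
    · have hj : j = n + 1 := by omega
      subst hj
      have ha₀ := mem_of_mem_upTo_zero ha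
      have hb₀ := mem_of_mem_upTo_zero hb
      rw [coverDegree_zero] at ha₀ hb₀
      obtain ⟨s, rfl⟩ := ha₀
      obtain ⟨t, rfl⟩ := hb₀
      have hQs := hα.isSubbimodule_range hR
      obtain ⟨r, hr⟩ := hQs.mul_mem t _ (hQs.smul_mem s q hq)
      have hmem := mul_mem_upTo (mul_mem_upTo ha hq' le_rfl) hb le_rfl
      change coverScalar 𝒜 e s * q * coverScalar 𝒜 e t ∈ D
      change coverScalar 𝒜 e s * q * coverScalar 𝒜 e t ∈ _ at hmem
      rw [← hr] at hmem ⊢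
      have hr' := upTo_mono (coverDegree 𝒜 e) (show 0 + (n + 1) + 0 ≤ n + 1 by omega)
        (hα.mem_upTo_of_apply_mem hR hmem)
      let r₁ : R := ⟨_, hR.proj_mem (n + 1) r.2⟩
      have h₁ : α (r - r₁) ∈ jacobiTerm (coverDegree 𝒜 e) Q n :=
        mem_jacobiTerm ⟨_, rfl⟩ (hα.filtered n _ (sub_proj_mem_upTo hr'))
      have hr₁ : (r₁ : TensorCover 𝒜 e) ∈ coverDegree 𝒜 e (n + 1) := PBW.proj_mem _ _ _
      have h₂ : α r₁ ∈ ((coverDegree 𝒜 e (n + 1)).comap R.subtype).map α :=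
        ⟨r₁, hr₁, rfl⟩
      have h₃ := add_mem (hD₃ h₂) (hD₄ h₁)
      rwa [← map_add, add_sub_cancel] at h₃
    · have : upTo (coverDegree 𝒜 e) (l + 1) ≤ D.comap (LinearMap.mulLeft k (a * q)) := by
        refine (upTo_succ_le' 𝒜 e l).trans (sup_le ?_ ?_)
        · rw [Submodule.mul_le]
          intro c hc v hv
          rw [Submodule.mem_comap, LinearMap.mulLeft_apply, ← mul_assoc]
          exact hD₂ (Submodule.mul_mem_mul
            (mul_mem_jacobiTerm Q (by omega) ha hq hq' hc) hv)
        · intro c hc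
          exact hD₄ (mul_mem_jacobiTerm Q (by omega) ha hq hq' hc)
      exact this hb
  · have : upTo (coverDegree 𝒜 e) (i + 1) ≤
        D.comap (LinearMap.mulRight k b ∘ₗ LinearMap.mulRight k q) := by
      refine (upTo_succ_le 𝒜 e i).trans (sup_le ?_ ?_)
      · rw [Submodule.mul_le]
        intro v hv c hc
        rw [Submodule.mem_comap, LinearMap.comp_apply, LinearMap.mulRight_apply,
          LinearMap.mulRight_apply, mul_assoc, mul_assoc, ← mul_assoc c]
        exact hD₁ (Submodule.mul_mem_mul hv
          (mul_mem_jacobiTerm Q (by omega) hc hq hq' hb))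
      · intro c hc
        exact hD₄ (mul_mem_jacobiTerm Q (by omega) hc hq hq' hb)
    exact this ha

theorem jacobiTerm_zero : jacobiTerm (coverDegree 𝒜 e) (LinearMap.range α) 0 = ⊥ := by
  rw [eq_bot_iff]
  intro x hx
  have h₁ := mem_of_mem_upTo_zero (jacobiTerm_le_upTo 0 hx)
  have h₂ := hα.proj_mem_relationIdeal hR hx
  rw [proj_of_mem h₁] at h₂
  rw [Submodule.mem_bot]
  exact eq_zero_of_mem_relationIdeal_of_mem_zero 𝒜 e h₂ h₁

/-- Since I_A vanishes in degree 0, α(R)_0 = 0 and α(R)_1 comes from R¹ alone, where r is read off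
from the leading term of α(r). This starts the induction below the range n ≥ 1 of the theorem. -/
theorem jacobi_zero : Jacobi (coverDegree 𝒜 e) (LinearMap.range α) 0 := by
  rintro x ⟨hx, hx'⟩
  have h := hα.jacobiTerm_succ_le hR 0 hx
  rw [hα.jacobiTerm_zero hR, Submodule.mul_bot, Submodule.bot_mul, sup_bot_eq, sup_bot_eq,
    bot_sup_eq] at h
  obtain ⟨r, hr, rfl⟩ := h
  have h₁ := hα.component_zero 1 r hr
  rw [proj_eq_zero_of_mem_upTo hx' Nat.zero_lt_one] at h₁
  have h₂ : r = 0 := Subtype.ext h₁.symm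
  rw [h₂, map_zero]
  exact zero_mem _

end IsFilteredMap

end Deformations

/-! ### From (J_N) to (J_{N+1}). -/

section JacobiStep

variable {k S A : Type*} [Field k] [Ring S] [Algebra k S] [Ring A] [Algebra k A]
  {𝒜 : ℕ → Submodule k A} [GradedAlgebra 𝒜] {e : S ≃ₐ[k] 𝒜 0}
  {R : Submodule k (TensorCover 𝒜 e)} {α : R →ₗ[k] TensorCover 𝒜 e}

theorem mul_mem_relationIdeal_inf {i j n : ℕ} {t w : TensorCover 𝒜 e}
    (ht : t ∈ coverDegree 𝒜 e i) (hw : w ∈ relationIdeal 𝒜 e ⊓ coverDegree 𝒜 e j)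
    (h : i + j = n) : t * w ∈ relationIdeal 𝒜 e ⊓ coverDegree 𝒜 e n :=
  ⟨mul_mem_relationIdeal_left t hw.1, h ▸ SetLike.mul_mem_graded ht hw.2⟩

theorem mul_mem_relationIdeal_inf' {i j n : ℕ} {t w : TensorCover 𝒜 e}
    (hw : w ∈ relationIdeal 𝒜 e ⊓ coverDegree 𝒜 e j) (ht : t ∈ coverDegree 𝒜 e i)
    (h : j + i = n) : w * t ∈ relationIdeal 𝒜 e ⊓ coverDegree 𝒜 e n :=
  ⟨mul_mem_relationIdeal_right hw.1 t, h ▸ SetLike.mul_mem_graded hw.2 ht⟩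

variable (𝒜 e) in
theorem isHomogeneous_augmentationIdeal :
    DirectSum.SetLike.IsHomogeneous (coverDegree 𝒜 e) (augmentationIdeal 𝒜 e) := by
  rw [isHomogeneous_iff]
  intro n x hx
  rcases eq_or_ne n 0 with rfl | hn
  · rw [proj_zero_of_mem_augmentationIdeal 𝒜 e hx]
    exact zero_mem _
  · exact mem_augmentationIdeal_of_mem 𝒜 e hn (proj_mem _ _ _)

/-- An element of `I_A I_A + T_A⁺ I_A T_A⁺` which is homogeneous of degree `N + 2` is a sum of products
of homogeneous elements of the same degree. -/
theorem mem_of_mem_deepRelations {N : ℕ} {C : Submodule k (TensorCover 𝒜 e)}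
    (h₁ : ∀ a b, a + b = N → ∀ w ∈ relationIdeal 𝒜 e ⊓ coverDegree 𝒜 e (a + 1),
      ∀ w' ∈ relationIdeal 𝒜 e ⊓ coverDegree 𝒜 e (b + 1), w * w' ∈ C)
    (h₂ : ∀ v, ∀ w ∈ relationIdeal 𝒜 e ⊓ coverDegree 𝒜 e N, ∀ v',
      coverVec 𝒜 e v * w * coverVec 𝒜 e v' ∈ C) {r : TensorCover 𝒜 e}
    (hr : r ∈ deepRelations 𝒜 e) (hr' : r ∈ coverDegree 𝒜 e (N + 2)) : r ∈ C := by
  have hI := isHomogeneous_relationIdeal 𝒜 e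
  have hM := isHomogeneous_augmentationIdeal 𝒜 e
  have hM₀ : ∀ t ∈ augmentationIdeal 𝒜 e, t ∈ coverDegree 𝒜 e 0 → t = 0 := fun t ht ht' => by
    rw [← proj_of_mem ht', proj_zero_of_mem_augmentationIdeal 𝒜 e ht]
  have key : deepRelations 𝒜 e ≤ C.comap (GradedAlgebra.proj (coverDegree 𝒜 e) (N + 2)) := by
    refine sup_le ?_ ?_
    · refine mul_le_of_isHomogeneous hI hI fun a b w hw hwa w' hw' hwb => ?_
      have hww := SetLike.mul_mem_graded hwa hwb
      rw [Submodule.mem_comap]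
      by_cases hab : a + b = N + 2
      · rw [proj_of_mem (hab ▸ hww)]
        rcases a with _ | a
        · rw [eq_zero_of_mem_relationIdeal_of_mem_zero 𝒜 e hw hwa, zero_mul]
          exact zero_mem _
        rcases b with _ | b
        · rw [eq_zero_of_mem_relationIdeal_of_mem_zero 𝒜 e hw' hwb, mul_zero]
          exact zero_mem _
        exact h₁ a b (by omega) w ⟨hw, hwa⟩ w' ⟨hw', hwb⟩
      · rw [proj_of_mem_ne hww hab]
        exact zero_mem _
    · rw [mul_assoc]
      refine mul_le_of_isHomogeneous hM (isHomogeneous_mul hI hM) fun i m t ht hti u hu hum => ?_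
      have hu' : u ∈ (C.comap (GradedAlgebra.proj (coverDegree 𝒜 e) (N + 2))).comap
          (LinearMap.mulLeft k t ∘ₗ GradedAlgebra.proj (coverDegree 𝒜 e) m) := by
        refine (mul_le_of_isHomogeneous hI hM fun j l w hw hwj t' ht' htl => ?_ :
          relationIdeal 𝒜 e * augmentationIdeal 𝒜 e ≤ _) hu
        have hwt := SetLike.mul_mem_graded hwj htl
        rw [Submodule.mem_comap, LinearMap.comp_apply, LinearMap.mulLeft_apply, Submodule.mem_comap]
        by_cases hjl : j + l = m
        · subst hjl
          rw [proj_of_mem hwt]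
          have htwt := SetLike.mul_mem_graded hti hwt
          by_cases hijl : i + (j + l) = N + 2
          · rw [hijl] at htwt
            rw [proj_of_mem htwt]
            rcases i with _ | i
            · rw [hM₀ t ht hti, zero_mul]
              exact zero_mem _
            rcases l with _ | l
            · rw [hM₀ t' ht' htl, mul_zero, mul_zero]
              exact zero_mem _
            -- One letter is kept at each end; the rest of the outer factors is absorbed into w by
            -- the ideal property.
            have h₃ : coverDegree 𝒜 e (i + 1) ≤ C.comap (LinearMap.mulRight k (w * t')) := by
              refine TensorRing.mem_degree_succ_induction' fun v t₀ ht₀ => ?_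
              have h₄ : coverDegree 𝒜 e (l + 1) ≤
                  C.comap (LinearMap.mulLeft k (coverVec 𝒜 e v * (t₀ * w))) := by
                refine TensorRing.mem_degree_succ_induction fun t₁ ht₁ v' => ?_
                rw [Submodule.mem_comap, LinearMap.mulLeft_apply, ← mul_assoc,
                  mul_assoc (coverVec 𝒜 e v)]
                refine h₂ v _ ?_ v'
                exact mul_mem_relationIdeal_inf' (mul_mem_relationIdeal_inf ht₀ ⟨hw, hwj⟩ rfl) ht₁
                  (by omega)
              have h₅ := h₄ htl
              rw [Submodule.mem_comap, LinearMap.mulLeft_apply] at h₅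
              rw [Submodule.mem_comap, LinearMap.mulRight_apply]
              simpa only [mul_assoc] using h₅
            exact h₃ hti
          · rw [proj_of_mem_ne htwt hijl]
            exact zero_mem _
        · rw [proj_of_mem_ne hwt hjl, mul_zero, map_zero]
          exact zero_mem _
      rw [Submodule.mem_comap, LinearMap.comp_apply, LinearMap.mulLeft_apply,
        proj_of_mem hum] at hu'
      exact hu'
  have := key hr
  rwa [Submodule.mem_comap, proj_of_mem hr'] at this

theorem isSubbimodule_inf {n : ℕ} :
    IsSubbimodule (coverScalar 𝒜 e) (relationIdeal 𝒜 e ⊓ coverDegree 𝒜 e n) :=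
  ⟨fun s _ hx => mul_mem_relationIdeal_inf (coverScalar_mem 𝒜 e s) hx (zero_add n),
    fun s _ hx => mul_mem_relationIdeal_inf' hx (coverScalar_mem 𝒜 e s) (add_zero n)⟩

theorem isSubbimodule_jacobiTerm (Q : Submodule k (TensorCover 𝒜 e)) (n : ℕ) :
    IsSubbimodule (coverScalar 𝒜 e) (jacobiTerm (coverDegree 𝒜 e) Q n) :=
  ⟨fun s _ hx => left_mul_mem_jacobiTerm (coverScalar_mem_upTo 𝒜 e s 0) hx (zero_add n).le,
    fun s _ hx => right_mul_mem_jacobiTerm hx (coverScalar_mem_upTo 𝒜 e s 0) le_rfl⟩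

theorem isSubbimodule_ker_proj (n : ℕ) :
    IsSubbimodule (coverScalar 𝒜 e) (LinearMap.ker (GradedAlgebra.proj (coverDegree 𝒜 e) n)) := by
  constructor
  · intro s x hx
    have h := proj_mul_of_mem_left (j := n) (coverScalar_mem 𝒜 e s) x
    rw [zero_add, LinearMap.mem_ker.1 hx, mul_zero] at h
    exact h
  · intro s x hx
    have h := proj_mul_of_mem_right (i := n) x (coverScalar_mem 𝒜 e s)
    rw [add_zero, LinearMap.mem_ker.1 hx, zero_mul] at h
    exact h

namespace IsFilteredMap

variable (hα : IsFilteredMap (coverScalar 𝒜 e) (coverDegree 𝒜 e) R α)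
  (hR : IsBimoduleOfRelations 𝒜 e R)
include hα hR

/-- If `Tor₃^A(S, S)` vanishes in degree `N + 2`, then `(𝒥_N)` implies `(𝒥_{N + 1})`. -/
theorem jacobi_succ {m : ℕ} {x y : Fin m → S} (h : IsCasimir k x y) {N : ℕ}
    (hJ : Jacobi (coverDegree 𝒜 e) (LinearMap.range α) N)
    (hdeep : ∀ r ∈ coverDegree 𝒜 e 1 * (relationIdeal 𝒜 e ⊓ coverDegree 𝒜 e (N + 1)),
      r ∈ (relationIdeal 𝒜 e ⊓ coverDegree 𝒜 e (N + 1)) * coverDegree 𝒜 e 1 →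
        r ∈ deepRelations 𝒜 e) :
    Jacobi (coverDegree 𝒜 e) (LinearMap.range α) (N + 1) := by
  set Q := LinearMap.range α with hQ
  set 𝒯 := coverDegree 𝒜 e with h𝒯
  set J := jacobiTerm 𝒯 Q with hJdef
  obtain ⟨g, hg, hgw⟩ := h.exists_bimodule_choice (coverScalar 𝒜 e)
    (W := relationIdeal 𝒜 e ⊓ 𝒯 (N + 1)) (X := J (N + 1))
    (Y := LinearMap.ker (GradedAlgebra.proj 𝒯 (N + 1))) isSubbimodule_inf
    (isSubbimodule_jacobiTerm Q (N + 1)) (isSubbimodule_ker_proj (N + 1)) (fun w hw => by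
      obtain ⟨z, hz, hzw⟩ := hα.exists_lift hR (N + 1) hw.1 hw.2
      refine ⟨z, hz, ?_⟩
      rw [LinearMap.mem_ker, map_sub, hzw, proj_of_mem hw.2, sub_self])
  have hgJ : ∀ w ∈ relationIdeal 𝒜 e ⊓ 𝒯 (N + 1), g w ∈ J (N + 1) := fun w hw => (hgw w hw).1
  have hgp : ∀ w ∈ relationIdeal 𝒜 e ⊓ 𝒯 (N + 1), GradedAlgebra.proj 𝒯 (N + 1) (g w) = w :=
    fun w hw => by
      have h₁ := LinearMap.mem_ker.1 (hgw w hw).2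
      rwa [map_sub, proj_of_mem hw.2, sub_eq_zero] at h₁
  -- This is how (J_N) is used: two lifts with the same leading term differ by an element of J N.
  have hlow : ∀ u ∈ J (N + 1), ∀ u' ∈ J (N + 1),
      GradedAlgebra.proj 𝒯 (N + 1) u = GradedAlgebra.proj 𝒯 (N + 1) u' → u - u' ∈ J N := by
    intro u hu u' hu' huu'
    refine hJ ⟨sub_mem hu hu', mem_upTo_of_proj_eq_zero
      (jacobiTerm_le_upTo _ (sub_mem hu hu')) ?_⟩
    rw [map_sub, huu', sub_self]
  have hvec : ∀ v, coverVec 𝒜 e v ∈ upTo 𝒯 1 := fun v => mem_upTo (coverVec_mem 𝒜 e v)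
  have hleft : ∀ v, ∀ u ∈ J N, coverVec 𝒜 e v * u ∈ J (N + 1) := fun v u hu =>
    left_mul_mem_jacobiTerm (hvec v) hu (by omega)
  have hright : ∀ v, ∀ u ∈ J N, u * coverVec 𝒜 e v ∈ J (N + 1) := fun v u hu =>
    right_mul_mem_jacobiTerm hu (hvec v) (by omega)
  -- `fl` and `fr` play the roles of id ⊗ g and g ⊗ id. They are well defined over S because g is a
  -- bimodule map.
  obtain ⟨fl, hfl⟩ := TensorRing.exists_map_vec_mul h hg
  obtain ⟨fr, hfr⟩ := TensorRing.exists_map_mul_vec h hg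
  have hl : ∀ a ∈ 𝒯 1 * J (N + 1), a - fl (GradedAlgebra.proj 𝒯 (N + 2) a) ∈ J (N + 1) := by
    have : 𝒯 1 * J (N + 1) ≤ (J (N + 1)).comap
        (LinearMap.id - fl ∘ₗ GradedAlgebra.proj 𝒯 (N + 2)) := by
      rw [show 𝒯 1 = _ from coverDegree_one 𝒜 e, Submodule.mul_le]
      rintro _ ⟨v, rfl⟩ u hu
      have hp : GradedAlgebra.proj 𝒯 (N + 2) (coverVec 𝒜 e v * u) =
          coverVec 𝒜 e v * GradedAlgebra.proj 𝒯 (N + 1) u := by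
        rw [show N + 2 = 1 + (N + 1) by omega]
        exact proj_mul_of_mem_left (coverVec_mem 𝒜 e v) u
      have hw : GradedAlgebra.proj 𝒯 (N + 1) u ∈ relationIdeal 𝒜 e ⊓ 𝒯 (N + 1) :=
        ⟨hα.proj_mem_relationIdeal hR hu, proj_mem _ _ _⟩
      rw [Submodule.mem_comap, LinearMap.sub_apply, LinearMap.id_apply, LinearMap.comp_apply]
      rw [hp, hfl, ← mul_sub]
      exact hleft v _ (hlow u hu _ (hgJ _ hw) (hgp _ hw).symm)
    exact fun a ha => this ha
  have hr : ∀ a ∈ J (N + 1) * 𝒯 1, a - fr (GradedAlgebra.proj 𝒯 (N + 2) a) ∈ J (N + 1) := by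
    have : J (N + 1) * 𝒯 1 ≤ (J (N + 1)).comap
        (LinearMap.id - fr ∘ₗ GradedAlgebra.proj 𝒯 (N + 2)) := by
      rw [show 𝒯 1 = _ from coverDegree_one 𝒜 e, Submodule.mul_le]
      rintro u hu _ ⟨v, rfl⟩
      have hp : GradedAlgebra.proj 𝒯 (N + 2) (u * coverVec 𝒜 e v) =
          GradedAlgebra.proj 𝒯 (N + 1) u * coverVec 𝒜 e v :=
        proj_mul_of_mem_right u (coverVec_mem 𝒜 e v)
      have hw : GradedAlgebra.proj 𝒯 (N + 1) u ∈ relationIdeal 𝒜 e ⊓ 𝒯 (N + 1) :=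
        ⟨hα.proj_mem_relationIdeal hR hu, proj_mem _ _ _⟩
      rw [Submodule.mem_comap, LinearMap.sub_apply, LinearMap.id_apply, LinearMap.comp_apply]
      rw [hp, hfr, ← sub_mul]
      exact hright v _ (hlow u hu _ (hgJ _ hw) (hgp _ hw).symm)
    exact fun a ha => this ha
  have hcompare : ∀ r ∈ deepRelations 𝒜 e, r ∈ 𝒯 (N + 2) → fl r - fr r ∈ J (N + 1) := by
    intro r hr hr'
    refine mem_of_mem_deepRelations (C := (J (N + 1)).comap (fl - fr)) ?_ ?_ hr hr'
    · intro a b hab w hw w' hw'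
      obtain ⟨z, hz, hzw⟩ := hα.exists_lift hR (a + 1) hw.1 hw.2
      obtain ⟨z', hz', hzw'⟩ := hα.exists_lift hR (b + 1) hw'.1 hw'.2
      have h₁ : fl (w * w') - w * z' ∈ J (N + 1) := by
        have : 𝒯 (a + 1) ≤ (J (N + 1)).comap
            (fl ∘ₗ LinearMap.mulRight k w' - LinearMap.mulRight k z') := by
          refine TensorRing.mem_degree_succ_induction' fun v t ht => ?_
          rw [Submodule.mem_comap, LinearMap.sub_apply, LinearMap.comp_apply,
            LinearMap.mulRight_apply, LinearMap.mulRight_apply, mul_assoc, mul_assoc, hfl,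
            ← mul_sub]
          have hw'' := mul_mem_relationIdeal_inf ht hw' (show a + (b + 1) = N + 1 by omega)
          refine hleft v _ (hlow _ (hgJ _ hw'') _
            (left_mul_mem_jacobiTerm (mem_upTo ht) hz' (by omega)) ?_)
          rw [hgp _ hw'', show N + 1 = a + (b + 1) by omega]
          refine (proj_mul_of_mem_left ht z').symm ▸ ?_
          rw [hzw']
        exact this hw.2
      have h₂ : fr (w * w') - z * w' ∈ J (N + 1) := by
        have : 𝒯 (b + 1) ≤ (J (N + 1)).comap
            (fr ∘ₗ LinearMap.mulLeft k w - LinearMap.mulLeft k z) := by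
          refine TensorRing.mem_degree_succ_induction fun t ht v => ?_
          rw [Submodule.mem_comap, LinearMap.sub_apply, LinearMap.comp_apply,
            LinearMap.mulLeft_apply, LinearMap.mulLeft_apply, ← mul_assoc, ← mul_assoc, hfr,
            ← sub_mul]
          have hw'' := mul_mem_relationIdeal_inf' hw ht (show (a + 1) + b = N + 1 by omega)
          refine hright v _ (hlow _ (hgJ _ hw'') _
            (right_mul_mem_jacobiTerm hz (mem_upTo ht) (by omega)) ?_)
          rw [hgp _ hw'', show N + 1 = (a + 1) + b by omega]
          refine (proj_mul_of_mem_right z ht).symm ▸ ?_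
          rw [hzw]
        exact this hw'.2
      -- The two lifts are represented by w z' and z w', and w z' - z w' = (w - z) z' + z (z' - w').
      -- Each difference has lost its leading term, which saves one degree.
      have h₃ : (w - z) * z' ∈ J (N + 1) := by
        refine left_mul_mem_jacobiTerm (m := a) (mem_upTo_of_proj_eq_zero
          (sub_mem (mem_upTo hw.2) (jacobiTerm_le_upTo _ hz)) ?_) hz' (by omega)
        rw [map_sub, hzw, proj_of_mem hw.2, sub_self]
      have h₄ : z * (z' - w') ∈ J (N + 1) := by
        refine right_mul_mem_jacobiTerm (m := b) hz (mem_upTo_of_proj_eq_zero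
          (sub_mem (jacobiTerm_le_upTo _ hz') (mem_upTo hw'.2)) ?_) (by omega)
        rw [map_sub, hzw', proj_of_mem hw'.2, sub_self]
      rw [Submodule.mem_comap, LinearMap.sub_apply]
      convert add_mem (sub_mem h₁ h₂) (add_mem h₃ h₄) using 1
      rw [sub_mul, mul_sub]
      abel
    -- Here both lifts are congruent to v z v', with z a lift of w.
    · intro v w hw v'
      obtain ⟨z, hz, hzw⟩ := hα.exists_lift hR N hw.1 hw.2
      have hwr := mul_mem_relationIdeal_inf' hw (coverVec_mem 𝒜 e v') rfl
      have hwl := mul_mem_relationIdeal_inf (coverVec_mem 𝒜 e v) hw (add_comm 1 N)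
      have h₁ : fl (coverVec 𝒜 e v * w * coverVec 𝒜 e v') -
          coverVec 𝒜 e v * z * coverVec 𝒜 e v' ∈ J (N + 1) := by
        rw [mul_assoc, mul_assoc, hfl, ← mul_sub]
        refine hleft v _ (hlow _ (hgJ _ hwr) _ (hright v' z hz) ?_)
        rw [hgp _ hwr]
        refine (proj_mul_of_mem_right z (coverVec_mem 𝒜 e v')).symm ▸ ?_
        rw [hzw]
      have h₂ : fr (coverVec 𝒜 e v * w * coverVec 𝒜 e v') -
          coverVec 𝒜 e v * z * coverVec 𝒜 e v' ∈ J (N + 1) := by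
        rw [hfr, ← sub_mul]
        refine hright v' _ (hlow _ (hgJ _ hwl) _ (hleft v z hz) ?_)
        rw [hgp _ hwl, add_comm N 1]
        refine (proj_mul_of_mem_left (coverVec_mem 𝒜 e v) z).symm ▸ ?_
        rw [hzw]
      rw [Submodule.mem_comap, LinearMap.sub_apply]
      convert sub_mem h₁ h₂ using 1
      abel
  rintro u ⟨hu, hu'⟩
  obtain ⟨_, hab, _, hrq, rfl⟩ := Submodule.mem_sup.1 (hα.jacobiTerm_succ_le hR (N + 1) hu)
  obtain ⟨a, ha, b, hb, rfl⟩ := Submodule.mem_sup.1 hab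
  obtain ⟨_, ⟨r, hrN, rfl⟩, q, hq, rfl⟩ := Submodule.mem_sup.1 hrq
  have hpa : GradedAlgebra.proj 𝒯 (N + 2) a ∈
      𝒯 1 * (relationIdeal 𝒜 e ⊓ 𝒯 (N + 1)) := by
    have : 𝒯 1 * J (N + 1) ≤ (𝒯 1 * (relationIdeal 𝒜 e ⊓ 𝒯 (N + 1))).comap
        (GradedAlgebra.proj 𝒯 (N + 2)) := by
      rw [Submodule.mul_le]
      intro v hv z hz
      rw [Submodule.mem_comap, show N + 2 = 1 + (N + 1) by omega, proj_mul_of_mem_left hv z]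
      exact Submodule.mul_mem_mul hv ⟨hα.proj_mem_relationIdeal hR hz, proj_mem _ _ _⟩
    exact this ha
  have hpb : GradedAlgebra.proj 𝒯 (N + 2) b ∈
      (relationIdeal 𝒜 e ⊓ 𝒯 (N + 1)) * 𝒯 1 := by
    have : J (N + 1) * 𝒯 1 ≤ ((relationIdeal 𝒜 e ⊓ 𝒯 (N + 1)) * 𝒯 1).comap
        (GradedAlgebra.proj 𝒯 (N + 2)) := by
      rw [Submodule.mul_le]
      intro z hz v hv
      rw [Submodule.mem_comap, show N + 2 = (N + 1) + 1 by omega, proj_mul_of_mem_right z hv]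
      exact Submodule.mul_mem_mul ⟨hα.proj_mem_relationIdeal hR hz, proj_mem _ _ _⟩ hv
    exact this hb
  have hsum : GradedAlgebra.proj 𝒯 (N + 2) a + GradedAlgebra.proj 𝒯 (N + 2) b + r = 0 := by
    have h₁ := proj_eq_zero_of_mem_upTo hu' (Nat.lt_succ_self (N + 1))
    rw [map_add, map_add, map_add, hα.component_zero (N + 2) r hrN,
      proj_eq_zero_of_mem_upTo (jacobiTerm_le_upTo (N + 1) hq) (Nat.lt_succ_self (N + 1)),
      add_zero] at h₁
    exact h₁
  -- The relation r is minus the sum of the leading terms of a and b, so it lies in I_A T_A¹ + T_A¹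
  -- I_A, which meets R trivially.
  have hr0 : r = 0 := by
    have h₁ : (r : TensorCover 𝒜 e) ∈ R ⊓ decomposableRelations 𝒜 e := by
      refine ⟨r.2, ?_⟩
      have h₂ : (r : TensorCover 𝒜 e) =
          -(GradedAlgebra.proj 𝒯 (N + 2) b + GradedAlgebra.proj 𝒯 (N + 2) a) := by
        rw [add_comm (GradedAlgebra.proj 𝒯 (N + 2) b)]
        exact eq_neg_of_add_eq_zero_right hsum
      rw [h₂]
      refine neg_mem (Submodule.add_mem_sup ?_ ?_)
      · exact (mul_le_mul_left inf_le_left _ : _ ≤ relationIdeal 𝒜 e * 𝒯 1) hpb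
      · exact (mul_le_mul_right inf_le_left _ : _ ≤ 𝒯 1 * relationIdeal 𝒜 e) hpa
    rw [hR.inf_eq] at h₁
    exact Subtype.ext ((Submodule.mem_bot k).1 h₁)
  subst hr0
  have hneg : GradedAlgebra.proj 𝒯 (N + 2) b = -GradedAlgebra.proj 𝒯 (N + 2) a := by
    rw [Submodule.coe_zero, add_zero] at hsum
    exact eq_neg_of_add_eq_zero_right hsum
  have hpa' : GradedAlgebra.proj 𝒯 (N + 2) a ∈
      (relationIdeal 𝒜 e ⊓ 𝒯 (N + 1)) * 𝒯 1 := by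
    rw [hneg, neg_mem_iff] at hpb
    exact hpb
  have h₁ := hcompare _ (hdeep _ hpa hpa') (proj_mem _ _ _)
  have h₂ := hl a ha
  have h₃ := hr b hb
  rw [hneg, map_neg] at h₃
  rw [map_zero, zero_add]
  -- With p the projection to degree N + 2 and p(b) = -p(a), a + b is the sum of (fl - fr)(p(a)), a
  -- - fl(p(a)) and b + fr(p(a)).
  convert add_mem (add_mem h₁ (add_mem h₂ h₃)) hq using 1
  abel

end IsFilteredMap

end JacobiStep

/-! ### Existence of R and α, and the two implications. -/

section Main

variable {k S A : Type*} [Field k] [Ring S] [Algebra k S] [Ring A] [Algebra k A]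
  {𝒜 : ℕ → Submodule k A} [GradedAlgebra 𝒜] {e : S ≃ₐ[k] 𝒜 0} {m : ℕ} {x y : Fin m → S}

variable (𝒜 e) in
theorem decomposableRelations_le : decomposableRelations 𝒜 e ≤ relationIdeal 𝒜 e := by
  refine sup_le ?_ ?_
  · rw [Submodule.mul_le]
    exact fun w hw t _ => mul_mem_relationIdeal_right hw t
  · rw [Submodule.mul_le]
    exact fun t _ w hw => mul_mem_relationIdeal_left t hw

variable (𝒜 e) in
theorem isHomogeneous_decomposableRelations :
    DirectSum.SetLike.IsHomogeneous (coverDegree 𝒜 e) (decomposableRelations 𝒜 e) :=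
  isHomogeneous_sup
    (isHomogeneous_mul (isHomogeneous_relationIdeal 𝒜 e) (isHomogeneous_degree 1))
    (isHomogeneous_mul (isHomogeneous_degree 1) (isHomogeneous_relationIdeal 𝒜 e))

variable (𝒜 e) in
theorem isSubbimodule_decomposableRelations :
    IsSubbimodule (coverScalar 𝒜 e) (decomposableRelations 𝒜 e) := by
  have h₁ : relationIdeal 𝒜 e * coverDegree 𝒜 e 1 ≤ decomposableRelations 𝒜 e := le_sup_left
  have h₂ : coverDegree 𝒜 e 1 * relationIdeal 𝒜 e ≤ decomposableRelations 𝒜 e := le_sup_right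
  constructor
  · intro s
    suffices h : decomposableRelations 𝒜 e ≤
        (decomposableRelations 𝒜 e).comap (LinearMap.mulLeft k (coverScalar 𝒜 e s)) from
      fun _ hx => h hx
    refine sup_le ?_ ?_
    · rw [Submodule.mul_le]
      intro w hw v hv
      rw [Submodule.mem_comap, LinearMap.mulLeft_apply, ← mul_assoc]
      exact h₁ (Submodule.mul_mem_mul (mul_mem_relationIdeal_left _ hw) hv)
    · rw [Submodule.mul_le]
      intro v hv w hw
      rw [Submodule.mem_comap, LinearMap.mulLeft_apply, ← mul_assoc]
      have := SetLike.mul_mem_graded (coverScalar_mem 𝒜 e s) hv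
      rw [zero_add] at this
      exact h₂ (Submodule.mul_mem_mul this hw)
  · intro s
    suffices h : decomposableRelations 𝒜 e ≤
        (decomposableRelations 𝒜 e).comap (LinearMap.mulRight k (coverScalar 𝒜 e s)) from
      fun _ hx => h hx
    refine sup_le ?_ ?_
    · rw [Submodule.mul_le]
      intro w hw v hv
      rw [Submodule.mem_comap, LinearMap.mulRight_apply, mul_assoc]
      have := SetLike.mul_mem_graded hv (coverScalar_mem 𝒜 e s)
      rw [add_zero] at this
      exact h₁ (Submodule.mul_mem_mul hw this)
    · rw [Submodule.mul_le]
      intro v hv w hw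
      rw [Submodule.mem_comap, LinearMap.mulRight_apply, mul_assoc]
      exact h₂ (Submodule.mul_mem_mul hv (mul_mem_relationIdeal_right hw _))

variable (𝒜 e) in
-- A graded bimodule complement is cut out by the kernel of a graded bimodule projection onto the
-- decomposable relations: average a linear retraction, then keep its degree-preserving part.
theorem IsCasimir.exists_isBimoduleOfRelations (h : IsCasimir k x y) :
    ∃ R : Submodule k (TensorCover 𝒜 e), IsBimoduleOfRelations 𝒜 e R := by
  set D := decomposableRelations 𝒜 e with hD
  set 𝒯 := coverDegree 𝒜 e with h𝒯
  have hDs : IsSubbimodule (coverScalar 𝒜 e) D := isSubbimodule_decomposableRelations 𝒜 e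
  have hDh : ∀ n, ∀ d ∈ D, GradedAlgebra.proj 𝒯 n d ∈ D := isHomogeneous_decomposableRelations 𝒜 e
  obtain ⟨p, hp⟩ := LinearMap.exists_leftInverse_of_injective D.subtype
    (LinearMap.ker_eq_bot.2 D.subtype_injective)
  have hp : ∀ d : D, p d = d := fun d => DFunLike.congr_fun hp d
  let q₁ := average (coverScalar 𝒜 e) (coverScalar 𝒜 e) x y (D.subtype ∘ₗ p)
  have hq₁ : IsBimoduleMap (coverScalar 𝒜 e) (coverScalar 𝒜 e) q₁ := h.isBimoduleMap_average _ _ _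
  have hq₁D : ∀ t, q₁ t ∈ D := fun t => average_mem _ _ _ hDs fun _ _ => SetLike.coe_mem _
  have hq₁id : ∀ d ∈ D, q₁ d = d := fun d hd => h.average_eq _ _ _ _ _ fun s t => by
    have := hp ⟨_, hDs.smul_mem s _ (hDs.mul_mem t d hd)⟩
    exact congrArg Subtype.val this
  -- Homogeneity of D ensures that the degree-preserving part still has values in D and fixes D.
  let q := gradedGlue 𝒯 fun n => GradedAlgebra.proj 𝒯 n ∘ₗ q₁
  have hq : ∀ n, ∀ t ∈ 𝒯 n, q t = GradedAlgebra.proj 𝒯 n (q₁ t) :=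
    fun n t ht => gradedGlue_of_mem _ ht
  have hqb : IsBimoduleMap (coverScalar 𝒜 e) (coverScalar 𝒜 e) q := by
    refine isBimoduleMap_gradedGlue _ (coverScalar_mem 𝒜 e) fun n => ⟨fun s b => ?_, fun s b => ?_⟩
    · have := proj_mul_of_mem_left (j := n) (coverScalar_mem 𝒜 e s) (q₁ b)
      rw [zero_add] at this
      rw [LinearMap.comp_apply, hq₁.map_smul, LinearMap.comp_apply]
      exact this
    · have := proj_mul_of_mem_right (i := n) (q₁ b) (coverScalar_mem 𝒜 e s)
      rw [add_zero] at this
      rw [LinearMap.comp_apply, hq₁.map_mul, LinearMap.comp_apply]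
      exact this
  have hqD : ∀ t, q t ∈ D := fun t =>
    mem_of_forall_proj_mem 𝒯 (C := D.comap q) (x := t) fun n => by
      rw [Submodule.mem_comap, hq n _ (proj_mem 𝒯 n t)]
      exact hDh n _ (hq₁D _)
  have hqid : ∀ d ∈ D, q d = d := fun d hd => by
    have : d ∈ LinearMap.ker (q - LinearMap.id) := mem_of_forall_proj_mem 𝒯 fun n => by
      rw [LinearMap.mem_ker, LinearMap.sub_apply, hq n _ (proj_mem 𝒯 n d), hq₁id _ (hDh n d hd),
        proj_proj, LinearMap.id_apply, sub_self]
    exact sub_eq_zero.1 (LinearMap.mem_ker.1 this)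
  have hqproj : ∀ n t, q (GradedAlgebra.proj 𝒯 n t) = GradedAlgebra.proj 𝒯 n (q t) := by
    intro n t
    induction t using DirectSum.Decomposition.inductionOn 𝒯 with
    | zero => simp
    | @homogeneous i t =>
      by_cases hi : i = n
      · subst hi
        rw [proj_of_mem t.2, hq i t t.2, proj_proj]
      · rw [proj_of_mem_ne t.2 hi, map_zero, hq i t t.2, proj_of_mem_ne (proj_mem 𝒯 i _) hi]
    | add t u ht hu => simp only [map_add, ht, hu]
  refine ⟨relationIdeal 𝒜 e ⊓ LinearMap.ker q, ⟨⟨?_, ?_⟩, ?_, ?_, ?_⟩⟩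
  · rintro s w ⟨hw, hw'⟩
    refine ⟨mul_mem_relationIdeal_left _ hw, ?_⟩
    have hw'' : q w = 0 := hw'
    exact (hqb.map_smul s w).trans (by rw [hw'', mul_zero])
  · rintro s w ⟨hw, hw'⟩
    refine ⟨mul_mem_relationIdeal_right hw _, ?_⟩
    have hw'' : q w = 0 := hw'
    exact (hqb.map_mul s w).trans (by rw [hw'', zero_mul])
  · rw [isHomogeneous_iff]
    rintro n w ⟨hw, hw'⟩
    refine ⟨isHomogeneous_relationIdeal 𝒜 e n hw, ?_⟩
    have hw'' : q w = 0 := hw'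
    exact (hqproj n w).trans (by rw [hw'', map_zero])
  · rw [eq_bot_iff]
    rintro w ⟨⟨-, hw⟩, hwD⟩
    exact (Submodule.mem_bot k).2 ((hqid w hwD).symm.trans hw)
  · refine le_antisymm (sup_le inf_le_left (decomposableRelations_le 𝒜 e)) fun w hw => ?_
    rw [← sub_add_cancel w (q w)]
    refine Submodule.add_mem_sup ⟨sub_mem hw (decomposableRelations_le 𝒜 e (hqD w)), ?_⟩ (hqD w)
    rw [SetLike.mem_coe, LinearMap.mem_ker, map_sub, hqid _ (hqD w), sub_self]

variable {R P : Submodule k (TensorCover 𝒜 e)}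

/-- Each element of R of degree n is the leading term of an element of P^{≤n}. These are chosen
S-bilinearly for every n and glued along the grading of R. -/
theorem IsBimoduleOfRelations.exists_isFilteredMap (h : IsCasimir k x y)
    (hR : IsBimoduleOfRelations 𝒜 e R) (hP : IsSubbimodule (coverScalar 𝒜 e) P)
    (hRP : R ≤ leading (coverDegree 𝒜 e) P) :
    ∃ α : R →ₗ[k] TensorCover 𝒜 e,
      IsFilteredMap (coverScalar 𝒜 e) (coverDegree 𝒜 e) R α ∧ LinearMap.range α ≤ P := by
  set 𝒯 := coverDegree 𝒜 e with h𝒯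
  have key : ∀ n, ∃ g : TensorCover 𝒜 e →ₗ[k] TensorCover 𝒜 e,
      IsBimoduleMap (coverScalar 𝒜 e) (coverScalar 𝒜 e) g ∧ ∀ w ∈ R ⊓ 𝒯 n,
        g w ∈ P ⊓ upTo 𝒯 n ∧ g w - w ∈ LinearMap.ker (GradedAlgebra.proj 𝒯 n) := by
    intro n
    refine h.exists_bimodule_choice (coverScalar 𝒜 e) ⟨?_, ?_⟩ ⟨?_, ?_⟩
      (isSubbimodule_ker_proj n) ?_
    · rintro s w ⟨hw, hw'⟩
      have := SetLike.mul_mem_graded (coverScalar_mem 𝒜 e s) hw'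
      rw [zero_add] at this
      exact ⟨hR.isSubbimodule.smul_mem s w hw, this⟩
    · rintro s w ⟨hw, hw'⟩
      have := SetLike.mul_mem_graded hw' (coverScalar_mem 𝒜 e s)
      rw [add_zero] at this
      exact ⟨hR.isSubbimodule.mul_mem s w hw, this⟩
    · rintro s w ⟨hw, hw'⟩
      exact ⟨hP.smul_mem s w hw,
        mul_mem_upTo (coverScalar_mem_upTo 𝒜 e s 0) hw' (zero_add n).le⟩
    · rintro s w ⟨hw, hw'⟩
      exact ⟨hP.mul_mem s w hw, mul_mem_upTo hw' (coverScalar_mem_upTo 𝒜 e s 0) le_rfl⟩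
    · rintro w ⟨hw, hw'⟩
      obtain ⟨z, hz, hzw⟩ := proj_mem_leadingPart 𝒯 (n := n) (hRP hw)
      rw [proj_of_mem hw'] at hzw
      refine ⟨z, hz, ?_⟩
      rw [LinearMap.mem_ker, map_sub, hzw, proj_of_mem hw', sub_self]
  choose g hg hgw using key
  have hG : ∀ n, ∀ w ∈ R ⊓ 𝒯 n, gradedGlue 𝒯 g w = g n w := fun n w hw =>
    gradedGlue_of_mem g hw.2
  have hGb := isBimoduleMap_gradedGlue (coverScalar 𝒜 e) (coverScalar_mem 𝒜 e) hg
  have hproj : ∀ n, ∀ r ∈ R, GradedAlgebra.proj 𝒯 n r ∈ R ⊓ 𝒯 n := fun n r hr =>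
    ⟨hR.proj_mem n hr, PBW.proj_mem 𝒯 n r⟩
  refine ⟨gradedGlue 𝒯 g ∘ₗ R.subtype, ⟨?_, ?_, ?_, ?_⟩, ?_⟩
  · intro s r r' hr
    rw [LinearMap.comp_apply, LinearMap.comp_apply, Submodule.subtype_apply, hr]
    exact hGb.map_smul s r
  · intro s r r' hr
    rw [LinearMap.comp_apply, LinearMap.comp_apply, Submodule.subtype_apply, hr]
    exact hGb.map_mul s r
  · intro n r hr
    refine mem_of_forall_proj_mem 𝒯 (C := (upTo 𝒯 n).comap (gradedGlue 𝒯 g))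
      (x := (r : TensorCover 𝒜 e)) fun i => ?_
    rw [Submodule.mem_comap]
    rcases le_or_gt i n with hi | hi
    · rw [hG i _ (hproj i r r.2)]
      exact upTo_mono 𝒯 hi (hgw i _ (hproj i r r.2)).1.2
    · rw [proj_eq_zero_of_mem_upTo hr hi, map_zero]
      exact zero_mem _
  · intro n r hr
    have h₁ := LinearMap.mem_ker.1 (hgw n r ⟨r.2, hr⟩).2
    rw [map_sub, proj_of_mem hr, sub_eq_zero] at h₁
    rw [LinearMap.comp_apply, Submodule.subtype_apply, hG n _ ⟨r.2, hr⟩]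
    exact h₁
  · rintro _ ⟨r, rfl⟩
    refine mem_of_forall_proj_mem 𝒯 (C := P.comap (gradedGlue 𝒯 g))
      (x := (r : TensorCover 𝒜 e)) fun i => ?_
    rw [Submodule.mem_comap, hG i _ (hproj i r r.2)]
    exact (hgw i _ (hproj i r r.2)).1.1

theorem IsPBWDeformation.idealOf_eq (h : IsPBWDeformation (coverDegree 𝒜 e) P R)
    (hRP : R ≤ leading (coverDegree 𝒜 e) P) :
    idealOf R = idealOf (leading (coverDegree 𝒜 e) P) := by
  refine le_antisymm (TwoSidedIdeal.span_mono hRP) (TwoSidedIdeal.span_le.2 fun r hr => ?_)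
  have : leading (coverDegree 𝒜 e) P ≤ LinearMap.ker (toQuotient R).toLinearMap := by
    refine iSup_le fun n => ?_
    rintro _ ⟨z, ⟨hz, hz'⟩, rfl⟩
    exact toQuotient_eq_zero_iff.2 (h.proj_mem_idealOf (TwoSidedIdeal.subset_span hz) hz')
  exact toQuotient_eq_zero_iff.1 (this hr)

/-- If `U(P)` is a PBW-deformation and `α(R) ⊆ P`, then `⟨P⟩ ∩ T^{≤ n} ⊆ α(R)_n`. -/
theorem IsPBWDeformation.mem_jacobiTerm (h : IsPBWDeformation (coverDegree 𝒜 e) P R)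
    (hR : IsBimoduleOfRelations 𝒜 e R) {α : R →ₗ[k] TensorCover 𝒜 e}
    (hα : IsFilteredMap (coverScalar 𝒜 e) (coverDegree 𝒜 e) R α) (hαP : LinearMap.range α ≤ P)
    {n : ℕ} {t : TensorCover 𝒜 e} (ht : t ∈ idealOf P) (htn : t ∈ upTo (coverDegree 𝒜 e) n) :
    t ∈ jacobiTerm (coverDegree 𝒜 e) (LinearMap.range α) n := by
  induction n generalizing t with
  | zero =>
    have h₁ := hR.mem_idealOf_iff.1 (h.proj_mem_idealOf ht htn)
    have h₂ := mem_of_mem_upTo_zero htn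
    rw [proj_of_mem h₂] at h₁
    rw [eq_zero_of_mem_relationIdeal_of_mem_zero 𝒜 e h₁ h₂]
    exact zero_mem _
  | succ n ih =>
    -- The leading term of t lies in ⟨R⟩ = I_A; subtracting a lift leaves an element of ⟨P⟩ of lower
    -- filtration.
    obtain ⟨z, hz, hzt⟩ := hα.exists_lift hR (n + 1)
      (hR.mem_idealOf_iff.1 (h.proj_mem_idealOf ht htn)) (proj_mem _ _ _)
    have hzP : z ∈ idealOf P :=
      TwoSidedIdeal.span_mono (SetLike.coe_subset_coe.2 hαP) (mem_idealOf_of_mem_jacobiTerm hz)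
    have h₁ : t - z ∈ upTo (coverDegree 𝒜 e) n := by
      refine mem_upTo_of_proj_eq_zero (sub_mem htn (jacobiTerm_le_upTo _ hz)) ?_
      rw [map_sub, hzt, sub_self]
    have h₂ := ih (sub_mem ht hzP) h₁
    rw [← sub_add_cancel t z]
    exact add_mem (jacobiTerm_mono (Nat.le_succ n) h₂) hz

/-- The two inclusions give ⟨P⟩ = ⟨α(R)⟩, and the Jacobi conditions identify its part in T^{≤n} with
α(R)_n, whose leading terms in degree n are those of I_A = ⟨R⟩. -/
theorem isPBWDeformation_of_jacobi (hR : IsBimoduleOfRelations 𝒜 e R)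
    {α : R →ₗ[k] TensorCover 𝒜 e}
    (hα : IsFilteredMap (coverScalar 𝒜 e) (coverDegree 𝒜 e) R α) (hαP : LinearMap.range α ≤ P)
    (hPα : ∀ t ∈ P, t ∈ idealOf (LinearMap.range α))
    (hJ : ∀ n, Jacobi (coverDegree 𝒜 e) (LinearMap.range α) n) :
    IsPBWDeformation (coverDegree 𝒜 e) P R := by
  refine isPBWDeformation_of_forall fun t => ⟨fun ht n => ?_, fun ht => ?_⟩
  · have ht' := isHomogeneous_relationIdeal 𝒜 e n (hR.mem_idealOf_iff.1 ht)
    obtain ⟨z, hz, hzt⟩ := hα.exists_lift hR n ht' (proj_mem _ n t)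
    exact ⟨z, TwoSidedIdeal.span_mono (SetLike.coe_subset_coe.2 hαP)
      (mem_idealOf_of_mem_jacobiTerm hz), jacobiTerm_le_upTo n hz, hzt⟩
  · rw [hR.mem_idealOf_iff]
    refine mem_of_forall_proj_mem (coverDegree 𝒜 e) fun n => ?_
    obtain ⟨z, hz, hzn, hzt⟩ := ht n
    have hz' : z ∈ idealOf (LinearMap.range α) := TwoSidedIdeal.span_le.2 hPα hz
    rw [← hzt]
    exact hα.proj_mem_relationIdeal hR (mem_jacobiTerm_of_mem_upTo hJ hz' hzn)

theorem le_homologicalComplexity {n : ℕ}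
    (h : ¬ Subsingleton (TorThree 𝒜 e (n + 1))) :
    homologicalComplexity 𝒜 e ≠ -1 ∧ (n : EReal) ≤ homologicalComplexity 𝒜 e := by
  have hle : (n : EReal) ≤ homologicalComplexity 𝒜 e := by
    rw [homologicalComplexity, if_neg fun h' => h (h' (n + 1))]
    refine le_sSup ⟨n + 1, not_subsingleton_iff_nontrivial.1 h, ?_⟩
    rw [Nat.cast_add, Nat.cast_one]
    exact (EReal.add_sub_cancel_right (b := 1)).symm
  refine ⟨fun h' => ?_, hle⟩
  rw [h'] at hle
  have h₁ : (-1 : EReal) < n := by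
    have : ((-1 : ℝ) : EReal) < ((n : ℝ) : EReal) := by
      rw [EReal.coe_lt_coe_iff]
      have : (0 : ℝ) ≤ n := Nat.cast_nonneg n
      linarith
    simpa using this
  exact absurd hle (not_le.2 h₁)

end Main

end PBW

end

theorem mainTheorem12 {k S A : Type*} [Field k] [Ring S] [Algebra k S] [Ring A] [Algebra k A]
    (𝒜 : ℕ → Submodule k A) [GradedAlgebra 𝒜] (e : S ≃ₐ[k] 𝒜 0)
    (hS : PBW.IsSeparableAlgebra k S) (hA : PBW.IsStronglyGraded 𝒜) :
    (∃ R : Submodule k (PBW.TensorCover 𝒜 e), PBW.IsBimoduleOfRelations 𝒜 e R) ∧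
    ∀ R : Submodule k (PBW.TensorCover 𝒜 e), PBW.IsBimoduleOfRelations 𝒜 e R →
      ∀ P : Submodule k (PBW.TensorCover 𝒜 e),
        PBW.IsSubbimodule (PBW.coverScalar 𝒜 e) P →
        R ≤ PBW.leading (PBW.coverDegree 𝒜 e) P →
        (PBW.IsPBWDeformation (PBW.coverDegree 𝒜 e) P R ↔
          PBW.idealOf R = PBW.idealOf (PBW.leading (PBW.coverDegree 𝒜 e) P) ∧
          ∃ α : R →ₗ[k] PBW.TensorCover 𝒜 e,
            PBW.IsFilteredMap (PBW.coverScalar 𝒜 e) (PBW.coverDegree 𝒜 e) R α ∧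
            LinearMap.range α ≤ P ∧
            (∀ x ∈ P, x ∈ PBW.idealOf (LinearMap.range α)) ∧
            (PBW.homologicalComplexity 𝒜 e = -1 ∨
              ∀ n : ℕ, 1 ≤ n → (n : EReal) ≤ PBW.homologicalComplexity 𝒜 e →
                PBW.Jacobi (PBW.coverDegree 𝒜 e) (LinearMap.range α) n)) := by
  obtain ⟨m, x, y, h⟩ := hS.exists_isCasimir
  refine ⟨h.exists_isBimoduleOfRelations 𝒜 e, fun R hR P hP hRP => ⟨fun hPBW => ?_, ?_⟩⟩
  · obtain ⟨α, hα, hαP⟩ := hR.exists_isFilteredMap h hP hRP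
    have key : ∀ n, ∀ t ∈ PBW.idealOf P, t ∈ PBW.upTo (PBW.coverDegree 𝒜 e) n →
        t ∈ PBW.jacobiTerm (PBW.coverDegree 𝒜 e) (LinearMap.range α) n :=
      fun n t ht htn => hPBW.mem_jacobiTerm hR hα hαP ht htn
    refine ⟨hPBW.idealOf_eq hRP, α, hα, hαP, fun t ht => ?_, Or.inr fun n _ _ => ?_⟩
    · obtain ⟨n, hn⟩ := PBW.exists_mem_upTo (PBW.coverDegree 𝒜 e) t
      exact PBW.mem_idealOf_of_mem_jacobiTerm (key n t (TwoSidedIdeal.subset_span ht) hn)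
    · rintro t ⟨ht, htn⟩
      exact key n t (TwoSidedIdeal.span_mono (SetLike.coe_subset_coe.2 hαP)
        (PBW.mem_idealOf_of_mem_jacobiTerm ht)) htn
  · rintro ⟨-, α, hα, hαP, hPα, hc⟩
    refine PBW.isPBWDeformation_of_jacobi hR hα hαP hPα fun n => ?_
    induction n with
    | zero => exact hα.jacobi_zero hR
    | succ n ih =>
      -- If Tor_3 is nonzero in degree n + 2, then n + 1 ≤ c(A) and (J_{n+1}) is among the
      -- hypotheses; otherwise it follows from (J_n).
      by_cases hTor : Subsingleton (PBW.TorThree 𝒜 e (n + 1 + 1))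
      · exact hα.jacobi_succ hR h ih fun r hl hr => PBW.mem_deepRelations 𝒜 e hA h hTor hl hr
      · obtain ⟨h₁, h₂⟩ := PBW.le_homologicalComplexity hTor
        exact (hc.resolve_left h₁) (n + 1) (Nat.le_add_left 1 n) h₂
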